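/- **Theorem 3.3 (blow-up from small data).** Fix $\psi\in\mathcal S(\mathbb R^3)$ generating a Littlewood–Paley decomposition, that is, $\operatorname{supp}\widehat\psi\subset\{3/5\le|\xi|\le 5/3\}$ and $\sum_{j\in\mathbb Z}\widehat{\psi_j}(\xi)=1$ for all $\xi\neq0$, where $\psi_j(x)=2^{3j}\psi(2^jx)$ and $\widehat f(\xi)=\int e^{-ix\cdot\xi}f(x)\,dx$. For $s\in\mathbb R$ and $1\le p,q\le\infty$ let $$\|f\|_{\dot B^{s,q}_p}=\Big(\sum_{j\in\mathbb Z}\big(2^{js}\|\psi_j*f\|_{L^p}\big)^q\Big)^{1/q},$$ with the supremum over $j$ in place of the sum if $q=\infty$. For a real-valued $u_0\in\mathcal S(\mathbb R^3)$ and $0<T<\infty$, a *Weissler solution* on $[0,T]$ of the cubic heat equation $\partial_tu=\Delta u+u^3$ on $\mathbb R^3$ with datum $u_0$ is a function $u\in C([0,T],L^3(\mathbb R^3))\cap L^\infty_{loc}((0,T],L^\infty(\mathbb R^3))$ with $u(0)=u_0$ and $$u(t)=e^{t\Delta}u_0+\int_0^te^{(t-\tau)\Delta}u(\tau)^3\,d\tau\qquad(0<t\le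 T).$$ Let $\delta>0$ and $3<q_0\le\infty$. Then there are a real-valued $u_0\in\mathcal S(\mathbb R^3)$, a time $T^*$ with $0<T^*<\delta$, and a function $u$ on $[0,T^*)$ such that: 1. $u$ is the unique maximal Weissler solution with datum $u_0$, and its lifespan is $T^*$: $u$ is a Weissler solution on $[0,T]$ for every $0<T<T^*$, and any Weissler solution on an interval $[0,T]$ with datum $u_0$ satisfies $T<T^*$ and coincides with $u$ on $[0,T]$; 2. $u$ blows up at $T^*$: $\|u(t)\|_{L^\infty}\to\infty$ as $t\uparrow T^*$; 3. $\|u_0\|_{\dot B^{-2/3,q}_9}\le\delta$ for all $q$ with $q_0\le q\le\infty$; 4. $\|u_0\|_{\dot B^{-1,\infty}_\infty}\le\delta$. In particular (take $q=\infty$), for $p=9$ no smallness condition on $\|u_0\|_{\dot B^{-\sigma,\infty}_p}$, $\sigma=1-3/p$, guarantees a global solution. -/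

import Mathlib

open MeasureTheory Set Filter Topology
open scoped ENNReal NNReal SchwartzMap FourierTransform

namespace CubicHeat

/-- The Euclidean space `ℝ³`. -/
abbrev E3 : Type := EuclideanSpace ℝ (Fin 3)

instance fact_one_le_three : Fact ((1 : ℝ≥0∞) ≤ 3) := ⟨by norm_num⟩

/-- The heat kernel of `ℝ³`, `G_t(x) = (4πt)^{-3/2} exp(-|x|²/(4t))` for `t > 0`. -/
noncomputable def heatKernel (t : ℝ) (x : E3) : ℝ :=
  (4 * Real.pi * t) ^ (-(3 / 2) : ℝ) * Real.exp (-‖x‖ ^ 2 / (4 * t))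

/-- The heat semigroup for `t > 0`: `(e^{tΔ} f)(x) = ∫ G_t(x - y) f(y) dy`. -/
noncomputable def heat (t : ℝ) (f : E3 → ℝ) (x : E3) : ℝ :=
  ∫ y, heatKernel t (x - y) * f y

/-- `u` is a Weissler solution on the closed interval `[0,T]` of the cubic heat equation
`∂_t u = Δu + u³`, `u(0) = u₀`: it belongs to `C([0,T], L³) ∩ L^∞_loc((0,T], L^∞)` and satisfies
`u(t) = e^{tΔ} u₀ + ∫_0^t e^{(t-τ)Δ} u(τ)³ dτ` (almost everywhere in `x`) for `0 < t ≤ T`. Values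
of `u` outside `[0,T]` play no role. -/
structure IsWeisslerSolution (u₀ : 𝓢(E3, ℝ)) (T : ℝ)
    (u : ℝ → Lp ℝ 3 (volume : Measure E3)) : Prop where
  pos : 0 < T
  continuousOn : ContinuousOn u (Icc 0 T)
  locBounded : ∀ a : ℝ, 0 < a → ∃ M : ℝ≥0, ∀ t ∈ Icc a T,
    eLpNorm (u t : E3 → ℝ) ∞ volume ≤ M
  initial : u 0 = u₀.toLp 3 volume
  duhamel : ∀ t ∈ Ioc 0 T, ∀ᵐ x : E3,
    (u t : E3 → ℝ) x =
      heat t u₀ x + ∫ τ in (0 : ℝ)..t, heat (t - τ) (fun y => (u τ : E3 → ℝ) y ^ 3) x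

/-- `u` is the (unique) maximal Weissler solution arising from `u₀`, and `Tmax < ∞` is its lifespan:
`u` is a Weissler solution on `[0,T]` for every `0 < T < Tmax`, and every Weissler solution on a
closed interval `[0,T]` with the same datum has `T < Tmax` and coincides there with `u`. -/
structure IsMaximalWeisslerSolution (u₀ : 𝓢(E3, ℝ)) (Tmax : ℝ)
    (u : ℝ → Lp ℝ 3 (volume : Measure E3)) : Prop where
  pos : 0 < Tmax
  solution : ∀ T : ℝ, 0 < T → T < Tmax → IsWeisslerSolution u₀ T u
  maximal_unique : ∀ (T : ℝ) (v : ℝ → Lp ℝ 3 (volume : Measure E3)),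
    IsWeisslerSolution u₀ T v → T < Tmax ∧ ∀ t ∈ Icc 0 T, v t = u t

/-- The Fourier transform in the normalization `f̂(ξ) = ∫ e^{-i x·ξ} f(x) dx` (Mathlib's transform
has the phase `e^{-2πi x·ξ}`). -/
noncomputable def hat (f : E3 → ℂ) (ξ : E3) : ℂ :=
  𝓕 f ((2 * Real.pi)⁻¹ • ξ)

/-- The dilates `ψ_j(x) = 2^{3j} ψ(2^j x)`, `j ∈ ℤ`. -/
noncomputable def dilate (ψ : E3 → ℂ) (j : ℤ) (x : E3) : ℂ :=
  ((2 : ℂ) ^ (3 * j)) * ψ ((2 : ℝ) ^ j • x)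

/-- `ψ` generates a homogeneous Littlewood–Paley decomposition of `ℝ³`: its Fourier transform is
supported in the annulus `3/5 ≤ |ξ| ≤ 5/3`, and `∑_{j ∈ ℤ} ψ̂_j(ξ) = 1` for all `ξ ≠ 0`. -/
structure IsLittlewoodPaley (ψ : 𝓢(E3, ℂ)) : Prop where
  support : ∀ ξ : E3, hat ψ ξ ≠ 0 → 3 / 5 ≤ ‖ξ‖ ∧ ‖ξ‖ ≤ 5 / 3
  sum_eq_one : ∀ ξ : E3, ξ ≠ 0 → HasSum (fun j : ℤ => hat (dilate ψ j) ξ) 1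

/-- The Littlewood–Paley block `ψ_j * f`. -/
noncomputable def lpBlock (ψ : 𝓢(E3, ℂ)) (j : ℤ) (f : 𝓢(E3, ℝ)) (x : E3) : ℂ :=
  ∫ y, dilate ψ j (x - y) * (f y : ℂ)

/-- The homogeneous Besov norm of the Schwartz function `f`, with values in `[0,∞]`:
`‖f‖_{Ḃ^{s,q}_p} = (∑_{j ∈ ℤ} (2^{js} ‖ψ_j * f‖_{L^p})^q)^{1/q}`, read as
`sup_j 2^{js} ‖ψ_j * f‖_{L^p}` if `q = ∞`. -/
noncomputable def besovNorm (ψ : 𝓢(E3, ℂ)) (s : ℝ) (p q : ℝ≥0∞) (f : 𝓢(E3, ℝ)) : ℝ≥0∞ :=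
  if q = ∞ then
    ⨆ j : ℤ, ENNReal.ofReal ((2 : ℝ) ^ ((j : ℝ) * s)) * eLpNorm (lpBlock ψ j f) p volume
  else
    (∑' j : ℤ, (ENNReal.ofReal ((2 : ℝ) ^ ((j : ℝ) * s)) *
      eLpNorm (lpBlock ψ j f) p volume) ^ q.toReal) ^ (1 / q.toReal)

end CubicHeat

namespace CubicHeat

/-! Work with data whose Fourier transform is nonnegative. On the Fourier side the cube becomes a
threefold convolution and the heat semigroup a positive multiplier, so every term of the Duhamel
equation is nonnegative. The Picard iterates increase to a minimal solution `fsol` with values in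
`[0,∞]`, which exists for all time. Lower bounds can therefore be obtained by keeping a few
interactions and discarding the rest. The integral `mass` of the minimal solution equals both
`u(t,0)` and the sup norm of `u(t)` while it is finite, so blow-up of `u` is blow-up of the mass.

The datum consists of `N` packets, at the frequencies `±64^k` and `±2·64^k` with amplitude `w·16^k`.
The resonance `l + l - 2l = 0` sends the cube of a packet to frequencies near zero. Packet `k`
survives for a time of order `64^(-2k)`, and `16^3 = 64^2`, so each packet deposits the same amount,
of order `w^3`, in the low frequencies (`ofReal_le_fsol_low`). The total is of order `N w^3`. Each
Littlewood–Paley block sees only one packet and has weighted `L⁹` norm of order at most `w`, so the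
Besov norm is at most of order `N^(1/q) w`. With `w = N^(-a)` and `1/q < a < 1/3` the Besov norm
tends to zero while `N w^3` tends to infinity: this is where `q > 3` enters. Once the low
frequencies are large they feed themselves like `y' = c y^3` and become infinite within a prescribed
time (`mass_eq_top_of_le`).

It remains to turn infinite mass at time `s` into a statement about Weissler solutions. The mass at
most doubles over a time of order `mass^(-2)`, which gives a lifespan at most `s` at whose end the
mass tends to infinity (`exists_lifespan`). Before that time the inverse Fourier transform of `fsol`
is a Weissler solution, bounded down to time zero. Uniqueness against an arbitrary competitor,
bounded only away from time zero, is `IsWeisslerSolution.eq_of_bounded`: a smoothing bootstrap shows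
that the difference is at most `K (t-s)^(-1/2)` for arbitrarily small `K`. A competitor living up to
the lifespan would be bounded near it while coinciding with `u` before it, which is impossible. -/

/-! ### The heat kernel and the heat semigroup. -/

theorem heatKernel_pos {t : ℝ} (ht : 0 < t) (x : E3) : 0 < heatKernel t x := by
  unfold heatKernel
  have : 0 < 4 * Real.pi * t := by positivity
  exact mul_pos (Real.rpow_pos_of_pos this _) (Real.exp_pos _)

theorem heatKernel_le {t : ℝ} (ht : 0 < t) (x : E3) :
    heatKernel t x ≤ (4 * Real.pi * t) ^ (-(3 / 2) : ℝ) := by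
  unfold heatKernel
  have h : 0 < 4 * Real.pi * t := by positivity
  refine mul_le_of_le_one_right (Real.rpow_pos_of_pos h _).le (Real.exp_le_one_iff.2 ?_)
  apply div_nonpos_of_nonpos_of_nonneg
  · simp
  · positivity

theorem continuous_heatKernel (t : ℝ) : Continuous (heatKernel t) := by
  unfold heatKernel
  fun_prop

theorem continuousOn_heatKernel :
    ContinuousOn (fun p : ℝ × E3 => heatKernel p.1 p.2) (Ioi 0 ×ˢ univ) := by
  unfold heatKernel
  intro p hp
  have hp1 : 0 < p.1 := hp.1
  have h1 : 4 * Real.pi * p.1 ≠ 0 := by positivity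
  have h2 : 4 * p.1 ≠ 0 := by positivity
  apply ContinuousAt.continuousWithinAt
  refine ContinuousAt.mul ?_ ?_
  · exact ContinuousAt.rpow_const (by fun_prop) (Or.inl h1)
  · refine Real.continuous_exp.continuousAt.comp ?_
    exact ContinuousAt.div (by fun_prop) (by fun_prop) h2

theorem heatKernel_eq_gaussian (t : ℝ) (x : E3) :
    heatKernel t x = (4 * Real.pi * t) ^ (-(3 / 2) : ℝ) * Real.exp (-(1 / (4 * t)) * ‖x‖ ^ 2) := by
  unfold heatKernel
  congr 2
  ring

theorem integrable_gaussian {b : ℝ} (hb : 0 < b) :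
    Integrable (fun x : E3 => Real.exp (-b * ‖x‖ ^ 2)) := by
  have h := GaussianFourier.integrable_cexp_neg_mul_sq_norm_add (V := E3) (b := (b : ℂ))
    (by simpa using hb) 0 0
  have h' := h.norm
  refine h'.congr (ae_of_all _ fun x => ?_)
  simp only [zero_mul, add_zero, Complex.norm_exp]
  norm_cast

theorem integrable_heatKernel {t : ℝ} (ht : 0 < t) : Integrable (heatKernel t) := by
  have h := (integrable_gaussian (b := 1 / (4 * t)) (by positivity)).const_mul
    ((4 * Real.pi * t) ^ (-(3 / 2) : ℝ))
  exact h.congr (ae_of_all _ fun x => (heatKernel_eq_gaussian t x).symm)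

theorem integral_heatKernel {t : ℝ} (ht : 0 < t) : ∫ x, heatKernel t x = 1 := by
  simp_rw [heatKernel_eq_gaussian]
  rw [integral_const_mul, GaussianFourier.integral_rexp_neg_mul_sq_norm (by positivity)]
  have h : Real.pi / (1 / (4 * t)) = 4 * Real.pi * t := by field_simp
  rw [h, ← Real.rpow_add (by positivity)]
  simp

theorem integrable_heatKernel_sub {t : ℝ} (ht : 0 < t) (x : E3) :
    Integrable (fun y => heatKernel t (x - y)) :=
  (integrable_heatKernel ht).comp_sub_left x

theorem integral_heatKernel_sub {t : ℝ} (ht : 0 < t) (x : E3) :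
    ∫ y, heatKernel t (x - y) = 1 := by
  rw [integral_sub_left_eq_self (heatKernel t) volume x, integral_heatKernel ht]

theorem integrable_heatKernel_mul {t : ℝ} (ht : 0 < t) (x : E3) {f : E3 → ℝ}
    (hf : Integrable f) : Integrable (fun y => heatKernel t (x - y) * f y) := by
  refine hf.bdd_mul (c := (4 * Real.pi * t) ^ (-(3 / 2) : ℝ)) ?_ (ae_of_all _ fun y => ?_)
  · exact ((continuous_heatKernel t).comp (continuous_const.sub continuous_id)).aestronglyMeasurable
  · rw [Real.norm_of_nonneg (heatKernel_pos ht _).le]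
    exact heatKernel_le ht _

/-- Maximum principle for the heat semigroup. -/
theorem abs_heat_le_of_bdd {t : ℝ} (ht : 0 < t) (x : E3) {f : E3 → ℝ}
    {C : ℝ} (hC : ∀ᵐ y, |f y| ≤ C) : |heat t f x| ≤ C := by
  unfold heat
  have h := norm_integral_le_of_norm_le (f := fun y => heatKernel t (x - y) * f y)
    ((integrable_heatKernel_sub ht x).mul_const C) (by
      filter_upwards [hC] with y hy
      rw [norm_mul, Real.norm_of_nonneg (heatKernel_pos ht _).le]
      exact mul_le_mul_of_nonneg_left hy (heatKernel_pos ht _).le)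
  rwa [integral_mul_const, integral_heatKernel_sub ht, one_mul] at h

theorem abs_heat_le_of_integrable {t : ℝ} (ht : 0 < t) (x : E3) {f : E3 → ℝ}
    (hf : Integrable f) :
    |heat t f x| ≤ (4 * Real.pi * t) ^ (-(3 / 2) : ℝ) * ∫ y, |f y| := by
  unfold heat
  rw [← integral_const_mul, ← Real.norm_eq_abs]
  refine norm_integral_le_of_norm_le (hf.abs.const_mul _) (ae_of_all _ fun y => ?_)
  rw [norm_mul, Real.norm_of_nonneg (heatKernel_pos ht _).le]
  exact mul_le_mul_of_nonneg_right (heatKernel_le ht _) (abs_nonneg _)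

theorem heat_congr_ae {t : ℝ} {f g : E3 → ℝ} (h : f =ᵐ[volume] g) (x : E3) :
    heat t f x = heat t g x := by
  unfold heat
  refine integral_congr_ae ?_
  filter_upwards [h] with y hy
  rw [hy]

/-- Completing the square separates the total displacement `u + v` from a weighted difference. In
the Chapman–Kolmogorov integral only the second factor depends on the intermediate point. -/
theorem heatKernel_mul_heatKernel {a b : ℝ} (ha : 0 < a) (hb : 0 < b) (u v : E3) :
    heatKernel a u * heatKernel b v =
      heatKernel (a + b) (u + v) * heatKernel (a * b / (a + b)) ((b / (a + b)) • u - (a / (a + b)) • v) := by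
  unfold heatKernel
  have hab : 0 < a + b := by positivity
  have h1 : (4 * Real.pi * a) ^ (-(3 / 2) : ℝ) * (4 * Real.pi * b) ^ (-(3 / 2) : ℝ) =
      (4 * Real.pi * (a + b)) ^ (-(3 / 2) : ℝ) * (4 * Real.pi * (a * b / (a + b))) ^ (-(3 / 2) : ℝ) := by
    rw [← Real.mul_rpow (by positivity) (by positivity),
      ← Real.mul_rpow (by positivity) (by positivity)]
    congr 1
    field_simp
  have h2 : -‖u‖ ^ 2 / (4 * a) + -‖v‖ ^ 2 / (4 * b) = -‖u + v‖ ^ 2 / (4 * (a + b)) +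
      -‖(b / (a + b)) • u - (a / (a + b)) • v‖ ^ 2 / (4 * (a * b / (a + b))) := by
    rw [@norm_add_sq ℝ, @norm_sub_sq ℝ, norm_smul, norm_smul, inner_smul_left, inner_smul_right,
      mul_pow, mul_pow, Real.norm_eq_abs, Real.norm_eq_abs, sq_abs, sq_abs]
    simp only [RCLike.re_to_real, conj_trivial]
    field_simp
    ring
  calc _ = ((4 * Real.pi * a) ^ (-(3 / 2) : ℝ) * (4 * Real.pi * b) ^ (-(3 / 2) : ℝ)) *
        Real.exp (-‖u‖ ^ 2 / (4 * a) + -‖v‖ ^ 2 / (4 * b)) := by rw [Real.exp_add]; ring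
    _ = _ := by rw [h1, h2, Real.exp_add]; ring

/-- Chapman–Kolmogorov identity for the heat kernel. -/
theorem integral_heatKernel_mul_heatKernel {a b : ℝ} (ha : 0 < a) (hb : 0 < b) (x y : E3) :
    ∫ z, heatKernel a (x - z) * heatKernel b (z - y) = heatKernel (a + b) (x - y) := by
  have hab : 0 < a + b := by positivity
  have h : ∀ z, heatKernel a (x - z) * heatKernel b (z - y) =
      heatKernel (a + b) (x - y) *
        heatKernel (a * b / (a + b)) (((b / (a + b)) • x + (a / (a + b)) • y) - z) := by
    intro z
    rw [heatKernel_mul_heatKernel ha hb]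
    congr 2
    · abel
    · have : z = (b / (a + b)) • z + (a / (a + b)) • z := by
        rw [← add_smul, ← add_div, add_comm b a, div_self hab.ne', one_smul]
      conv_rhs => rw [this]
      module
  simp_rw [h]
  rw [integral_const_mul, integral_heatKernel_sub (by positivity), mul_one]

theorem heat_heat {a b : ℝ} (ha : 0 < a) (hb : 0 < b) {f : E3 → ℝ} (hf : Integrable f) (x : E3) :
    heat a (heat b f) x = heat (a + b) f x := by
  unfold heat
  have hm : AEStronglyMeasurable (Function.uncurry fun z y => heatKernel a (x - z) * (heatKernel b (z - y) * f y))
      ((volume : Measure E3).prod (volume : Measure E3)) := by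
    refine AEStronglyMeasurable.mul ?_ (AEStronglyMeasurable.mul ?_ ?_)
    · exact ((continuous_heatKernel a).comp (by fun_prop)).aestronglyMeasurable
    · exact ((continuous_heatKernel b).comp (by fun_prop)).aestronglyMeasurable
    · exact hf.1.comp_snd
  have hint : Integrable (Function.uncurry fun z y => heatKernel a (x - z) * (heatKernel b (z - y) * f y))
      ((volume : Measure E3).prod (volume : Measure E3)) := by
    have h0 : Integrable (fun p : E3 × E3 => heatKernel a (x - p.1) * f p.2)
        ((volume : Measure E3).prod (volume : Measure E3)) :=
      (integrable_heatKernel_sub ha x).mul_prod hf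
    refine (h0.norm.const_mul ((4 * Real.pi * b) ^ (-(3 / 2) : ℝ))).mono' hm
      (ae_of_all _ fun p => ?_)
    simp only [Function.uncurry, norm_mul]
    rw [Real.norm_of_nonneg (heatKernel_pos hb _).le, mul_left_comm]
    exact mul_le_mul_of_nonneg_right (heatKernel_le hb _) (by positivity)
  simp_rw [← integral_const_mul]
  rw [integral_integral_swap hint]
  refine integral_congr_ae (ae_of_all _ fun y => ?_)
  simp only
  simp_rw [← mul_assoc]
  rw [integral_mul_const, integral_heatKernel_mul_heatKernel ha hb]

theorem fourier_heatKernel {t : ℝ} (ht : 0 < t) (ξ : E3) :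
    𝓕 (fun x => (heatKernel t x : ℂ)) ξ =
      (Real.exp (-(4 * Real.pi ^ 2 * t) * ‖ξ‖ ^ 2) : ℂ) := by
  have h := fourier_gaussian_innerProductSpace (V := E3) (b := ((1 / (4 * t) : ℝ) : ℂ))
    (by rw [Complex.ofReal_re]; positivity) ξ
  have h2 : 𝓕 (fun x => (heatKernel t x : ℂ)) ξ = (((4 * Real.pi * t) ^ (-(3 / 2) : ℝ) : ℝ) : ℂ) *
      𝓕 (fun x : E3 => Complex.exp (-((1 / (4 * t) : ℝ) : ℂ) * (‖x‖ : ℂ) ^ 2)) ξ := by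
    rw [Real.fourier_eq, Real.fourier_eq, ← integral_const_mul]
    refine integral_congr_ae (ae_of_all _ fun x => ?_)
    simp only [Circle.smul_def, smul_eq_mul]
    rw [heatKernel_eq_gaussian]
    push_cast
    ring
  have h3 : (Real.pi : ℂ) / ((1 / (4 * t) : ℝ) : ℂ) = ((4 * Real.pi * t : ℝ) : ℂ) := by
    push_cast
    field_simp
  have h4 : ((Module.finrank ℝ E3 : ℂ) / 2) = ((3 / 2 : ℝ) : ℂ) := by simp
  rw [h2, h, h3, h4, ← Complex.ofReal_cpow (by positivity), ← mul_assoc, ← Complex.ofReal_mul,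
    ← Real.rpow_add (by positivity)]
  simp only [neg_add_cancel, Real.rpow_zero, Complex.ofReal_one, one_mul]
  push_cast
  congr 1
  field_simp

theorem heat_sub {t : ℝ} (ht : 0 < t) {f g : E3 → ℝ} (hf : Integrable f) (hg : Integrable g)
    (x : E3) : heat t (fun y => f y - g y) x = heat t f x - heat t g x := by
  unfold heat
  rw [← integral_sub (integrable_heatKernel_mul ht x hf) (integrable_heatKernel_mul ht x hg)]
  simp_rw [mul_sub]

/-! ### Forcing terms and their Duhamel integrals. -/

/-- A forcing term on `[0,T]`: continuous with values in `L¹` and locally bounded on `(0,T]`. -/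
structure IsForcing (T : ℝ) (h : ℝ → E3 → ℝ) : Prop where
  integrable : ∀ τ ∈ Icc 0 T, Integrable (h τ)
  continuous : ∀ τ ∈ Icc 0 T, Tendsto (fun σ => ∫ y, |h σ y - h τ y|) (𝓝[Icc 0 T] τ) (𝓝 0)
  bounded : ∀ a : ℝ, 0 < a → ∃ M : ℝ, ∀ t ∈ Icc a T, ∀ᵐ y, |h t y| ≤ M

namespace IsForcing

variable {T : ℝ} {h h' : ℝ → E3 → ℝ}

theorem sub (hh : IsForcing T h) (hh' : IsForcing T h') :
    IsForcing T (fun τ y => h τ y - h' τ y) where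
  integrable τ hτ := (hh.integrable τ hτ).sub (hh'.integrable τ hτ)
  continuous τ hτ := by
    have h1 := (hh.continuous τ hτ).add (hh'.continuous τ hτ)
    rw [add_zero] at h1
    refine tendsto_of_tendsto_of_tendsto_of_le_of_le' tendsto_const_nhds h1
      (Eventually.of_forall fun σ => integral_nonneg fun y => abs_nonneg _) ?_
    filter_upwards [self_mem_nhdsWithin] with σ hσ
    have i1 := ((hh.integrable σ hσ).sub (hh.integrable τ hτ)).abs
    have i2 := ((hh'.integrable σ hσ).sub (hh'.integrable τ hτ)).abs
    have e : ∫ y, |h σ y - h τ y| + |h' σ y - h' τ y| =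
        (∫ y, |h σ y - h τ y|) + ∫ y, |h' σ y - h' τ y| := integral_add i1 i2
    rw [← e]
    refine integral_mono_of_nonneg (ae_of_all _ fun y => abs_nonneg _) (i1.add i2)
      (ae_of_all _ fun y => ?_)
    show |h σ y - h' σ y - (h τ y - h' τ y)| ≤ |h σ y - h τ y| + |h' σ y - h' τ y|
    calc |h σ y - h' σ y - (h τ y - h' τ y)| = |(h σ y - h τ y) - (h' σ y - h' τ y)| := by
          congr 1; ring
      _ ≤ _ := abs_sub _ _
  bounded a ha := by
    obtain ⟨M, hM⟩ := hh.bounded a ha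
    obtain ⟨M', hM'⟩ := hh'.bounded a ha
    refine ⟨M + M', fun t ht => ?_⟩
    filter_upwards [hM t ht, hM' t ht] with y h1 h2
    exact (abs_sub _ _).trans (add_le_add h1 h2)

theorem exists_integral_le (hh : IsForcing T h) :
    ∃ C : ℝ, 0 ≤ C ∧ ∀ τ ∈ Icc 0 T, ∫ y, |h τ y| ≤ C := by
  have hc : ContinuousOn (fun τ => ∫ y, |h τ y|) (Icc 0 T) := by
    intro τ hτ
    rw [ContinuousWithinAt, tendsto_iff_norm_sub_tendsto_zero]
    refine tendsto_of_tendsto_of_tendsto_of_le_of_le' tendsto_const_nhds (hh.continuous τ hτ)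
      (Eventually.of_forall fun σ => norm_nonneg _) ?_
    filter_upwards [self_mem_nhdsWithin] with σ hσ
    rw [← integral_sub (hh.integrable σ hσ).abs (hh.integrable τ hτ).abs]
    refine norm_integral_le_of_norm_le ((hh.integrable σ hσ).sub (hh.integrable τ hτ)).abs
      (ae_of_all _ fun y => ?_)
    exact abs_abs_sub_abs_le_abs_sub _ _
  obtain ⟨C, hC⟩ := isCompact_Icc.exists_bound_of_continuousOn hc
  refine ⟨max C 0, le_max_right _ _, fun τ hτ => ?_⟩
  exact (le_abs_self _).trans ((hC τ hτ).trans (le_max_left _ _))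

/-- No joint measurability of the forcing in time and space is assumed; smoothing by the kernel at
positive time produces joint continuity, and hence the measurability needed for Fubini. A change of
the forcing is controlled in `L¹` by the sup of the kernel, and for a fixed forcing dominated
convergence applies. -/
theorem continuousOn_heat (hh : IsForcing T h) {s : ℝ} (hs : s ≤ T) :
    ContinuousOn (fun p : ℝ × E3 => heat (s - p.1) (h p.1) p.2) (Ico 0 s ×ˢ univ) := by
  rintro ⟨τ, x⟩ ⟨⟨h0, h1⟩, -⟩
  simp only at h0 h1
  have hτ : τ ∈ Icc 0 T := ⟨h0, h1.le.trans hs⟩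
  set c := (4 * Real.pi * ((s - τ) / 2)) ^ (-(3 / 2) : ℝ) with hc
  have hev : ∀ᶠ p : ℝ × E3 in 𝓝[Ico 0 s ×ˢ univ] (τ, x), (s - τ) / 2 ≤ s - p.1 ∧ p.1 ∈ Icc 0 T := by
    have h2 : ∀ᶠ p : ℝ × E3 in 𝓝 (τ, x), (s - τ) / 2 < s - p.1 := by
      refine ContinuousAt.eventually_lt (by fun_prop) (by fun_prop) ?_
      simp only
      linarith
    filter_upwards [nhdsWithin_le_nhds h2, self_mem_nhdsWithin] with p hp hp2
    exact ⟨hp.le, hp2.1.1, hp2.1.2.le.trans hs⟩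
  have hker : ∀ a : ℝ, (s - τ) / 2 ≤ a → (4 * Real.pi * a) ^ (-(3 / 2) : ℝ) ≤ c := by
    intro a ha
    have hst : 0 < s - τ := by linarith
    refine Real.rpow_le_rpow_of_nonpos (by positivity) ?_ (by norm_num)
    have := Real.pi_pos
    gcongr
  have hA : Tendsto (fun p : ℝ × E3 => heat (s - p.1) (fun y => h p.1 y - h τ y) p.2)
      (𝓝[Ico 0 s ×ˢ univ] (τ, x)) (𝓝 0) := by
    have hfst : Tendsto (fun p : ℝ × E3 => p.1) (𝓝[Ico 0 s ×ˢ univ] (τ, x)) (𝓝[Icc 0 T] τ) := by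
      refine tendsto_nhdsWithin_iff.2 ⟨continuous_fst.continuousAt.tendsto.mono_left nhdsWithin_le_nhds, ?_⟩
      filter_upwards [hev] with p hp using hp.2
    have hz := ((hh.continuous τ hτ).comp hfst).const_mul c
    rw [mul_zero] at hz
    refine squeeze_zero_norm' ?_ hz
    filter_upwards [hev] with p hp
    have hpos : 0 < s - p.1 := by linarith [hp.1]
    refine (abs_heat_le_of_integrable hpos p.2
      ((hh.integrable _ hp.2).sub (hh.integrable τ hτ))).trans ?_
    exact mul_le_mul_of_nonneg_right (hker _ hp.1) (integral_nonneg fun y => abs_nonneg _)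
  have hB : ContinuousWithinAt (fun p : ℝ × E3 => heat (s - p.1) (h τ) p.2)
      (Ico 0 s ×ˢ univ) (τ, x) := by
    unfold heat
    refine continuousWithinAt_of_dominated (bound := fun y => c * |h τ y|) ?_ ?_
      ((hh.integrable τ hτ).abs.const_mul c) ?_
    · filter_upwards [hev] with p hp
      exact (integrable_heatKernel_mul (by linarith [hp.1]) p.2 (hh.integrable τ hτ)).1
    · filter_upwards [hev] with p hp
      refine ae_of_all _ fun y => ?_
      have hpos : 0 < s - p.1 := by linarith [hp.1]
      rw [norm_mul, Real.norm_of_nonneg (heatKernel_pos hpos _).le]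
      exact mul_le_mul_of_nonneg_right ((heatKernel_le hpos _).trans (hker _ hp.1)) (abs_nonneg _)
    · refine ae_of_all _ fun y => ContinuousAt.continuousWithinAt ?_
      refine ContinuousAt.mul ?_ continuousAt_const
      have hk : ContinuousAt (fun q : ℝ × E3 => heatKernel q.1 q.2) (s - τ, x - y) :=
        continuousOn_heatKernel.continuousAt
          ((isOpen_Ioi.prod isOpen_univ).mem_nhds ⟨by simpa using h1, mem_univ _⟩)
      exact ContinuousAt.comp (f := fun p : ℝ × E3 => (s - p.1, p.2 - y)) (x := (τ, x)) hk
        (by fun_prop)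
  have hsum := hA.add hB
  rw [zero_add] at hsum
  refine hsum.congr' ?_
  filter_upwards [hev] with p hp
  rw [heat_sub (by linarith [hp.1]) (hh.integrable _ hp.2) (hh.integrable τ hτ)]
  ring

/-- For `τ ≤ s/2` the kernel is bounded and the `L¹` norm suffices; for `τ ≥ s/2` the forcing itself
is bounded and the maximum principle applies. -/
theorem exists_abs_heat_le (hh : IsForcing T h) {s : ℝ} (hs0 : 0 < s) (hs : s ≤ T) :
    ∃ C : ℝ, ∀ τ ∈ Ico 0 s, ∀ x, |heat (s - τ) (h τ) x| ≤ C := by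
  obtain ⟨C, hC0, hC⟩ := hh.exists_integral_le
  obtain ⟨M, hM⟩ := hh.bounded (s / 2) (by positivity)
  refine ⟨max ((4 * Real.pi * (s / 2)) ^ (-(3 / 2) : ℝ) * C) M, fun τ hτ x => ?_⟩
  have hτT : τ ∈ Icc 0 T := ⟨hτ.1, hτ.2.le.trans hs⟩
  have hpos : 0 < s - τ := by linarith [hτ.2]
  rcases le_total τ (s / 2) with h1 | h1
  · refine le_trans ?_ (le_max_left _ _)
    refine (abs_heat_le_of_integrable hpos x (hh.integrable τ hτT)).trans ?_
    refine mul_le_mul ?_ (hC τ hτT) (integral_nonneg fun y => abs_nonneg _) (by positivity)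
    refine Real.rpow_le_rpow_of_nonpos (by positivity) ?_ (by norm_num)
    have := Real.pi_pos
    gcongr
    linarith
  · exact (abs_heat_le_of_bdd hpos x (hM τ ⟨h1, hτT.2⟩)).trans (le_max_right _ _)

theorem aestronglyMeasurable_heat (hh : IsForcing T h) {s : ℝ} (hs : s ≤ T) :
    AEStronglyMeasurable (fun p : ℝ × E3 => heat (s - p.1) (h p.1) p.2)
      ((volume.restrict (Ioo 0 s)).prod volume) := by
  have := ((hh.continuousOn_heat hs).mono (prod_mono_left Ioo_subset_Ico_self)).aestronglyMeasurable
    (μ := (volume : Measure ℝ).prod (volume : Measure E3)) (measurableSet_Ioo.prod MeasurableSet.univ)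
  rwa [← Measure.prod_restrict, Measure.restrict_univ] at this

theorem intervalIntegrable_heat (hh : IsForcing T h) {s : ℝ} (hs0 : 0 < s) (hs : s ≤ T) (x : E3) :
    IntervalIntegrable (fun τ => heat (s - τ) (h τ) x) volume 0 s := by
  obtain ⟨C, hC⟩ := hh.exists_abs_heat_le hs0 hs
  rw [intervalIntegrable_iff_integrableOn_Ioo_of_le hs0.le]
  have h1 : ContinuousOn (fun τ => heat (s - τ) (h τ) x) (Ioo 0 s) :=
    (hh.continuousOn_heat hs).comp (f := fun τ : ℝ => (τ, x)) (s := Ioo 0 s)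
      (by fun_prop) (fun τ hτ => ⟨Ioo_subset_Ico_self hτ, mem_univ _⟩)
  have hc : Integrable (fun _ : ℝ => C) (volume.restrict (Ioo 0 s)) := by simp
  refine hc.mono' (h1.aestronglyMeasurable measurableSet_Ioo) ?_
  filter_upwards [ae_restrict_mem measurableSet_Ioo] with τ hτ
  exact hC τ (Ioo_subset_Ico_self hτ) x

/-- The heat semigroup commutes with the Duhamel integral. -/
theorem heat_duhamel (hh : IsForcing T h) {s t : ℝ} (hs0 : 0 < s) (hst : s < t) (ht : t ≤ T)
    (x : E3) :
    heat (t - s) (fun z => ∫ τ in (0 : ℝ)..s, heat (s - τ) (h τ) z) x =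
      ∫ τ in (0 : ℝ)..s, heat (t - τ) (h τ) x := by
  have hs : s ≤ T := hst.le.trans ht
  have hts : 0 < t - s := by linarith
  obtain ⟨C, hC⟩ := hh.exists_abs_heat_le hs0 hs
  conv_lhs => unfold heat
  change ∫ z, heatKernel (t - s) (x - z) * (∫ τ in (0 : ℝ)..s, heat (s - τ) (h τ) z) = _
  simp_rw [intervalIntegral.integral_of_le hs0.le, integral_Ioc_eq_integral_Ioo,
    ← integral_const_mul]
  have hint : Integrable (Function.uncurry fun (z : E3) (τ : ℝ) =>
      heatKernel (t - s) (x - z) * heat (s - τ) (h τ) z)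
      ((volume : Measure E3).prod (volume.restrict (Ioo 0 s))) := by
    have h0 : Integrable (fun p : E3 × ℝ => heatKernel (t - s) (x - p.1) * C)
        ((volume : Measure E3).prod (volume.restrict (Ioo 0 s))) := by
      have hc : Integrable (fun _ : ℝ => C) (volume.restrict (Ioo 0 s)) := by simp
      exact (integrable_heatKernel_sub hts x).mul_prod hc
    refine h0.mono' ?_ ?_
    · refine AEStronglyMeasurable.mul ?_ (hh.aestronglyMeasurable_heat hs).prod_swap
      exact ((continuous_heatKernel _).comp (by fun_prop)).aestronglyMeasurable
    · have hae : ∀ᵐ p : E3 × ℝ ∂((volume : Measure E3).prod (volume.restrict (Ioo 0 s))),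
          p.2 ∈ Ioo 0 s :=
        Measure.quasiMeasurePreserving_snd.ae (ae_restrict_mem measurableSet_Ioo)
      filter_upwards [hae] with p hp
      simp only [Function.uncurry, norm_mul]
      rw [Real.norm_of_nonneg (heatKernel_pos hts _).le]
      exact mul_le_mul_of_nonneg_left (hC _ (Ioo_subset_Ico_self hp) _) (heatKernel_pos hts _).le
  rw [integral_integral_swap hint]
  refine setIntegral_congr_fun measurableSet_Ioo fun τ hτ => ?_
  have := heat_heat hts (sub_pos.2 hτ.2) (hh.integrable τ ⟨hτ.1.le, hτ.2.le.trans hs⟩) x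
  rw [sub_add_sub_cancel] at this
  exact this

end IsForcing

/-! ### Cubes of `L³` functions as forcing terms. -/

theorem integrable_abs_pow_three (f : Lp ℝ 3 (volume : Measure E3)) :
    Integrable (fun y => |(f : E3 → ℝ) y| ^ 3) := by
  have := (Lp.memLp f).integrable_norm_rpow (by norm_num) (by norm_num)
  refine this.congr (ae_of_all _ fun y => ?_)
  simp only [Real.norm_eq_abs]
  norm_num

theorem integral_abs_pow_three (f : Lp ℝ 3 (volume : Measure E3)) :
    ∫ y, |(f : E3 → ℝ) y| ^ 3 = ‖f‖ ^ 3 := by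
  rw [Lp.norm_def, (Lp.memLp f).eLpNorm_eq_integral_rpow_norm (by norm_num) (by norm_num)]
  have h : ∀ y, ‖(f : E3 → ℝ) y‖ ^ (3 : ℝ≥0∞).toReal = |(f : E3 → ℝ) y| ^ 3 := by
    intro y
    rw [Real.norm_eq_abs]
    norm_num
  simp_rw [h]
  rw [ENNReal.toReal_ofReal (by positivity), ← Real.rpow_natCast, ← Real.rpow_mul (by positivity)]
  norm_num

/-- Weighted Young inequality: the free parameter `l` makes the part without `a - b` as small as
desired. After integration it gives continuity of the cube from `L³` to `L¹` without Hölder's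
inequality. -/
theorem abs_cube_sub_cube_le {l : ℝ} (hl : 0 < l) (hl1 : l ≤ 1) (a b : ℝ) :
    |a ^ 3 - b ^ 3| ≤ 6 * l * |b| ^ 3 + 7 / l ^ 2 * |a - b| ^ 3 := by
  have h0 : |a ^ 3 - b ^ 3| ≤ |a - b| ^ 3 + 3 * |b| * |a - b| ^ 2 + 3 * |b| ^ 2 * |a - b| := by
    have : a ^ 3 - b ^ 3 = (a - b) ^ 3 + 3 * b * (a - b) ^ 2 + 3 * b ^ 2 * (a - b) := by ring
    rw [this]
    refine (abs_add_three _ _ _).trans (le_of_eq ?_)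
    simp only [abs_mul, abs_pow, Nat.abs_ofNat]
  have hd := abs_nonneg (a - b)
  have hb := abs_nonneg b
  generalize |a - b| = d at *
  generalize |b| = e at *
  have hl2 : 1 ≤ 1 / l ^ 2 := by
    rw [le_div_iff₀ (by positivity), one_mul]
    exact pow_le_one₀ hl.le hl1
  have hl3 : 1 / l ≤ 1 / l ^ 2 := by
    apply one_div_le_one_div_of_le (by positivity)
    nlinarith
  have e1 : 7 / l ^ 2 = 7 * (1 / l ^ 2) := by ring
  rw [e1]
  have hd3 : 0 ≤ d ^ 3 := by positivity
  rcases le_total d (l * e) with h | h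
  · have h1 : e * d ^ 2 ≤ l * e ^ 3 := by
      calc e * d ^ 2 ≤ e * (l * e) ^ 2 := by gcongr
        _ = l * (l * e ^ 3) := by ring
        _ ≤ 1 * (l * e ^ 3) := by gcongr
        _ = _ := one_mul _
    have h2 : e ^ 2 * d ≤ l * e ^ 3 := by
      calc e ^ 2 * d ≤ e ^ 2 * (l * e) := by gcongr
        _ = _ := by ring
    nlinarith
  · have h' : e ≤ 1 / l * d := by
      rw [one_div, ← div_eq_inv_mul, le_div_iff₀ hl]; linarith
    have h1 : e * d ^ 2 ≤ 1 / l ^ 2 * d ^ 3 := by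
      calc e * d ^ 2 ≤ (1 / l * d) * d ^ 2 := by gcongr
        _ = 1 / l * d ^ 3 := by ring
        _ ≤ _ := by gcongr
    have h2 : e ^ 2 * d ≤ 1 / l ^ 2 * d ^ 3 := by
      calc e ^ 2 * d ≤ (1 / l * d) ^ 2 * d := by gcongr
        _ = _ := by ring
    have : 0 ≤ l * e ^ 3 := by positivity
    nlinarith

theorem integrable_pow_three (f : Lp ℝ 3 (volume : Measure E3)) :
    Integrable (fun y => (f : E3 → ℝ) y ^ 3) := by
  refine (integrable_abs_pow_three f).mono' ((Lp.aestronglyMeasurable f).pow 3)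
    (ae_of_all _ fun y => ?_)
  simp

theorem integral_abs_cube_sub_cube_le {l : ℝ} (hl : 0 < l) (hl1 : l ≤ 1)
    (f g : Lp ℝ 3 (volume : Measure E3)) :
    ∫ y, |(f : E3 → ℝ) y ^ 3 - (g : E3 → ℝ) y ^ 3| ≤
      6 * l * ‖g‖ ^ 3 + 7 / l ^ 2 * ‖f - g‖ ^ 3 := by
  rw [← integral_abs_pow_three, ← integral_abs_pow_three, ← integral_const_mul,
    ← integral_const_mul, ← integral_add ((integrable_abs_pow_three g).const_mul _)
      ((integrable_abs_pow_three (f - g)).const_mul _)]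
  refine integral_mono_of_nonneg (ae_of_all _ fun y => abs_nonneg _)
    (((integrable_abs_pow_three g).const_mul _).add
      ((integrable_abs_pow_three (f - g)).const_mul _)) ?_
  filter_upwards [Lp.coeFn_sub f g] with y hy
  rw [hy]
  exact abs_cube_sub_cube_le hl hl1 _ _

theorem ae_abs_le_of_eLpNorm_top_le {f : E3 → ℝ} {M : ℝ≥0}
    (h : eLpNorm f ∞ volume ≤ M) : ∀ᵐ y, |f y| ≤ M := by
  rw [eLpNorm_exponent_top] at h
  filter_upwards [ae_le_eLpNormEssSup (f := f) (μ := volume)] with y hy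
  have := hy.trans h
  rw [enorm_le_coe] at this
  exact_mod_cast this

theorem IsWeisslerSolution.isForcing {u₀ : 𝓢(E3, ℝ)} {T : ℝ}
    {u : ℝ → Lp ℝ 3 (volume : Measure E3)} (hu : IsWeisslerSolution u₀ T u) :
    IsForcing T (fun τ y => (u τ : E3 → ℝ) y ^ 3) where
  integrable τ _ := integrable_pow_three _
  continuous τ hτ := by
    rw [Metric.tendsto_nhds]
    intro ε hε
    obtain ⟨l, hl, hl1, hl2⟩ : ∃ l : ℝ, 0 < l ∧ l ≤ 1 ∧ 6 * l * ‖u τ‖ ^ 3 < ε / 2 := by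
      have hp : 0 < 12 * ‖u τ‖ ^ 3 + 1 := by positivity
      refine ⟨min 1 (ε / (12 * ‖u τ‖ ^ 3 + 1)), by positivity, min_le_left _ _, ?_⟩
      have h1 : min 1 (ε / (12 * ‖u τ‖ ^ 3 + 1)) * (12 * ‖u τ‖ ^ 3 + 1) ≤ ε := by
        rw [← le_div_iff₀ hp]
        exact min_le_right _ _
      have h2 : 0 < min 1 (ε / (12 * ‖u τ‖ ^ 3 + 1)) := by positivity
      nlinarith
    have hc : Tendsto (fun σ => 7 / l ^ 2 * ‖u σ - u τ‖ ^ 3) (𝓝[Icc 0 T] τ) (𝓝 0) := by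
      have h1 := ((tendsto_iff_norm_sub_tendsto_zero.1 (hu.continuousOn τ hτ)).pow 3).const_mul
        (7 / l ^ 2)
      simpa using h1
    filter_upwards [hc.eventually_lt_const (half_pos hε)] with σ hσ
    rw [Real.dist_0_eq_abs, abs_of_nonneg (integral_nonneg fun y => abs_nonneg _)]
    refine (integral_abs_cube_sub_cube_le hl hl1 _ _).trans_lt ?_
    linarith
  bounded a ha := by
    obtain ⟨M, hM⟩ := hu.locBounded a ha
    refine ⟨(M : ℝ) ^ 3, fun t ht => ?_⟩
    filter_upwards [ae_abs_le_of_eLpNorm_top_le (hM t ht)] with y hy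
    rw [abs_pow]
    gcongr

/-! ### Smoothing estimates and singular time integrals. -/

theorem rpow_four_pi_mul_le {σ p : ℝ} (hσ : 0 < σ) (hp : p ≤ 0) :
    (4 * Real.pi * σ) ^ p ≤ σ ^ p := by
  refine Real.rpow_le_rpow_of_nonpos hσ ?_ hp
  nlinarith [Real.pi_gt_three]

/-- The smoothing estimate `L³ → L^∞` of the heat semigroup. -/
theorem abs_heat_Lp_three_le {σ m : ℝ} (hσ : 0 < σ) (hm : 0 < m)
    {f : Lp ℝ 3 (volume : Measure E3)} (hf : ‖f‖ ≤ m) (x : E3) :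
    |heat σ f x| ≤ 2 * σ ^ (-(1 / 2) : ℝ) * m := by
  -- This level balances the two terms in `|z| ≤ l + |z|^3 / l^2` once the `L¹` bound `σ^(-3/2) m^3`
  -- is applied to the cube.
  set l := σ ^ (-(1 / 2) : ℝ) * m with hl
  have hl0 : 0 < l := by positivity
  have hpt : ∀ z : ℝ, |z| ≤ l + (1 / l ^ 2) * |z| ^ 3 := by
    intro z
    rcases le_total |z| l with h | h
    · have : 0 ≤ (1 / l ^ 2) * |z| ^ 3 := by positivity
      linarith
    · have : |z| ≤ (1 / l ^ 2) * |z| ^ 3 := by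
        rw [one_div, ← div_eq_inv_mul, le_div_iff₀ (by positivity)]
        calc |z| * l ^ 2 ≤ |z| * |z| ^ 2 := by gcongr
          _ = _ := by ring
      linarith
  have hi := integrable_heatKernel_mul hσ x (integrable_abs_pow_three f)
  have hk := integrable_heatKernel_sub hσ x
  have h1 : |heat σ f x| ≤ ∫ y, (heatKernel σ (x - y) * l +
      (1 / l ^ 2) * (heatKernel σ (x - y) * |(f : E3 → ℝ) y| ^ 3)) := by
    unfold heat
    rw [← Real.norm_eq_abs]
    refine norm_integral_le_of_norm_le ((hk.mul_const l).add (hi.const_mul _)) (ae_of_all _ fun y => ?_)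
    rw [norm_mul, Real.norm_of_nonneg (heatKernel_pos hσ _).le]
    have := mul_le_mul_of_nonneg_left (hpt ((f : E3 → ℝ) y)) (heatKernel_pos hσ (x - y)).le
    calc _ ≤ _ := this
      _ = _ := by ring
  rw [integral_add (hk.mul_const l) (hi.const_mul _), integral_mul_const, integral_const_mul,
    integral_heatKernel_sub hσ, one_mul] at h1
  have h2 : ∫ y, heatKernel σ (x - y) * |(f : E3 → ℝ) y| ^ 3 ≤ σ ^ (-(3 / 2) : ℝ) * m ^ 3 := by
    have h3 := abs_heat_le_of_integrable hσ x (integrable_abs_pow_three f)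
    simp_rw [abs_pow, abs_abs] at h3
    rw [integral_abs_pow_three] at h3
    refine (le_abs_self _).trans (h3.trans ?_)
    exact mul_le_mul (rpow_four_pi_mul_le hσ (by norm_num)) (by gcongr) (by positivity) (by positivity)
  have h4 : (1 / l ^ 2) * (σ ^ (-(3 / 2) : ℝ) * m ^ 3) = l := by
    have e : σ ^ (-(3 / 2) : ℝ) = (σ ^ (-(1 / 2) : ℝ)) ^ 3 := by
      rw [← Real.rpow_natCast, ← Real.rpow_mul hσ.le]; norm_num
    rw [e, hl]
    field_simp
  calc |heat σ f x| ≤ l + (1 / l ^ 2) * (σ ^ (-(3 / 2) : ℝ) * m ^ 3) := h1.trans (by gcongr)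
    _ = _ := by rw [h4, hl]; ring

/-- Interpolation between the two bounds for the heat flow of a cube. -/
theorem heat_abs_pow_three_le {σ A E : ℝ} (hσ : 0 < σ) (hA : 0 ≤ A)
    {f : Lp ℝ 3 (volume : Measure E3)} (hf : ‖f‖ ≤ E) (hfA : ∀ᵐ y, |(f : E3 → ℝ) y| ≤ A) (x : E3) :
    heat σ (fun y => |(f : E3 → ℝ) y| ^ 3) x ≤
      (A * E) ^ (3 / 2 : ℝ) * σ ^ (-(3 / 4) : ℝ) := by
  have hE : 0 ≤ E := (norm_nonneg _).trans hf
  set I := heat σ (fun y => |(f : E3 → ℝ) y| ^ 3) x with hI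
  have hI0 : 0 ≤ I := integral_nonneg fun y =>
    mul_nonneg (heatKernel_pos hσ _).le (by positivity)
  have h1 : I ≤ A ^ 3 := by
    refine (le_abs_self _).trans (abs_heat_le_of_bdd hσ x ?_)
    filter_upwards [hfA] with y hy
    rw [abs_pow, abs_abs]
    gcongr
  have h2 : I ≤ σ ^ (-(3 / 2) : ℝ) * E ^ 3 := by
    have h3 := abs_heat_le_of_integrable hσ x (integrable_abs_pow_three f)
    simp_rw [abs_pow, abs_abs] at h3
    rw [integral_abs_pow_three] at h3
    refine (le_abs_self _).trans (h3.trans ?_)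
    exact mul_le_mul (rpow_four_pi_mul_le hσ (by norm_num)) (by gcongr) (by positivity) (by positivity)
  -- The geometric mean of the two bounds keeps the time singularity at `σ^(-3/4)`, which is
  -- integrable, whereas `σ^(-3/2)` is not.
  have h3 : I ^ 2 ≤ ((A * E) ^ (3 / 2 : ℝ) * σ ^ (-(3 / 4) : ℝ)) ^ 2 := by
    have e : ((A * E) ^ (3 / 2 : ℝ) * σ ^ (-(3 / 4) : ℝ)) ^ 2 = A ^ 3 * (σ ^ (-(3 / 2) : ℝ) * E ^ 3) := by
      rw [mul_pow, ← Real.rpow_natCast, ← Real.rpow_natCast, ← Real.rpow_mul (by positivity),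
        ← Real.rpow_mul hσ.le]
      norm_num
      rw [mul_pow]; ring
    rw [e, sq]
    exact mul_le_mul h1 h2 hI0 (by positivity)
  exact (sq_le_sq₀ hI0 (by positivity)).1 h3

/-- The longer of the two subintervals has at least half the total length, so its factor is
comparable to `(t-s)^(-3/4)`. This replaces a beta integral by elementary ones. -/
theorem rpow_mul_rpow_le {s t τ : ℝ} (h1 : s < τ) (h2 : τ < t) :
    (τ - s) ^ (-(3 / 4) : ℝ) * (t - τ) ^ (-(3 / 4) : ℝ) ≤
      2 * (t - s) ^ (-(3 / 4) : ℝ) * ((τ - s) ^ (-(3 / 4) : ℝ) + (t - τ) ^ (-(3 / 4) : ℝ)) := by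
  have key : ∀ a b : ℝ, 0 < a → a ≤ b → 0 < b →
      b ^ (-(3 / 4) : ℝ) ≤ 2 * (a + b) ^ (-(3 / 4) : ℝ) := by
    intro a b ha hab hb
    have h3 : (2 * b) ^ (-(3 / 4) : ℝ) ≤ (a + b) ^ (-(3 / 4) : ℝ) :=
      Real.rpow_le_rpow_of_nonpos (by positivity) (by linarith) (by norm_num)
    rw [Real.mul_rpow (by norm_num) hb.le] at h3
    have h4 : (2 : ℝ)⁻¹ ≤ 2 ^ (-(3 / 4) : ℝ) := by
      rw [← Real.rpow_neg_one]
      exact Real.rpow_le_rpow_of_exponent_le (by norm_num) (by norm_num)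
    have h5 : 0 < b ^ (-(3 / 4) : ℝ) := by positivity
    nlinarith
  have ha : 0 < τ - s := by linarith
  have hb : 0 < t - τ := by linarith
  have pa : 0 < (τ - s) ^ (-(3 / 4) : ℝ) := by positivity
  have pb : 0 < (t - τ) ^ (-(3 / 4) : ℝ) := by positivity
  have e : t - s = (τ - s) + (t - τ) := by ring
  have pc : 0 < (t - s) ^ (-(3 / 4) : ℝ) := by rw [e]; positivity
  rcases le_total (τ - s) (t - τ) with h | h
  · have := key _ _ ha h hb
    rw [← e] at this
    nlinarith [mul_le_mul_of_nonneg_left this pa.le, mul_pos pc pb]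
  · have := key _ _ hb h ha
    rw [add_comm, ← e] at this
    nlinarith [mul_le_mul_of_nonneg_right this pb.le, mul_pos pc pa]

theorem intervalIntegral_sub_left_rpow {s t p : ℝ} (hp : -1 < p) :
    ∫ τ in s..t, (τ - s) ^ p = (t - s) ^ (p + 1) / (p + 1) := by
  rw [intervalIntegral.integral_comp_sub_right (fun z => z ^ p) s, sub_self,
    integral_rpow (Or.inl hp), Real.zero_rpow (by linarith), sub_zero]

theorem intervalIntegral_sub_right_rpow {s t p : ℝ} (hp : -1 < p) :
    ∫ τ in s..t, (t - τ) ^ p = (t - s) ^ (p + 1) / (p + 1) := by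
  rw [intervalIntegral.integral_comp_sub_left (fun z => z ^ p) t, sub_self,
    integral_rpow (Or.inl hp), Real.zero_rpow (by linarith), sub_zero]

theorem intervalIntegrable_sub_left_rpow {s t p : ℝ} (hp : -1 < p) :
    IntervalIntegrable (fun τ => (τ - s) ^ p) volume s t := by
  have h := (intervalIntegral.intervalIntegrable_rpow' (a := 0) (b := t - s) hp).comp_sub_right s
  simpa using h

theorem intervalIntegrable_sub_right_rpow {s t p : ℝ} (hp : -1 < p) :
    IntervalIntegrable (fun τ => (t - τ) ^ p) volume s t := by
  have h := (intervalIntegral.intervalIntegrable_rpow' (a := t - s) (b := 0) hp).comp_sub_left t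
  simpa using h

/-! ### Uniqueness of Weissler solutions. -/

/-- The difference `w` of two solutions, driven by the difference `h` of the cubes. -/
structure IsDifference (T U : ℝ) (w : ℝ → Lp ℝ 3 (volume : Measure E3)) (h : ℝ → E3 → ℝ) :
    Prop where
  forcing : IsForcing T h
  continuousOn : ContinuousOn w (Icc 0 T)
  duhamel : ∀ s t : ℝ, 0 < s → s < t → t ≤ T → ∀ᵐ x : E3,
    (w t : E3 → ℝ) x = heat (t - s) (w s) x + ∫ τ in s..t, heat (t - τ) (h τ) x
  bound : ∀ τ ∈ Icc 0 T, ∀ᵐ y : E3, |h τ y| ≤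
    3 * |(w τ : E3 → ℝ) y| ^ 3 + 5 * U ^ 2 * |(w τ : E3 → ℝ) y|

namespace IsDifference

variable {T U : ℝ} {w : ℝ → Lp ℝ 3 (volume : Measure E3)} {h : ℝ → E3 → ℝ}

theorem abs_heat_le (H : IsDifference T U w h) {τ σ A E : ℝ} (hτ : τ ∈ Icc 0 T) (hσ : 0 < σ)
    (hA : 0 ≤ A) (hE : ‖w τ‖ ≤ E) (hwA : ∀ᵐ y, |(w τ : E3 → ℝ) y| ≤ A) (x : E3) :
    |heat σ (h τ) x| ≤ 3 * ((A * E) ^ (3 / 2 : ℝ) * σ ^ (-(3 / 4) : ℝ)) + 5 * U ^ 2 * A := by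
  have hi := integrable_heatKernel_mul hσ x (integrable_abs_pow_three (w τ))
  have hk := integrable_heatKernel_sub hσ x
  have h1 : |heat σ (h τ) x| ≤ ∫ y, (3 * (heatKernel σ (x - y) * |(w τ : E3 → ℝ) y| ^ 3) +
      heatKernel σ (x - y) * (5 * U ^ 2 * A)) := by
    unfold heat
    rw [← Real.norm_eq_abs]
    refine norm_integral_le_of_norm_le ((hi.const_mul _).add (hk.mul_const _)) ?_
    filter_upwards [H.bound τ hτ, hwA] with y hy hyA
    rw [norm_mul, Real.norm_of_nonneg (heatKernel_pos hσ _).le, Real.norm_eq_abs]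
    have h2 : |h τ y| ≤ 3 * |(w τ : E3 → ℝ) y| ^ 3 + 5 * U ^ 2 * A := hy.trans (by gcongr)
    have := mul_le_mul_of_nonneg_left h2 (heatKernel_pos hσ (x - y)).le
    calc _ ≤ _ := this
      _ = _ := by ring
  rw [integral_add (hi.const_mul _) (hk.mul_const _), integral_mul_const, integral_const_mul,
    integral_heatKernel_sub hσ, one_mul] at h1
  refine h1.trans ?_
  have := heat_abs_pow_three_le hσ hA hE hwA x
  unfold heat at this
  linarith

/-- A bootstrap in which the critical norm `E` need not be small: the cubic term contributes order
`(K E)^(3/2)`, which is superlinear in `K` and is absorbed for small `K`. The target splits into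
`K/4` from the linear part, `K/2` from the forcing on `[s,r]` and `K/4` from the last slice `[r,t]`.
-/
theorem ae_abs_le (H : IsDifference T U w h) {s b K E : ℝ} (hs : 0 < s)
    (hbT : b ≤ T) (hb1 : b - s ≤ 1) (hbU : 40 * U ^ 2 * (b - s) ≤ 1) (hK : 0 < K)
    (hE : ∀ τ ∈ Icc 0 T, ‖w τ‖ ≤ E) (hws : ‖w s‖ ≤ K / 8)
    (hKE : 48 * (K * E) ^ (3 / 2 : ℝ) ≤ K / 4) :
    ∀ t ∈ Ioc s b, ∀ᵐ x, |(w t : E3 → ℝ) x| ≤ K * (t - s) ^ (-(1 / 2) : ℝ) := by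
  obtain ⟨M, hM⟩ := H.forcing.bounded s hs
  -- The qualitative bound `M` on the forcing over `[s,T]` fixes a step `η` over which the forcing
  -- contributes at most `K/4`. The desired bound then propagates by induction in steps of `η`, with
  -- no continuity of the sup norm required.
  obtain ⟨η, hη, hηM⟩ : ∃ η : ℝ, 0 < η ∧ |M| * η ≤ K / 4 := by
    refine ⟨K / 4 / (|M| + 1), by positivity, ?_⟩
    rw [← mul_div_assoc, div_le_iff₀ (by positivity)]
    nlinarith [abs_nonneg M]
  suffices hstep : ∀ n : ℕ, ∀ t ∈ Ioc s b, t ≤ s + n * η →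
      ∀ᵐ x, |(w t : E3 → ℝ) x| ≤ K * (t - s) ^ (-(1 / 2) : ℝ) by
    intro t ht
    obtain ⟨n, hn⟩ := exists_nat_ge ((t - s) / η)
    rw [div_le_iff₀ hη] at hn
    exact hstep n t ht (by linarith)
  intro n
  induction n with
  | zero =>
    intro t ht h1
    simp at h1
    exact absurd ht.1 (not_lt.2 h1)
  | succ n ih =>
    intro t ht htn
    have hts : 0 < t - s := by linarith [ht.1]
    have htT : t ≤ T := ht.2.trans hbT
    have hE0 : 0 ≤ E := (norm_nonneg _).trans (hE t ⟨by linarith, htT⟩)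
    set r := max s (t - η) with hr
    have hsr : s ≤ r := le_max_left _ _
    have hrt : r ≤ t := max_le ht.1.le (by linarith)
    have htr : t - r ≤ η := by linarith [le_max_right s (t - η)]
    set q := (t - s) ^ (-(1 / 2) : ℝ) with hq
    have hq1 : 1 ≤ q := Real.one_le_rpow_of_pos_of_le_one_of_nonpos hts (by linarith [ht.2]) (by norm_num)
    -- Majorant of the forcing where the induction hypothesis holds. Its integral carries `3·2·(4+4)
    -- = 48` from the singular powers, and `10 U^2 (t-s)`, which is `40 U^2 (t-s)` times one
    -- quarter.
    set F : ℝ → ℝ := fun τ => 3 * (K * E) ^ (3 / 2 : ℝ) * (2 * (t - s) ^ (-(3 / 4) : ℝ) *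
      ((τ - s) ^ (-(3 / 4) : ℝ) + (t - τ) ^ (-(3 / 4) : ℝ))) +
        5 * U ^ 2 * K * (τ - s) ^ (-(1 / 2) : ℝ) with hF
    have hFi : IntervalIntegrable F volume s t :=
      ((((intervalIntegrable_sub_left_rpow (by norm_num)).add
        (intervalIntegrable_sub_right_rpow (by norm_num))).const_mul _).const_mul _).add
        ((intervalIntegrable_sub_left_rpow (by norm_num)).const_mul _)
    have hFint : ∫ τ in s..t, F τ ≤ K / 4 * q + K / 4 * q := by
      have i1 := intervalIntegrable_sub_left_rpow (s := s) (t := t) (p := -(3 / 4)) (by norm_num)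
      have i2 := intervalIntegrable_sub_right_rpow (s := s) (t := t) (p := -(3 / 4)) (by norm_num)
      have i3 := intervalIntegrable_sub_left_rpow (s := s) (t := t) (p := -(1 / 2)) (by norm_num)
      rw [hF, intervalIntegral.integral_add (((i1.add i2).const_mul _).const_mul _) (i3.const_mul _),
        intervalIntegral.integral_const_mul, intervalIntegral.integral_const_mul,
        intervalIntegral.integral_const_mul, intervalIntegral.integral_add i1 i2,
        intervalIntegral_sub_left_rpow (by norm_num), intervalIntegral_sub_right_rpow (by norm_num),
        intervalIntegral_sub_left_rpow (by norm_num)]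
      have e1 : (t - s) ^ (-(3 / 4) : ℝ) * (t - s) ^ (-(3 / 4) + 1 : ℝ) = q := by
        rw [← Real.rpow_add hts]; norm_num [hq]
      have e2 : (t - s) ^ (-(1 / 2) + 1 : ℝ) = (t - s) * q := by
        rw [Real.rpow_add hts, Real.rpow_one, mul_comm]
      have e3 : 3 * (K * E) ^ (3 / 2 : ℝ) * (2 * (t - s) ^ (-(3 / 4) : ℝ) *
          ((t - s) ^ (-(3 / 4) + 1 : ℝ) / (-(3 / 4) + 1) + (t - s) ^ (-(3 / 4) + 1 : ℝ) / (-(3 / 4) + 1)))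
          = 48 * (K * E) ^ (3 / 2 : ℝ) * q := by
        rw [← e1]; ring
      have e4 : 5 * U ^ 2 * K * ((t - s) ^ (-(1 / 2) + 1 : ℝ) / (-(1 / 2) + 1)) =
          (40 * U ^ 2 * (t - s)) * (K / 4) * q := by
        rw [e2]; ring
      rw [e3, e4]
      have h40 : 40 * U ^ 2 * (t - s) ≤ 1 := by
        refine le_trans ?_ hbU
        have := ht.2
        gcongr
      have hKq : 0 ≤ K / 4 * q := by positivity
      nlinarith [mul_le_mul_of_nonneg_right hKE (zero_le_one.trans hq1),
        mul_le_mul_of_nonneg_right h40 hKq]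
    have hgood : ∀ x, ∀ τ ∈ Ioo s r, ‖heat (t - τ) (h τ) x‖ ≤ F τ := by
      intro x τ hτ
      have hτs : 0 < τ - s := by linarith [hτ.1]
      have hτt : 0 < t - τ := by linarith [hτ.2]
      have hτn : τ ≤ s + n * η := by
        have h1 : s < r := hτ.1.trans hτ.2
        have h2 : r = t - η := by
          rcases max_choice s (t - η) with h3 | h3
          · rw [← hr] at h3; linarith
          · exact h3
        push_cast at htn
        linarith [hτ.2]
      have hτT : τ ∈ Icc 0 T := ⟨by linarith, by linarith⟩
      have hb := ih τ ⟨hτ.1, by linarith [ht.2]⟩ hτn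
      have h1 := H.abs_heat_le hτT hτt (by positivity) (hE τ hτT) hb x
      rw [Real.norm_eq_abs]
      refine h1.trans ?_
      have e : (K * (τ - s) ^ (-(1 / 2) : ℝ) * E) ^ (3 / 2 : ℝ) =
          (K * E) ^ (3 / 2 : ℝ) * (τ - s) ^ (-(3 / 4) : ℝ) := by
        rw [mul_right_comm, Real.mul_rpow (by positivity) (by positivity), ← Real.rpow_mul hτs.le]
        norm_num
      rw [e, mul_assoc ((K * E) ^ (3 / 2 : ℝ)), ← mul_assoc 3, ← mul_assoc (5 * U ^ 2)]
      exact add_le_add (mul_le_mul_of_nonneg_left (rpow_mul_rpow_le hτ.1 (by linarith))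
        (by positivity)) le_rfl
    have hF0 : ∀ τ ∈ Ioo s t, 0 ≤ F τ := by
      intro τ hτ
      have hτs : 0 < τ - s := by linarith [hτ.1]
      have hτt : 0 < t - τ := by linarith [hτ.2]
      rw [hF]
      positivity
    have hfull : ∀ x, IntervalIntegrable (fun τ => heat (t - τ) (h τ) x) volume 0 t :=
      fun x => H.forcing.intervalIntegrable_heat (by linarith) htT x
    filter_upwards [H.duhamel s t hs ht.1 htT] with x hx
    have i1 : IntervalIntegrable (fun τ => heat (t - τ) (h τ) x) volume s r :=
      (hfull x).mono_set (by
        rw [uIcc_of_le hsr, uIcc_of_le (by linarith)]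
        exact Icc_subset_Icc hs.le hrt)
    have i2 : IntervalIntegrable (fun τ => heat (t - τ) (h τ) x) volume r t :=
      (hfull x).mono_set (by
        rw [uIcc_of_le hrt, uIcc_of_le (by linarith)]
        exact Icc_subset_Icc (by linarith) le_rfl)
    have b1 : |∫ τ in s..r, heat (t - τ) (h τ) x| ≤ K / 4 * q + K / 4 * q := by
      refine le_trans ?_ hFint
      rw [intervalIntegral.integral_of_le hsr, intervalIntegral.integral_of_le ht.1.le,
        integral_Ioc_eq_integral_Ioo, integral_Ioc_eq_integral_Ioo, ← Real.norm_eq_abs]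
      have hFi' : IntegrableOn F (Ioo s t) :=
        (intervalIntegrable_iff_integrableOn_Ioo_of_le ht.1.le).1 hFi
      have hsub : Ioo s r ⊆ Ioo s t := Ioo_subset_Ioo_right hrt
      refine (norm_integral_le_of_norm_le (hFi'.mono_set hsub) ?_).trans ?_
      · filter_upwards [ae_restrict_mem measurableSet_Ioo] with τ hτ using hgood x τ hτ
      · refine setIntegral_mono_set hFi' ?_ hsub.eventuallyLE
        filter_upwards [ae_restrict_mem measurableSet_Ioo] with τ hτ using hF0 τ hτ
    have b2 : |∫ τ in r..t, heat (t - τ) (h τ) x| ≤ K / 4 * q := by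
      have h1 : ‖∫ τ in r..t, heat (t - τ) (h τ) x‖ ≤ |M| * |t - r| := by
        rw [intervalIntegral.integral_of_le hrt, integral_Ioc_eq_integral_Ioo]
        have h3 := norm_setIntegral_le_of_norm_le_const (μ := volume) (s := Ioo r t) (C := |M|)
          (f := fun τ => heat (t - τ) (h τ) x) (by simp) (fun τ hτ => by
            have hτT : τ ∈ Icc s T := ⟨by linarith [hτ.1], by linarith [hτ.2]⟩
            exact (abs_heat_le_of_bdd (by linarith [hτ.2]) x (hM τ hτT)).trans (le_abs_self _))
        rw [Real.volume_real_Ioo_of_le hrt] at h3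
        rwa [abs_of_nonneg (by linarith : 0 ≤ t - r)]
      rw [Real.norm_eq_abs, abs_of_nonneg (by linarith : 0 ≤ t - r)] at h1
      calc _ ≤ _ := h1
        _ ≤ |M| * η := by gcongr
        _ ≤ K / 4 * 1 := by linarith
        _ ≤ _ := by gcongr
    have b3 : |heat (t - s) (w s) x| ≤ K / 4 * q := by
      refine (abs_heat_Lp_three_le hts (by positivity) hws x).trans (le_of_eq ?_)
      rw [← hq]; ring
    rw [hx, ← intervalIntegral.integral_add_adjacent_intervals i1 i2]
    refine (abs_add_le _ _).trans ?_
    have := abs_add_le (∫ τ in s..r, heat (t - τ) (h τ) x) (∫ τ in r..t, heat (t - τ) (h τ) x)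
    linarith

/-- Continuity at `a` allows a restart time `s > a` with `w s` as small in `L³` as any given `K`
requires. The resulting bound at `b` is uniform in `s`, so letting `K` tend to zero gives `w b = 0`.
-/
theorem eq_zero_of_step (H : IsDifference T U w h) {a b : ℝ} (ha : 0 ≤ a) (hab : a < b)
    (hbT : b ≤ T) (hb1 : b - a ≤ 1) (hbU : 40 * U ^ 2 * (b - a) ≤ 1) (hwa : w a = 0) :
    w b = 0 := by
  obtain ⟨E, hE⟩ := isCompact_Icc.exists_bound_of_continuousOn H.continuousOn
  have hE0 : 0 ≤ E := (norm_nonneg _).trans (hE a ⟨ha, by linarith⟩)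
  have hba : 0 < (b - a) / 2 := by linarith
  have key : ∀ K : ℝ, 0 < K → 48 * (K * E) ^ (3 / 2 : ℝ) ≤ K / 4 →
      ∀ᵐ x, |(w b : E3 → ℝ) x| ≤ K * ((b - a) / 2) ^ (-(1 / 2) : ℝ) := by
    intro K hK hKE
    have hc : Tendsto (fun s => ‖w s‖) (𝓝[>] a) (𝓝 0) := by
      have h1 : Tendsto w (𝓝[Icc 0 T] a) (𝓝 0) := by
        have := H.continuousOn a ⟨ha, by linarith⟩
        rwa [ContinuousWithinAt, hwa] at this
      have h2 : Tendsto w (𝓝[>] a) (𝓝 0) := by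
        refine h1.mono_left (nhdsWithin_le_of_mem ?_)
        filter_upwards [Ioo_mem_nhdsGT (hab.trans_le hbT)] with s hs
        exact ⟨by linarith [hs.1], hs.2.le⟩
      simpa using h2.norm
    obtain ⟨s, hs1, hs2⟩ := ((hc.eventually_lt_const (show (0 : ℝ) < K / 8 by positivity)).and
      (Ioo_mem_nhdsGT (show a < a + (b - a) / 2 by linarith))).exists
    have hsb : s < b := by linarith [hs2.2]
    have hU : 40 * U ^ 2 * (b - s) ≤ 1 := by
      refine le_trans ?_ hbU
      have := hs2.1
      gcongr
    have := H.ae_abs_le (s := s) (b := b) (by linarith [hs2.1]) hbT (by linarith [hs2.1]) hU hK hE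
      hs1.le hKE b ⟨hsb, le_rfl⟩
    filter_upwards [this] with x hx
    refine hx.trans ?_
    refine mul_le_mul_of_nonneg_left ?_ hK.le
    exact Real.rpow_le_rpow_of_nonpos hba (by linarith [hs2.2]) (by norm_num)
  -- Dividing by `K`, the condition becomes `192 E^(3/2) K^(1/2) ≤ 1`, which holds for small `K`.
  have hsmall : ∀ᶠ n : ℕ in atTop, 48 * (1 / ((n : ℝ) + 1) * E) ^ (3 / 2 : ℝ) ≤ 1 / ((n : ℝ) + 1) / 4 := by
    have h1 : Tendsto (fun n : ℕ => 192 * E ^ (3 / 2 : ℝ) * (1 / ((n : ℝ) + 1)) ^ (1 / 2 : ℝ)) atTop (𝓝 0) := by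
      have h2 := (tendsto_one_div_add_atTop_nhds_zero_nat (𝕜 := ℝ)).rpow_const
        (p := 1 / 2) (Or.inr (by norm_num))
      rw [Real.zero_rpow (by norm_num)] at h2
      simpa using h2.const_mul (192 * E ^ (3 / 2 : ℝ))
    filter_upwards [h1.eventually_lt_const zero_lt_one] with n hn
    have hp : 0 < 1 / ((n : ℝ) + 1) := by positivity
    generalize 1 / ((n : ℝ) + 1) = k at *
    rw [Real.mul_rpow hp.le hE0]
    have e : k ^ (3 / 2 : ℝ) = k * k ^ (1 / 2 : ℝ) := by
      nth_rw 2 [← Real.rpow_one k]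
      rw [← Real.rpow_add hp]; norm_num
    rw [e]
    nlinarith
  obtain ⟨N, hN⟩ := eventually_atTop.1 hsmall
  have hall : ∀ᵐ x, ∀ n : ℕ, |(w b : E3 → ℝ) x| ≤
      1 / (((n + N : ℕ) : ℝ) + 1) * ((b - a) / 2) ^ (-(1 / 2) : ℝ) := by
    rw [ae_all_iff]
    intro n
    exact key _ (by positivity) (hN _ (by omega))
  refine (Lp.eq_zero_iff_ae_eq_zero).2 ?_
  filter_upwards [hall] with x hx
  have hlim : Tendsto (fun n : ℕ => 1 / (((n + N : ℕ) : ℝ) + 1) * ((b - a) / 2) ^ (-(1 / 2) : ℝ))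
      atTop (𝓝 0) := by
    have h1 := (tendsto_add_atTop_iff_nat N).2 (tendsto_one_div_add_atTop_nhds_zero_nat (𝕜 := ℝ))
    simpa using h1.mul_const (((b - a) / 2) ^ (-(1 / 2) : ℝ))
  have := ge_of_tendsto' hlim hx
  simpa using this

theorem eq_zero (H : IsDifference T U w h) (hw0 : w 0 = 0) : ∀ t ∈ Icc 0 T, w t = 0 := by
  -- The admissible step depends on `U` alone, so finitely many steps cover `[0,T]`.
  set η := 1 / (40 * U ^ 2 + 1) with hη
  have hη0 : 0 < η := by positivity
  have hη1 : η ≤ 1 := by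
    rw [hη, div_le_one (by positivity)]
    nlinarith [sq_nonneg U]
  have hηU : 40 * U ^ 2 * η ≤ 1 := by
    rw [hη, mul_one_div, div_le_one (by positivity)]
    linarith
  suffices hstep : ∀ n : ℕ, ∀ t ∈ Icc 0 T, t ≤ n * η → w t = 0 by
    intro t ht
    obtain ⟨n, hn⟩ := exists_nat_ge (t / η)
    exact hstep n t ht ((div_le_iff₀ hη0).1 hn)
  intro n
  induction n with
  | zero =>
    intro t ht h1
    simp at h1
    rw [le_antisymm h1 ht.1, hw0]
  | succ n ih =>
    intro t ht h1
    rcases le_or_gt t (n * η) with h2 | h2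
    · exact ih t ht h2
    · have h3 : t - n * η ≤ η := by push_cast at h1; linarith
      have h0 : 0 ≤ n * η := by positivity
      refine H.eq_zero_of_step (a := n * η) h0 h2 ht.2 (h3.trans hη1) ?_
        (ih _ ⟨h0, h2.le.trans ht.2⟩ le_rfl)
      refine le_trans ?_ hηU
      gcongr

end IsDifference

/-- A Weissler solution which is bounded up to time zero is the only one with its datum. -/
theorem IsWeisslerSolution.eq_of_bounded {u₀ : 𝓢(E3, ℝ)} {T : ℝ}
    {u v : ℝ → Lp ℝ 3 (volume : Measure E3)} (hu : IsWeisslerSolution u₀ T u)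
    (hv : IsWeisslerSolution u₀ T v) {U : ℝ}
    (hU : ∀ t ∈ Icc 0 T, ∀ᵐ y, |(u t : E3 → ℝ) y| ≤ U) : ∀ t ∈ Icc 0 T, v t = u t := by
  have hF : IsForcing T (fun τ y => (v τ : E3 → ℝ) y ^ 3 - (u τ : E3 → ℝ) y ^ 3) :=
    hv.isForcing.sub hu.isForcing
  have hrep : ∀ t ∈ Ioc 0 T, ∀ᵐ x : E3, ((v t - u t : Lp ℝ 3 (volume : Measure E3)) : E3 → ℝ) x =
      ∫ τ in (0 : ℝ)..t, heat (t - τ) (fun y => (v τ : E3 → ℝ) y ^ 3 - (u τ : E3 → ℝ) y ^ 3) x := by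
    intro t ht
    filter_upwards [hu.duhamel t ht, hv.duhamel t ht, Lp.coeFn_sub (v t) (u t)] with x h1 h2 h3
    rw [h3, Pi.sub_apply, h1, h2, add_sub_add_left_eq_sub, ← intervalIntegral.integral_sub
      (hv.isForcing.intervalIntegrable_heat ht.1 ht.2 x)
      (hu.isForcing.intervalIntegrable_heat ht.1 ht.2 x)]
    rw [intervalIntegral.integral_of_le ht.1.le, intervalIntegral.integral_of_le ht.1.le,
      integral_Ioc_eq_integral_Ioo, integral_Ioc_eq_integral_Ioo]
    refine setIntegral_congr_fun measurableSet_Ioo fun τ hτ => ?_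
    exact (heat_sub (sub_pos.2 hτ.2) (integrable_pow_three _) (integrable_pow_three _) x).symm
  have H : IsDifference T U (fun t => v t - u t)
      (fun τ y => (v τ : E3 → ℝ) y ^ 3 - (u τ : E3 → ℝ) y ^ 3) := by
    refine ⟨hF, hv.continuousOn.sub hu.continuousOn, ?_, ?_⟩
    · intro s t hs hst ht
      have hcong : ∀ x, heat (t - s) ((v s - u s : Lp ℝ 3 (volume : Measure E3)) : E3 → ℝ) x = _ :=
        fun x => heat_congr_ae (hrep s ⟨hs, hst.le.trans ht⟩) x
      filter_upwards [hrep t ⟨hs.trans hst, ht⟩] with x hx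
      have hi := hF.intervalIntegrable_heat (hs.trans hst) ht x
      rw [hx, hcong, hF.heat_duhamel hs hst ht,
        intervalIntegral.integral_add_adjacent_intervals]
      · exact hi.mono_set (by
          rw [uIcc_of_le hs.le, uIcc_of_le (by linarith)]
          exact Icc_subset_Icc le_rfl hst.le)
      · exact hi.mono_set (by
          rw [uIcc_of_le hst.le, uIcc_of_le (by linarith)]
          exact Icc_subset_Icc hs.le le_rfl)
    · intro τ hτ
      filter_upwards [hU τ hτ, Lp.coeFn_sub (v τ) (u τ)] with y hy h3
      rw [h3, Pi.sub_apply]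
      set a := (v τ : E3 → ℝ) y
      set b := (u τ : E3 → ℝ) y
      have e : a ^ 3 - b ^ 3 = (a - b) ^ 3 + 3 * b * (a - b) ^ 2 + 3 * b ^ 2 * (a - b) := by ring
      rw [e]
      refine (abs_add_three _ _ _).trans ?_
      simp only [abs_mul, abs_pow, Nat.abs_ofNat]
      have hd := abs_nonneg (a - b)
      have hb := abs_nonneg b
      generalize |a - b| = d at *
      generalize |b| = e at *
      have h1 : e ^ 2 ≤ U ^ 2 := by gcongr
      -- The mixed term is removed by `2 e d ≤ e^2 + d^2` multiplied by `d`.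
      nlinarith [mul_nonneg hd (sq_nonneg (e - d)), mul_le_mul_of_nonneg_right h1 hd, pow_nonneg hd 3]
  intro t ht
  refine sub_eq_zero.1 (H.eq_zero ?_ t ht)
  rw [hu.initial, hv.initial, sub_self]

/-! ### The heat symbol and threefold convolutions of nonnegative densities. -/

/-- The Fourier symbol of the heat semigroup. -/
noncomputable def symb (t : ℝ) (ξ : E3) : ℝ≥0∞ :=
  ENNReal.ofReal (Real.exp (-(4 * Real.pi ^ 2 * t) * ‖ξ‖ ^ 2))

theorem symb_anti {s t : ℝ} (h : s ≤ t) (ξ : E3) : symb t ξ ≤ symb s ξ := by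
  unfold symb
  gcongr

theorem symb_zero (ξ : E3) : symb 0 ξ = 1 := by simp [symb]

theorem symb_le_one {t : ℝ} (h : 0 ≤ t) (ξ : E3) : symb t ξ ≤ 1 :=
  (symb_anti h ξ).trans_eq (symb_zero ξ)

theorem symb_neg (t : ℝ) (ξ : E3) : symb t (-ξ) = symb t ξ := by simp [symb]

@[fun_prop]
theorem measurable_symb : Measurable (fun p : ℝ × E3 => symb p.1 p.2) := by
  unfold symb
  fun_prop

/-- The threefold convolution `f ∗ f ∗ f`, which represents the cube on the Fourier side. -/
noncomputable def conv3 (f : E3 → ℝ≥0∞) : E3 → ℝ≥0∞ :=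
  lconvolution f (lconvolution f f volume) volume

theorem conv3_apply (f : E3 → ℝ≥0∞) (ξ : E3) :
    conv3 f ξ = ∫⁻ a, f a * ∫⁻ b, f b * f (-b + (-a + ξ)) := by
  simp only [conv3, lconvolution_def]

theorem conv3_mono {f g : E3 → ℝ≥0∞} (h : f ≤ g) (ξ : E3) : conv3 f ξ ≤ conv3 g ξ := by
  simp only [conv3_apply]
  exact lintegral_mono fun a => mul_le_mul' (h a)
    (lintegral_mono fun b => mul_le_mul' (h b) (h _))

theorem measurable_conv3 {f : E3 → ℝ≥0∞} (hf : Measurable f) : Measurable (conv3 f) :=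
  measurable_lconvolution _ hf (measurable_lconvolution _ hf hf)

theorem measurable_conv3_family {F : ℝ → E3 → ℝ≥0∞}
    (hF : Measurable (fun p : ℝ × E3 => F p.1 p.2)) :
    Measurable (fun p : ℝ × E3 => conv3 (F p.1) p.2) := by
  simp only [conv3_apply]
  refine Measurable.lintegral_prod_right' (f := fun q : (ℝ × E3) × E3 =>
    F q.1.1 q.2 * ∫⁻ b, F q.1.1 b * F q.1.1 (-b + (-q.2 + q.1.2))) ?_
  refine Measurable.mul (hF.comp (by fun_prop : Measurable fun q : (ℝ × E3) × E3 => (q.1.1, q.2))) ?_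
  refine Measurable.lintegral_prod_right' (f := fun q : ((ℝ × E3) × E3) × E3 =>
    F q.1.1.1 q.2 * F q.1.1.1 (-q.2 + (-q.1.2 + q.1.1.2))) ?_
  exact (hF.comp (by fun_prop : Measurable fun q : ((ℝ × E3) × E3) × E3 => (q.1.1.1, q.2))).mul
    (hF.comp (by fun_prop : Measurable fun q : ((ℝ × E3) × E3) × E3 =>
      (q.1.1.1, -q.2 + (-q.1.2 + q.1.1.2))))

theorem lintegral_lconvolution {f g : E3 → ℝ≥0∞} (hf : Measurable f) (hg : Measurable g) :
    ∫⁻ x, lconvolution f g volume x = (∫⁻ x, f x) * ∫⁻ x, g x := by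
  simp only [lconvolution_def]
  rw [lintegral_lintegral_swap]
  · have h : ∀ y, ∫⁻ x, f y * g (-y + x) = f y * ∫⁻ x, g x := by
      intro y
      rw [lintegral_const_mul _ (by fun_prop), lintegral_add_left_eq_self g (-y)]
    simp_rw [h]
    rw [lintegral_mul_const _ hf]
  · exact ((hf.comp measurable_snd).mul (hg.comp (by fun_prop))).aemeasurable

theorem lintegral_conv3 {f : E3 → ℝ≥0∞} (hf : Measurable f) :
    ∫⁻ x, conv3 f x = (∫⁻ x, f x) ^ 3 := by
  rw [conv3, lintegral_lconvolution hf (measurable_lconvolution _ hf hf),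
    lintegral_lconvolution hf hf]
  ring

theorem lconvolution_le {f g : E3 → ℝ≥0∞} (hf : Measurable f) {B : ℝ≥0∞} (hB : ∀ x, g x ≤ B) (x : E3) :
    lconvolution f g volume x ≤ (∫⁻ x, f x) * B := by
  rw [lconvolution_def, ← lintegral_mul_const _ hf]
  exact lintegral_mono fun y => mul_le_mul' le_rfl (hB _)

theorem conv3_le {f : E3 → ℝ≥0∞} (hf : Measurable f) {B : ℝ≥0∞} (hB : ∀ x, f x ≤ B) (x : E3) :
    conv3 f x ≤ (∫⁻ x, f x) ^ 2 * B := by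
  refine (lconvolution_le hf (lconvolution_le hf hB) x).trans_eq ?_
  ring

theorem lconvolution_neg {f g : E3 → ℝ≥0∞} (hf : ∀ x, f (-x) = f x) (hg : ∀ x, g (-x) = g x)
    (x : E3) : lconvolution f g volume (-x) = lconvolution f g volume x := by
  simp only [lconvolution_def]
  rw [← lintegral_neg_eq_self]
  refine lintegral_congr fun y => ?_
  rw [hf, ← hg]
  congr 2
  abel

theorem conv3_neg {f : E3 → ℝ≥0∞} (hf : ∀ x, f (-x) = f x) (x : E3) :
    conv3 f (-x) = conv3 f x :=
  lconvolution_neg hf (lconvolution_neg hf hf) x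

theorem iSup_mul_iSup_of_monotone {u v : ℕ → ℝ≥0∞} (hu : Monotone u) (hv : Monotone v) :
    (⨆ n, u n) * ⨆ n, v n = ⨆ n, u n * v n := by
  refine le_antisymm ?_ ENNReal.iSup_mul_le
  rw [ENNReal.iSup_mul]
  refine iSup_le fun m => ?_
  rw [ENNReal.mul_iSup]
  refine iSup_le fun n => ?_
  exact (mul_le_mul' (hu (le_max_left m n)) (hv (le_max_right m n))).trans
    (le_iSup (fun k => u k * v k) (max m n))

theorem conv3_iSup {F : ℕ → E3 → ℝ≥0∞} (hm : ∀ n, Measurable (F n)) (hF : Monotone F) (ξ : E3) :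
    conv3 (fun x => ⨆ n, F n x) ξ = ⨆ n, conv3 (F n) ξ := by
  have hF' : ∀ x, Monotone fun n => F n x := fun x m n h => hF h x
  simp only [conv3_apply]
  have h1 : ∀ a, ∫⁻ b, (⨆ n, F n b) * (⨆ n, F n (-b + (-a + ξ))) =
      ⨆ n, ∫⁻ b, F n b * F n (-b + (-a + ξ)) := by
    intro a
    rw [← lintegral_iSup]
    · exact lintegral_congr fun b => iSup_mul_iSup_of_monotone (hF' _) (hF' _)
    · exact fun n => (hm n).mul ((hm n).comp (by fun_prop))
    · exact fun m n h b => mul_le_mul' (hF h _) (hF h _)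
  simp_rw [h1]
  rw [← lintegral_iSup]
  · refine lintegral_congr fun a => iSup_mul_iSup_of_monotone (hF' _) ?_
    exact fun m n h => lintegral_mono fun b => mul_le_mul' (hF h _) (hF h _)
  · intro n
    refine (hm n).mul ?_
    refine Measurable.lintegral_prod_right' (f := fun q : E3 × E3 => F n q.2 * F n (-q.2 + (-q.1 + ξ))) ?_
    exact ((hm n).comp measurable_snd).mul ((hm n).comp (by fun_prop))
  · exact fun m n h a => mul_le_mul' (hF h _)
      (lintegral_mono fun b => mul_le_mul' (hF h _) (hF h _))

/-! ### The minimal solution on the Fourier side. -/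

/-- The Picard iterates of the cubic heat equation on the Fourier side. -/
noncomputable def picard (f₀ : E3 → ℝ≥0∞) : ℕ → ℝ → E3 → ℝ≥0∞
  | 0 => fun _ _ => 0
  | n + 1 => fun t ξ => symb t ξ * f₀ ξ +
      ∫⁻ τ in Ioo 0 t, symb (t - τ) ξ * conv3 (picard f₀ n τ) ξ

/-- The minimal nonnegative solution of the cubic heat equation on the Fourier side. -/
noncomputable def fsol (f₀ : E3 → ℝ≥0∞) (t : ℝ) (ξ : E3) : ℝ≥0∞ := ⨆ n, picard f₀ n t ξ

variable {f₀ : E3 → ℝ≥0∞}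

theorem picard_le_succ (f₀ : E3 → ℝ≥0∞) (n : ℕ) : picard f₀ n ≤ picard f₀ (n + 1) := by
  induction n with
  | zero => exact fun t ξ => zero_le
  | succ n ih =>
    intro t ξ
    refine add_le_add le_rfl (lintegral_mono fun τ => mul_le_mul' le_rfl ?_)
    exact conv3_mono (ih τ) ξ

theorem monotone_picard (f₀ : E3 → ℝ≥0∞) : Monotone (picard f₀) :=
  monotone_nat_of_le_succ (picard_le_succ f₀)

theorem measurable_duhamel {G : ℝ → E3 → ℝ≥0∞} (hG : Measurable fun p : ℝ × E3 => G p.1 p.2) :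
    Measurable (fun p : ℝ × E3 => ∫⁻ τ in Ioo 0 p.1, symb (p.1 - τ) p.2 * G τ p.2) := by
  simp_rw [← lintegral_indicator measurableSet_Ioo]
  refine Measurable.lintegral_prod_right' (f := fun q : (ℝ × E3) × ℝ =>
    (Ioo 0 q.1.1).indicator (fun τ => symb (q.1.1 - τ) q.1.2 * G τ q.1.2) q.2) ?_
  have h : (fun q : (ℝ × E3) × ℝ =>
      (Ioo 0 q.1.1).indicator (fun τ => symb (q.1.1 - τ) q.1.2 * G τ q.1.2) q.2) =
      {q : (ℝ × E3) × ℝ | 0 < q.2 ∧ q.2 < q.1.1}.indicator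
        (fun q => symb (q.1.1 - q.2) q.1.2 * G q.2 q.1.2) := by
    ext q
    simp only [indicator, mem_Ioo, mem_ofPred_eq]
  rw [h]
  refine Measurable.indicator ?_ ?_
  · exact (measurable_symb.comp (by fun_prop : Measurable fun q : (ℝ × E3) × ℝ =>
      (q.1.1 - q.2, q.1.2))).mul (hG.comp (by fun_prop : Measurable fun q : (ℝ × E3) × ℝ =>
      (q.2, q.1.2)))
  · exact (measurableSet_lt measurable_const measurable_snd).inter
      (measurableSet_lt measurable_snd (measurable_fst.comp measurable_fst))

theorem measurable_picard (hf₀ : Measurable f₀) (n : ℕ) :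
    Measurable (fun p : ℝ × E3 => picard f₀ n p.1 p.2) := by
  induction n with
  | zero => exact measurable_const
  | succ n ih =>
    exact (measurable_symb.mul (hf₀.comp measurable_snd)).add
      (measurable_duhamel (G := fun τ ξ => conv3 (picard f₀ n τ) ξ) (measurable_conv3_family ih))

theorem measurable_picard_apply (hf₀ : Measurable f₀) (n : ℕ) (t : ℝ) :
    Measurable (picard f₀ n t) :=
  (measurable_picard hf₀ n).comp (measurable_const.prodMk measurable_id)

theorem measurable_fsol (hf₀ : Measurable f₀) :
    Measurable (fun p : ℝ × E3 => fsol f₀ p.1 p.2) :=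
  Measurable.iSup fun n => measurable_picard hf₀ n

theorem measurable_fsol_apply (hf₀ : Measurable f₀) (t : ℝ) : Measurable (fsol f₀ t) :=
  (measurable_fsol hf₀).comp (measurable_const.prodMk measurable_id)

/-- All terms are nonnegative and increase with the iteration index, so monotone convergence passes
to the limit in the Picard recursion, infinite values included. -/
theorem fsol_eq (hf₀ : Measurable f₀) (t : ℝ) (ξ : E3) :
    fsol f₀ t ξ = symb t ξ * f₀ ξ +
      ∫⁻ τ in Ioo 0 t, symb (t - τ) ξ * conv3 (fsol f₀ τ) ξ := by
  have hmono : ∀ ξ t, Monotone fun n => picard f₀ n t ξ :=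
    fun ξ t m n h => monotone_picard f₀ h t ξ
  have h1 : fsol f₀ t ξ = ⨆ n, picard f₀ (n + 1) t ξ :=
    ((hmono ξ t).iSup_nat_add 1).symm
  have h2 : ∀ τ, conv3 (fsol f₀ τ) ξ = ⨆ n, conv3 (picard f₀ n τ) ξ := fun τ =>
    conv3_iSup (fun n => measurable_picard_apply hf₀ n τ) (fun m n h => monotone_picard f₀ h τ) ξ
  rw [h1]
  simp only [picard]
  simp_rw [← ENNReal.add_iSup, h2, ENNReal.mul_iSup]
  rw [lintegral_iSup]
  · intro n
    exact (measurable_symb.comp (by fun_prop : Measurable fun τ : ℝ => (t - τ, ξ))).mul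
      ((measurable_conv3_family (measurable_picard hf₀ n)).comp
        (by fun_prop : Measurable fun τ : ℝ => (τ, ξ)))
  · exact fun m n h τ => mul_le_mul' le_rfl (conv3_mono (monotone_picard f₀ h τ) ξ)

theorem fsol_zero (hf₀ : Measurable f₀) (ξ : E3) : fsol f₀ 0 ξ = f₀ ξ := by
  rw [fsol_eq hf₀, symb_zero]
  simp

theorem fsol_neg (heven : ∀ ξ, f₀ (-ξ) = f₀ ξ) (t : ℝ) (ξ : E3) :
    fsol f₀ t (-ξ) = fsol f₀ t ξ := by
  have h : ∀ n t ξ, picard f₀ n t (-ξ) = picard f₀ n t ξ := by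
    intro n
    induction n with
    | zero => exact fun t ξ => rfl
    | succ n ih =>
      intro t ξ
      simp only [picard, symb_neg, heven, conv3_neg (ih _)]
  simp only [fsol, h]

/-! ### Mass, continuation and lifespan. -/

/-- The total mass of the minimal solution. -/
noncomputable def mass (f₀ : E3 → ℝ≥0∞) (t : ℝ) : ℝ≥0∞ := ∫⁻ ξ, fsol f₀ t ξ

theorem mass_eq_iSup (hf₀ : Measurable f₀) (t : ℝ) :
    mass f₀ t = ⨆ n, ∫⁻ ξ, picard f₀ n t ξ :=
  lintegral_iSup (fun n => measurable_picard_apply hf₀ n t) fun _ _ h => monotone_picard f₀ h t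

theorem lintegral_picard_le_mass (f₀ : E3 → ℝ≥0∞) (n : ℕ) (t : ℝ) :
    ∫⁻ ξ, picard f₀ n t ξ ≤ mass f₀ t :=
  lintegral_mono fun ξ => le_iSup (fun n => picard f₀ n t ξ) n

/-- The symbol decreases in time and is at most one, so restarting at `t₀` costs only an inequality.
Integrated in `ξ`, this is the integral form of `M' ≤ M^3`. -/
theorem picard_succ_le {t₀ t : ℝ} (ht : t₀ ≤ t) (n : ℕ) (ξ : E3) :
    picard f₀ (n + 1) t ξ ≤ picard f₀ (n + 1) t₀ ξ + ∫⁻ τ in Ico t₀ t, conv3 (picard f₀ n τ) ξ := by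
  simp only [picard]
  rw [add_assoc]
  refine add_le_add (mul_le_mul' (symb_anti ht ξ) le_rfl) ?_
  have hsub : Ioo 0 t ⊆ Ioo 0 t₀ ∪ Ico t₀ t := by
    intro τ hτ
    rcases lt_or_ge τ t₀ with h | h
    · exact Or.inl ⟨hτ.1, h⟩
    · exact Or.inr ⟨h, hτ.2⟩
  refine (lintegral_mono_set hsub).trans ((lintegral_union_le _ _ _).trans ?_)
  refine add_le_add (lintegral_mono fun τ => mul_le_mul' (symb_anti (by linarith) ξ) le_rfl) ?_
  refine setLIntegral_mono' measurableSet_Ico fun τ hτ => ?_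
  exact mul_le_of_le_one_left' (symb_le_one (by linarith [hτ.2]) ξ)

theorem lintegral_picard_succ_le (hf₀ : Measurable f₀) {t₀ t : ℝ} (ht : t₀ ≤ t)
    (n : ℕ) :
    ∫⁻ ξ, picard f₀ (n + 1) t ξ ≤
      mass f₀ t₀ + ∫⁻ τ in Ico t₀ t, (∫⁻ ξ, picard f₀ n τ ξ) ^ 3 := by
  have hm : Measurable (fun p : E3 × ℝ => conv3 (picard f₀ n p.2) p.1) :=
    (measurable_conv3_family (measurable_picard hf₀ n)).comp measurable_swap
  calc ∫⁻ ξ, picard f₀ (n + 1) t ξ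
      ≤ ∫⁻ ξ, (picard f₀ (n + 1) t₀ ξ + ∫⁻ τ in Ico t₀ t, conv3 (picard f₀ n τ) ξ) :=
        lintegral_mono fun ξ => picard_succ_le ht n ξ
    _ = (∫⁻ ξ, picard f₀ (n + 1) t₀ ξ) + ∫⁻ ξ, ∫⁻ τ in Ico t₀ t, conv3 (picard f₀ n τ) ξ :=
        lintegral_add_left (measurable_picard_apply hf₀ _ _) _
    _ = (∫⁻ ξ, picard f₀ (n + 1) t₀ ξ) + ∫⁻ τ in Ico t₀ t, ∫⁻ ξ, conv3 (picard f₀ n τ) ξ := by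
        rw [lintegral_lintegral_swap hm.aemeasurable]
    _ ≤ _ := by
        refine add_le_add (lintegral_picard_le_mass f₀ _ _) (le_of_eq ?_)
        exact lintegral_congr fun τ => lintegral_conv3 (measurable_picard_apply hf₀ n τ)

/-- The mass at most doubles on a time interval whose length depends only on the initial mass. -/
theorem mass_le_two_mul (hf₀ : Measurable f₀) {t₀ t : ℝ} (ht : t₀ ≤ t) {A : ℝ≥0∞}
    (hA : mass f₀ t₀ ≤ A) (hs : 8 * A ^ 2 * ENNReal.ofReal (t - t₀) ≤ 1) :
    mass f₀ t ≤ 2 * A := by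
  have h : ∀ n, ∀ r ∈ Icc t₀ t, ∫⁻ ξ, picard f₀ n r ξ ≤ 2 * A := by
    intro n
    induction n with
    | zero => intro r _; simp [picard]
    | succ n ih =>
      intro r hr
      refine (lintegral_picard_succ_le hf₀ hr.1 n).trans ?_
      have h1 : ∫⁻ τ in Ico t₀ r, (∫⁻ ξ, picard f₀ n τ ξ) ^ 3 ≤ ∫⁻ τ in Ico t₀ r, (2 * A) ^ 3 :=
        setLIntegral_mono' measurableSet_Ico fun τ hτ =>
          pow_le_pow_left' (ih τ ⟨hτ.1, hτ.2.le.trans hr.2⟩) 3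
      rw [setLIntegral_const, Real.volume_Ico] at h1
      have h2 : (2 * A) ^ 3 * ENNReal.ofReal (r - t₀) ≤ A := by
        calc (2 * A) ^ 3 * ENNReal.ofReal (r - t₀) ≤ (2 * A) ^ 3 * ENNReal.ofReal (t - t₀) := by
              gcongr; exact hr.2
          _ = (8 * A ^ 2 * ENNReal.ofReal (t - t₀)) * A := by ring
          _ ≤ 1 * A := by gcongr
          _ = A := one_mul A
      rw [two_mul]
      exact add_le_add hA (h1.trans h2)
  rw [mass_eq_iSup hf₀]
  exact iSup_le fun n => h n t ⟨ht, le_rfl⟩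

/-- A Grönwall argument: with mass at most `M`, the threefold convolution multiplies a sup bound by
at most `M^2`. Thus data bounded on the Fourier side stay bounded as long as the mass does. -/
theorem fsol_le_of_mass_le (hf₀ : Measurable f₀) {B : ℝ} (hB0 : 0 ≤ B)
    (hB : ∀ ξ, f₀ ξ ≤ ENNReal.ofReal B)
    {T M : ℝ} (hM0 : 0 ≤ M) (hM : ∀ t ∈ Icc 0 T, mass f₀ t ≤ ENNReal.ofReal M) :
    ∀ t ∈ Icc 0 T, ∀ ξ, fsol f₀ t ξ ≤ ENNReal.ofReal (B * Real.exp (M ^ 2 * t)) := by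
  have h : ∀ n, ∀ t ∈ Icc 0 T, ∀ ξ, picard f₀ n t ξ ≤ ENNReal.ofReal (B * Real.exp (M ^ 2 * t)) := by
    intro n
    induction n with
    | zero => intro t _ ξ; simp [picard]
    | succ n ih =>
      intro t ht ξ
      simp only [picard]
      have h1 : ∫⁻ τ in Ioo 0 t, symb (t - τ) ξ * conv3 (picard f₀ n τ) ξ ≤
          ∫⁻ τ in Ioo 0 t, ENNReal.ofReal (M ^ 2 * (B * Real.exp (M ^ 2 * τ))) := by
        refine setLIntegral_mono' measurableSet_Ioo fun τ hτ => ?_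
        have hτT : τ ∈ Icc 0 T := ⟨hτ.1.le, hτ.2.le.trans ht.2⟩
        refine (mul_le_of_le_one_left' (symb_le_one (by linarith [hτ.2]) ξ)).trans ?_
        refine (conv3_le (measurable_picard_apply hf₀ n τ) (ih τ hτT) ξ).trans ?_
        rw [ENNReal.ofReal_mul (p := M ^ 2) (by positivity), ENNReal.ofReal_pow hM0]
        gcongr
        exact (lintegral_picard_le_mass f₀ n τ).trans (hM τ hτT)
      have h2 : ∫⁻ τ in Ioo 0 t, ENNReal.ofReal (M ^ 2 * (B * Real.exp (M ^ 2 * τ))) =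
          ENNReal.ofReal (B * Real.exp (M ^ 2 * t) - B) := by
        have hc : Continuous fun τ : ℝ => M ^ 2 * (B * Real.exp (M ^ 2 * τ)) := by fun_prop
        have hi : IntervalIntegrable (fun τ : ℝ => M ^ 2 * (B * Real.exp (M ^ 2 * τ))) volume 0 t :=
          hc.intervalIntegrable _ _
        rw [← ofReal_integral_eq_lintegral_ofReal]
        · rw [← integral_Ioc_eq_integral_Ioo, ← intervalIntegral.integral_of_le ht.1]
          rw [intervalIntegral.integral_eq_sub_of_hasDerivAt
            (f := fun τ => B * Real.exp (M ^ 2 * τ)) (fun τ _ => ?_) hi]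
          · simp
          · have h3 : HasDerivAt (fun τ : ℝ => M ^ 2 * τ) (M ^ 2) τ := by
              simpa using (hasDerivAt_id τ).const_mul (M ^ 2)
            have h4 := h3.exp.const_mul B
            have e : B * (Real.exp (M ^ 2 * τ) * M ^ 2) = M ^ 2 * (B * Real.exp (M ^ 2 * τ)) := by ring
            rwa [e] at h4
        · exact (intervalIntegrable_iff_integrableOn_Ioo_of_le ht.1).1 hi
        · exact ae_of_all _ fun τ => by positivity
      rw [h2] at h1
      have hexp : 1 ≤ Real.exp (M ^ 2 * t) := Real.one_le_exp (mul_nonneg (sq_nonneg M) ht.1)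
      refine (add_le_add ((mul_le_of_le_one_left' (symb_le_one ht.1 ξ)).trans (hB ξ)) h1).trans ?_
      rw [← ENNReal.ofReal_add hB0 (by nlinarith)]
      refine ENNReal.ofReal_le_ofReal (by linarith)
  exact fun t ht ξ => iSup_le fun n => h n t ht ξ

/-- Mass at most `L` at a time in `G` allows continuation by `1/(8L^2)`, a length depending on `L`
only. Hence near the supremum of `G` the mass exceeds every `L`, a full limit and not only an upper
limit. -/
theorem exists_lifespan (hf₀ : Measurable f₀) (hfin : ∫⁻ ξ, f₀ ξ ≠ ∞) {s : ℝ} (hs : 0 ≤ s)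
    (hinf : mass f₀ s = ∞) :
    ∃ Tmax : ℝ, 0 < Tmax ∧ Tmax ≤ s ∧
      (∀ T < Tmax, ∃ A : ℝ≥0, ∀ t ∈ Icc 0 T, mass f₀ t ≤ A) ∧
      Tendsto (mass f₀) (𝓝[<] Tmax) (𝓝 ∞) := by
  set G : Set ℝ := {t | 0 ≤ t ∧ ∃ A : ℝ≥0, ∀ r ∈ Icc 0 t, mass f₀ r ≤ A} with hG
  have hbdd : ∀ t ∈ G, t ≤ s := by
    rintro t ⟨_, A, hA⟩
    by_contra! h
    have := hA s ⟨hs, h.le⟩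
    rw [hinf] at this
    exact absurd this (by simp)
  have hext : ∀ t ∈ G, ∀ L : ℝ≥0, 0 < L → mass f₀ t ≤ L → t + 1 / (8 * (L : ℝ) ^ 2) ∈ G := by
    rintro t ⟨ht0, A, hA⟩ L hL htL
    have hL' : (0 : ℝ) < L := hL
    refine ⟨by positivity, max A (2 * L), fun r hr => ?_⟩
    rcases le_total r t with h | h
    · exact (hA r ⟨hr.1, h⟩).trans (by gcongr; exact le_max_left _ _)
    · refine (mass_le_two_mul hf₀ h htL ?_).trans ?_
      · have e : (8 : ℝ≥0∞) * (L : ℝ≥0∞) ^ 2 = ENNReal.ofReal (8 * (L : ℝ) ^ 2) := by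
          rw [ENNReal.ofReal_mul (by norm_num), ENNReal.ofReal_pow hL'.le, ENNReal.ofReal_coe_nnreal]
          norm_num
        rw [e, ← ENNReal.ofReal_mul (by positivity), ← ENNReal.ofReal_one]
        refine ENNReal.ofReal_le_ofReal ?_
        have h1 : r - t ≤ 1 / (8 * (L : ℝ) ^ 2) := by linarith [hr.2]
        rwa [le_div_iff₀ (by positivity), mul_comm] at h1
      · have : (2 : ℝ≥0∞) * L = ((2 * L : ℝ≥0) : ℝ≥0∞) := by push_cast; rfl
        rw [this]
        gcongr
        exact le_max_right _ _
  have h0G : (0 : ℝ) ∈ G := by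
    refine ⟨le_rfl, (∫⁻ ξ, f₀ ξ).toNNReal, fun r hr => ?_⟩
    rw [le_antisymm hr.2 hr.1, ENNReal.coe_toNNReal hfin]
    exact lintegral_mono fun ξ => (fsol_zero hf₀ ξ).le
  have hbd : BddAbove G := ⟨s, hbdd⟩
  have hdown : ∀ T < sSup G, ∃ A : ℝ≥0, ∀ t ∈ Icc 0 T, mass f₀ t ≤ A := by
    intro T hT
    obtain ⟨t, ⟨_, A, hA⟩, hTt⟩ := exists_lt_of_lt_csSup ⟨0, h0G⟩ hT
    exact ⟨A, fun r hr => hA r ⟨hr.1, hr.2.trans hTt.le⟩⟩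
  have hpos : 0 < sSup G := by
    obtain ⟨_, A, hA⟩ := h0G
    have h1 := hext 0 ⟨le_rfl, A, hA⟩ (A + 1) (by positivity)
      ((hA 0 ⟨le_rfl, le_rfl⟩).trans (by gcongr; simp))
    refine lt_of_lt_of_le ?_ (le_csSup hbd h1)
    positivity
  refine ⟨sSup G, hpos, csSup_le ⟨0, h0G⟩ hbdd, hdown, ?_⟩
  rw [ENNReal.tendsto_nhds_top_iff_nnreal]
  intro x
  have hlt : max 0 (sSup G - 1 / (8 * ((x + 1 : ℝ≥0) : ℝ) ^ 2)) < sSup G := by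
    refine max_lt hpos (sub_lt_self _ ?_)
    have : (0 : ℝ) < (x + 1 : ℝ≥0) := by positivity
    positivity
  filter_upwards [Ioo_mem_nhdsLT hlt] with t ht
  by_contra! hx
  have ht0 : 0 ≤ t := (le_max_left _ _).trans ht.1.le
  obtain ⟨A, hA⟩ := hdown t ht.2
  have h1 := hext t ⟨ht0, A, hA⟩ (x + 1) (by positivity) (hx.trans (by gcongr; simp))
  have h2 := le_csSup hbd h1
  have h3 := (le_max_right 0 (sSup G - 1 / (8 * ((x + 1 : ℝ≥0) : ℝ) ^ 2))).trans_lt ht.1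
  linarith

/-! ### Inverse Fourier transforms: sup bound, Plancherel, multipliers. -/

theorem norm_fourierInv_le (F : E3 → ℂ) (x : E3) : ‖𝓕⁻ F x‖ ≤ ∫ ξ, ‖F ξ‖ := by
  rw [Real.fourierInv_eq]
  refine (norm_integral_le_integral_norm _).trans (le_of_eq ?_)
  simp only [Circle.norm_smul]

theorem continuous_fourierInv {F : E3 → ℂ} (hF : Integrable F) : Continuous (𝓕⁻ F) := by
  have h : 𝓕⁻ F = fun x => 𝓕 F (-x) := by
    ext x
    exact Real.fourierInv_eq_fourier_neg F x
  rw [h]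
  have h2 : Continuous (𝓕 F) :=
    VectorFourier.fourierIntegral_continuous Real.continuous_fourierChar
      (by exact continuous_inner) hF
  exact h2.comp continuous_neg

theorem continuous_fourierChar_inner :
    Continuous fun p : E3 × E3 => (Real.fourierChar (inner ℝ p.1 p.2) : ℂ) :=
  continuous_subtype_val.comp (Real.continuous_fourierChar.comp continuous_inner)

theorem fourierInv_sub {F G : E3 → ℂ} (hF : Integrable F) (hG : Integrable G) (x : E3) :
    𝓕⁻ (fun ξ => F ξ - G ξ) x = 𝓕⁻ F x - 𝓕⁻ G x := by
  have hi : ∀ {H : E3 → ℂ}, Integrable H → Integrable fun ξ => (Real.fourierChar (inner ℝ ξ x)) • H ξ := by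
    intro H hH
    refine hH.norm.mono' ?_ (ae_of_all _ fun ξ => by simp [Circle.norm_smul])
    refine AEStronglyMeasurable.smul ?_ hH.1
    exact (continuous_fourierChar_inner.comp
      (continuous_id.prodMk continuous_const : Continuous fun ξ : E3 => (ξ, x))).aestronglyMeasurable
  simp only [Real.fourierInv_eq]
  rw [← integral_sub (hi hF) (hi hG)]
  simp_rw [smul_sub]

theorem integral_fourierInv_mul {f g : E3 → ℂ} (hf : Integrable f) (hg : Integrable g) :
    ∫ x, 𝓕⁻ g x * f x = ∫ x, g x * 𝓕⁻ f x := by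
  simp only [Real.fourierInv_eq]
  simp_rw [← integral_mul_const, ← integral_const_mul]
  rw [integral_integral_swap]
  · refine integral_congr_ae (ae_of_all _ fun ξ => integral_congr_ae (ae_of_all _ fun x => ?_))
    simp only [Circle.smul_def, smul_eq_mul]
    rw [real_inner_comm]
    ring
  · refine (hf.mul_prod hg).norm.mono' ?_ (ae_of_all _ fun p => ?_)
    · refine AEStronglyMeasurable.mul (AEStronglyMeasurable.smul ?_ hg.1.comp_snd) hf.1.comp_fst
      exact (continuous_fourierChar_inner.comp
        (continuous_snd.prodMk continuous_fst : Continuous fun p : E3 × E3 => (p.2, p.1))).aestronglyMeasurable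
    · simp [Function.uncurry, Circle.norm_smul, mul_comm]

/-- Plancherel's theorem for integrable and square integrable functions. -/
theorem eLpNorm_fourierInv {F : E3 → ℂ} (hF : Integrable F) (hF2 : MemLp F 2) :
    eLpNorm (𝓕⁻ F) 2 volume = eLpNorm F 2 volume := by
  set f : Lp ℂ 2 (volume : Measure E3) := hF2.toLp F with hf
  have hnorm : ‖(𝓕⁻ f : Lp ℂ 2 (volume : Measure E3))‖ = ‖f‖ := by
    rw [← Lp.norm_fourier_eq, FourierTransform.fourier_fourierInv_eq]
  -- The abstract `L²` inverse transform and the integral one are identified by pairing both with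
  -- smooth compactly supported functions.
  have hae : ((𝓕⁻ f : Lp ℂ 2 (volume : Measure E3)) : E3 → ℂ) =ᵐ[volume] 𝓕⁻ F := by
    refine ae_eq_of_integral_contDiff_smul_eq ?_ (continuous_fourierInv hF).locallyIntegrable ?_
    · exact (Lp.memLp _).locallyIntegrable (by norm_num)
    · intro g hg hgc
      have hgC : HasCompactSupport fun x => (g x : ℂ) := hgc.comp_left (g := fun r : ℝ => (r : ℂ)) (by simp)
      have hgD : ContDiff ℝ (⊤ : ℕ∞) fun x => (g x : ℂ) := Complex.ofRealCLM.contDiff.comp hg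
      set G : 𝓢(E3, ℂ) := hgC.toSchwartzMap hgD with hG
      have hGa : ∀ x, G x = (g x : ℂ) := fun x => rfl
      have h1 := congrArg (fun L : 𝓢'(E3, ℂ) => L G) (Lp.fourierInv_toTemperedDistribution_eq f)
      simp only [TemperedDistribution.fourierInv_apply, Lp.toTemperedDistribution_apply,
        SchwartzMap.fourierInv_coe, smul_eq_mul] at h1
      have h2 : ∫ x, 𝓕⁻ (G : E3 → ℂ) x * (f : E3 → ℂ) x = ∫ x, 𝓕⁻ (G : E3 → ℂ) x * F x := by
        refine integral_congr_ae ?_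
        filter_upwards [hF2.coeFn_toLp] with x hx
        rw [hx]
      rw [h2, integral_fourierInv_mul hF G.integrable] at h1
      simp only [hGa] at h1
      simp only [Complex.real_smul]
      exact h1.symm
  rw [← eLpNorm_congr_ae hae, ← eLpNorm_congr_ae hF2.coeFn_toLp, ← hf]
  rw [Lp.norm_def, Lp.norm_def] at hnorm
  exact (ENNReal.toReal_eq_toReal_iff' (Lp.eLpNorm_ne_top _) (Lp.eLpNorm_ne_top _)).1 hnorm

theorem lintegral_enorm_fourierInv_sq {F : E3 → ℂ} (hF : Integrable F) (hF2 : MemLp F 2) :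
    ∫⁻ x, ‖𝓕⁻ F x‖ₑ ^ 2 = ∫⁻ ξ, ‖F ξ‖ₑ ^ 2 := by
  have h := congrArg (fun a : ℝ≥0∞ => a ^ 2) (eLpNorm_fourierInv hF hF2)
  have key : ∀ G : E3 → ℂ, eLpNorm G 2 volume ^ 2 = ∫⁻ x, ‖G x‖ₑ ^ 2 := by
    intro G
    have := eLpNorm_nnreal_pow_eq_lintegral (f := G) (μ := (volume : Measure E3)) (p := 2) (by norm_num)
    norm_num at this
    exact_mod_cast this
  simpa only [key] using h

/-- Convolution with an integrable kernel is a Fourier multiplier. -/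
theorem integral_kernel_mul_fourierInv {K F : E3 → ℂ} (hK : Integrable K) (hF : Integrable F) (x : E3) :
    ∫ y, K (x - y) * 𝓕⁻ F y = 𝓕⁻ (fun ξ => 𝓕 K ξ * F ξ) x := by
  simp only [Real.fourierInv_eq]
  simp_rw [← integral_const_mul]
  rw [integral_integral_swap]
  · refine integral_congr_ae (ae_of_all _ fun ξ => ?_)
    simp only [Circle.smul_def, smul_eq_mul]
    rw [Real.fourier_eq]
    rw [← integral_sub_left_eq_self _ volume x, ← integral_mul_const, ← integral_const_mul]
    refine integral_congr_ae (ae_of_all _ fun y => ?_)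
    simp only [Circle.smul_def, smul_eq_mul]
    have e : Real.fourierChar (inner ℝ ξ (x - y)) =
        Real.fourierChar (inner ℝ ξ x) * Real.fourierChar (-inner ℝ y ξ) := by
      rw [← AddChar.map_add_eq_mul, real_inner_comm ξ y, inner_sub_right]
      rfl
    rw [e, sub_sub_cancel, Circle.coe_mul]
    ring
  · refine ((hK.comp_sub_left x).mul_prod hF).norm.mono' ?_ (ae_of_all _ fun p => ?_)
    · refine AEStronglyMeasurable.mul (hK.comp_sub_left x).1.comp_fst
        (AEStronglyMeasurable.smul ?_ hF.1.comp_snd)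
      exact (continuous_fourierChar_inner.comp
        (continuous_snd.prodMk continuous_fst : Continuous fun p : E3 × E3 => (p.2, p.1))).aestronglyMeasurable
    · simp [Function.uncurry, Circle.norm_smul]

theorem lintegral_enorm_pow_le {g : E3 → ℂ} (hg : AEMeasurable g volume) {C : ℝ≥0∞} (hC : ∀ x, ‖g x‖ₑ ≤ C) (k : ℕ) :
    ∫⁻ x, ‖g x‖ₑ ^ (k + 2) ≤ C ^ k * ∫⁻ x, ‖g x‖ₑ ^ 2 := by
  rw [← lintegral_const_mul'' _ (by fun_prop)]
  refine lintegral_mono fun x => ?_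
  simp only
  rw [pow_add]
  gcongr
  exact hC x

/-- `L^{k+2}` bound of an inverse Fourier transform, interpolating between `L²` and `L^∞`. -/
theorem eLpNorm_fourierInv_pow_le {F : E3 → ℂ} (hF : Integrable F) {B : ℝ≥0∞} (hB : B ≠ ∞)
    (hFB : ∀ ξ, ‖F ξ‖ₑ ≤ B) (k : ℕ) :
    eLpNorm (𝓕⁻ F) ((k + 2 : ℕ) : ℝ≥0∞) volume ^ (k + 2) ≤ (∫⁻ ξ, ‖F ξ‖ₑ) ^ (k + 1) * B := by
  have hF2 : MemLp F 2 := by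
    rw [memLp_two_iff_integrable_sq_norm hF.1]
    refine (hF.norm.const_mul B.toReal).mono' (hF.1.norm.pow 2) (ae_of_all _ fun ξ => ?_)
    have h : ‖F ξ‖ ≤ B.toReal := by
      have := ENNReal.toReal_mono hB (hFB ξ)
      rwa [toReal_enorm] at this
    rw [norm_pow, norm_norm, sq]
    gcongr
  have hsup : ∀ x, ‖𝓕⁻ F x‖ₑ ≤ ∫⁻ ξ, ‖F ξ‖ₑ := by
    intro x
    rw [Real.fourierInv_eq]
    refine (enorm_integral_le_lintegral_enorm _).trans (le_of_eq ?_)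
    refine lintegral_congr fun ξ => ?_
    rw [← ofReal_norm, Circle.norm_smul, ofReal_norm]
  have h1 : eLpNorm (𝓕⁻ F) ((k + 2 : ℕ) : ℝ≥0∞) volume ^ (k + 2) = ∫⁻ x, ‖𝓕⁻ F x‖ₑ ^ (k + 2) := by
    have := eLpNorm_nnreal_pow_eq_lintegral (f := 𝓕⁻ F) (μ := (volume : Measure E3))
      (p := ((k + 2 : ℕ) : ℝ≥0)) (by positivity)
    simp only [NNReal.coe_natCast, ENNReal.rpow_natCast, ENNReal.coe_natCast] at this
    exact this
  rw [h1]
  refine (lintegral_enorm_pow_le (continuous_fourierInv hF).aemeasurable hsup k).trans ?_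
  rw [lintegral_enorm_fourierInv_sq hF hF2, pow_succ, mul_assoc]
  gcongr
  rw [← lintegral_mul_const'' _ hF.1.enorm]
  refine lintegral_mono fun ξ => ?_
  simp only
  rw [sq]
  gcongr
  exact hFB ξ

/-! ### From densities to functions on physical space. -/

/-- A `[0,∞]`-valued density, read as a complex function. -/
noncomputable def dens (f : E3 → ℝ≥0∞) (ξ : E3) : ℂ := ((f ξ).toReal : ℂ)

/-- The real function on the physical side with Fourier transform `f`. -/
noncomputable def phys (f : E3 → ℝ≥0∞) (x : E3) : ℝ := (𝓕⁻ (dens f) x).re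

theorem measurable_dens {f : E3 → ℝ≥0∞} (hf : Measurable f) : Measurable (dens f) :=
  Complex.measurable_ofReal.comp hf.ennreal_toReal

theorem enorm_dens_le (f : E3 → ℝ≥0∞) (ξ : E3) : ‖dens f ξ‖ₑ ≤ f ξ := by
  rw [dens, ← ofReal_norm, Complex.norm_real, Real.norm_of_nonneg ENNReal.toReal_nonneg]
  exact ENNReal.ofReal_toReal_le

theorem integrable_dens {f : E3 → ℝ≥0∞} (hf : Measurable f) (hfin : ∫⁻ ξ, f ξ ≠ ∞) :
    Integrable (dens f) :=
  (integrable_toReal_of_lintegral_ne_top hf.aemeasurable hfin).ofReal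

theorem integral_norm_dens {f : E3 → ℝ≥0∞} (hf : Measurable f) (hfin : ∫⁻ ξ, f ξ ≠ ∞) :
    ∫ ξ, ‖dens f ξ‖ = (∫⁻ ξ, f ξ).toReal := by
  rw [← integral_toReal hf.aemeasurable (ae_lt_top hf hfin)]
  refine integral_congr_ae (ae_of_all _ fun ξ => ?_)
  simp [dens]

theorem continuous_phys {f : E3 → ℝ≥0∞} (hf : Measurable f) (hfin : ∫⁻ ξ, f ξ ≠ ∞) :
    Continuous (phys f) :=
  Complex.continuous_re.comp (continuous_fourierInv (integrable_dens hf hfin))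

theorem abs_phys_le {f : E3 → ℝ≥0∞} (hf : Measurable f) (hfin : ∫⁻ ξ, f ξ ≠ ∞) (x : E3) :
    |phys f x| ≤ (∫⁻ ξ, f ξ).toReal :=
  (Complex.abs_re_le_norm _).trans
    ((norm_fourierInv_le _ x).trans (integral_norm_dens hf hfin).le)

theorem phys_zero {f : E3 → ℝ≥0∞} (hf : Measurable f) (hfin : ∫⁻ ξ, f ξ ≠ ∞) :
    phys f 0 = (∫⁻ ξ, f ξ).toReal := by
  rw [phys, Real.fourierInv_eq]
  simp only [inner_zero_right, AddChar.map_zero_eq_one, one_smul, dens]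
  rw [integral_complex_ofReal, Complex.ofReal_re, integral_toReal hf.aemeasurable (ae_lt_top hf hfin)]

theorem fourierInv_dens {f : E3 → ℝ≥0∞} (heven : ∀ ξ, f (-ξ) = f ξ) (x : E3) :
    𝓕⁻ (dens f) x = (phys f x : ℂ) := by
  have h : (starRingEnd ℂ) (𝓕⁻ (dens f) x) = 𝓕⁻ (dens f) x := by
    rw [Real.fourierInv_eq', ← integral_conj, ← integral_neg_eq_self]
    refine integral_congr_ae (ae_of_all _ fun ξ => ?_)
    simp only [smul_eq_mul, map_mul, ← Complex.exp_conj, Complex.conj_I, Complex.conj_ofReal, dens,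
      heven, inner_neg_left]
    congr 2
    push_cast
    ring
  exact (Complex.conj_eq_iff_re.1 h).symm

/-- Reading the density as a finite measure gives access to the product rule for characteristic
functions of convolutions; the factor `2π` reconciles the phases. -/
theorem fourierInv_dens_eq_charFun {f : E3 → ℝ≥0∞} (hf : Measurable f) (hfin : ∫⁻ ξ, f ξ ≠ ∞)
    (x : E3) : 𝓕⁻ (dens f) x = charFun (volume.withDensity f) ((2 * Real.pi) • x) := by
  rw [charFun_apply, integral_withDensity_eq_integral_toReal_smul hf (ae_lt_top hf hfin),
    Real.fourierInv_eq']
  refine integral_congr_ae (ae_of_all _ fun ξ => ?_)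
  simp only [dens, smul_eq_mul, Complex.real_smul, inner_smul_right]
  ring

theorem lintegral_conv3_ne_top {f : E3 → ℝ≥0∞} (hf : Measurable f) (hfin : ∫⁻ ξ, f ξ ≠ ∞) :
    ∫⁻ ξ, conv3 f ξ ≠ ∞ := by
  rw [lintegral_conv3 hf]
  exact ENNReal.pow_ne_top hfin

theorem phys_conv3 {f : E3 → ℝ≥0∞} (hf : Measurable f) (hfin : ∫⁻ ξ, f ξ ≠ ∞)
    (heven : ∀ ξ, f (-ξ) = f ξ) (x : E3) : phys (conv3 f) x = phys f x ^ 3 := by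
  have h2 : ∫⁻ ξ, lconvolution f f volume ξ ≠ ∞ := by
    rw [lintegral_lconvolution hf hf]
    exact ENNReal.mul_ne_top hfin hfin
  have hm2 := measurable_lconvolution (volume : Measure E3) hf hf
  have := isFiniteMeasure_withDensity hfin
  have := isFiniteMeasure_withDensity h2
  have h : 𝓕⁻ (dens (conv3 f)) x = 𝓕⁻ (dens f) x ^ 3 := by
    rw [fourierInv_dens_eq_charFun (measurable_conv3 hf) (lintegral_conv3_ne_top hf hfin),
      fourierInv_dens_eq_charFun hf hfin, conv3, ← conv_withDensity_eq_lconvolution hf hm2,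
      charFun_conv, ← conv_withDensity_eq_lconvolution hf hf, charFun_conv]
    ring
  rw [fourierInv_dens heven, fourierInv_dens (conv3_neg heven)] at h
  exact_mod_cast h

theorem measurable_symb_apply (t : ℝ) : Measurable (symb t) :=
  measurable_symb.comp (measurable_const.prodMk measurable_id)

theorem heat_phys {f : E3 → ℝ≥0∞} (hf : Measurable f) (hfin : ∫⁻ ξ, f ξ ≠ ∞)
    (heven : ∀ ξ, f (-ξ) = f ξ) {t : ℝ} (ht : 0 < t) (x : E3) :
    heat t (phys f) x = phys (fun ξ => symb t ξ * f ξ) x := by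
  have h := integral_kernel_mul_fourierInv (K := fun z => (heatKernel t z : ℂ))
    (integrable_heatKernel ht).ofReal (integrable_dens hf hfin) x
  have e : (fun ξ => 𝓕 (fun z => (heatKernel t z : ℂ)) ξ * dens f ξ) =
      dens (fun ξ => symb t ξ * f ξ) := by
    ext ξ
    rw [fourier_heatKernel ht, dens, dens, ENNReal.toReal_mul, symb,
      ENNReal.toReal_ofReal (Real.exp_pos _).le]
    push_cast
    ring
  rw [e] at h
  rw [phys, ← h, heat, ← Complex.ofReal_re (∫ y, heatKernel t (x - y) * phys f y),
    ← integral_complex_ofReal]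
  congr 1
  refine integral_congr_ae (ae_of_all _ fun y => ?_)
  simp only [fourierInv_dens heven]
  push_cast
  rfl

theorem integral_fourierChar_eq_re (x : E3) (r : ℝ) (ξ : E3) :
    (Real.fourierChar (inner ℝ ξ x) • (r : ℂ)).re = Real.cos (2 * Real.pi * inner ℝ ξ x) * r := by
  rw [Circle.smul_def, Real.fourierChar_apply, smul_eq_mul, Complex.re_mul_ofReal,
    Complex.exp_ofReal_mul_I_re]

theorem integrable_cos_mul {f : E3 → ℝ≥0∞} (hf : Measurable f) (hfin : ∫⁻ ξ, f ξ ≠ ∞) (x : E3) :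
    Integrable fun ξ => Real.cos (2 * Real.pi * inner ℝ ξ x) * (f ξ).toReal := by
  refine (integrable_toReal_of_lintegral_ne_top hf.aemeasurable hfin).bdd_mul (c := 1) ?_ ?_
  · exact (by fun_prop : Continuous fun ξ : E3 => Real.cos (2 * Real.pi * inner ℝ ξ x)).aestronglyMeasurable
  · exact ae_of_all _ fun ξ => Real.abs_cos_le_one _

/-- The real part turns the character into a bounded cosine, with no evenness needed. Additivity and
the exchange with the time integral then reduce to real integrals. -/
theorem phys_eq_integral_cos {f : E3 → ℝ≥0∞} (hf : Measurable f) (hfin : ∫⁻ ξ, f ξ ≠ ∞) (x : E3) :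
    phys f x = ∫ ξ, Real.cos (2 * Real.pi * inner ℝ ξ x) * (f ξ).toReal := by
  have hi : Integrable fun ξ => (Real.fourierChar (inner ℝ ξ x)) • dens f ξ := by
    refine (integrable_dens hf hfin).norm.mono' ?_ (ae_of_all _ fun ξ => by simp [Circle.norm_smul])
    refine AEStronglyMeasurable.smul ?_ (integrable_dens hf hfin).1
    exact (continuous_fourierChar_inner.comp
      (continuous_id.prodMk continuous_const : Continuous fun ξ : E3 => (ξ, x))).aestronglyMeasurable
  rw [phys, Real.fourierInv_eq]
  have := integral_re hi
  simp only [RCLike.re_to_complex] at this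
  rw [← this]
  refine integral_congr_ae (ae_of_all _ fun ξ => ?_)
  exact integral_fourierChar_eq_re x _ ξ

theorem phys_add {f g : E3 → ℝ≥0∞} (hf : Measurable f) (hfin : ∫⁻ ξ, f ξ ≠ ∞)
    (hg : Measurable g) (hgin : ∫⁻ ξ, g ξ ≠ ∞) (x : E3) :
    phys (fun ξ => f ξ + g ξ) x = phys f x + phys g x := by
  have hfg : ∫⁻ ξ, f ξ + g ξ ≠ ∞ := by
    rw [lintegral_add_left hf]
    exact ENNReal.add_ne_top.2 ⟨hfin, hgin⟩
  rw [phys_eq_integral_cos (f := fun ξ => f ξ + g ξ) (hf.add hg) hfg, phys_eq_integral_cos hf hfin,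
    phys_eq_integral_cos hg hgin,
    ← integral_add (integrable_cos_mul hf hfin x) (integrable_cos_mul hg hgin x)]
  refine integral_congr_ae ?_
  filter_upwards [ae_lt_top hf hfin, ae_lt_top hg hgin] with ξ h1 h2
  rw [ENNReal.toReal_add h1.ne h2.ne]
  ring

theorem phys_lintegral {G : ℝ → E3 → ℝ≥0∞} (hG : Measurable fun p : ℝ × E3 => G p.1 p.2) {t : ℝ}
    (ht : 0 ≤ t) (hfin : ∫⁻ τ in Ioo 0 t, ∫⁻ ξ, G τ ξ ≠ ∞)
    (hfin' : ∀ τ ∈ Ioo 0 t, ∫⁻ ξ, G τ ξ ≠ ∞) (x : E3) :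
    phys (fun ξ => ∫⁻ τ in Ioo 0 t, G τ ξ) x = ∫ τ in (0 : ℝ)..t, phys (G τ) x := by
  have hGs : Measurable fun p : E3 × ℝ => G p.2 p.1 := hG.comp measurable_swap
  have hm1 : Measurable fun ξ => ∫⁻ τ in Ioo 0 t, G τ ξ :=
    Measurable.lintegral_prod_right' (f := fun p : E3 × ℝ => G p.2 p.1) hGs
  have hswap : ∫⁻ ξ, ∫⁻ τ in Ioo 0 t, G τ ξ = ∫⁻ τ in Ioo 0 t, ∫⁻ ξ, G τ ξ :=
    lintegral_lintegral_swap hGs.aemeasurable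
  have hm2 : ∀ τ, Measurable (G τ) := fun τ => hG.comp (measurable_const.prodMk measurable_id)
  have hm3 : ∀ ξ, Measurable fun τ => G τ ξ := fun ξ => hG.comp (measurable_id.prodMk measurable_const)
  rw [phys_eq_integral_cos hm1 (by rwa [hswap]), intervalIntegral.integral_of_le ht,
    integral_Ioc_eq_integral_Ioo]
  have h1 : ∫ τ in Ioo 0 t, phys (G τ) x =
      ∫ τ in Ioo 0 t, ∫ ξ, Real.cos (2 * Real.pi * inner ℝ ξ x) * (G τ ξ).toReal :=
    setIntegral_congr_fun measurableSet_Ioo fun τ hτ => phys_eq_integral_cos (hm2 τ) (hfin' τ hτ) x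
  rw [h1, integral_integral_swap]
  · refine integral_congr_ae ?_
    filter_upwards [ae_lt_top hm1 (by rwa [hswap])] with ξ hξ
    rw [integral_const_mul, integral_toReal (hm3 ξ).aemeasurable (ae_lt_top (hm3 ξ) hξ.ne)]
  · have hi : Integrable (fun p : ℝ × E3 => (G p.1 p.2).toReal)
        ((volume.restrict (Ioo 0 t)).prod volume) := by
      refine integrable_toReal_of_lintegral_ne_top hG.aemeasurable ?_
      rw [lintegral_prod _ hG.aemeasurable]
      exact hfin
    refine hi.bdd_mul (c := 1) ?_ ?_
    · exact (by fun_prop : Continuous fun p : ℝ × E3 =>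
        Real.cos (2 * Real.pi * inner ℝ p.2 x)).aestronglyMeasurable
    · exact ae_of_all _ fun p => Real.abs_cos_le_one _

theorem enorm_dens_sub_le {f g : E3 → ℝ≥0∞} {B : ℝ≥0∞} (hf : ∀ ξ, f ξ ≤ B) (hg : ∀ ξ, g ξ ≤ B)
    (ξ : E3) : ‖dens f ξ - dens g ξ‖ₑ ≤ 2 * B := by
  refine (enorm_sub_le).trans ?_
  rw [two_mul]
  exact add_le_add ((enorm_dens_le f ξ).trans (hf ξ)) ((enorm_dens_le g ξ).trans (hg ξ))

/-- Interpolation of `L³` between `L²` (Plancherel) and `L^∞`: given a common sup bound on the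
densities, their `L¹` convergence suffices for `L³` convergence in physical space. -/
theorem eLpNorm_phys_sub_le {f g : E3 → ℝ≥0∞} (hf : Measurable f) (hfin : ∫⁻ ξ, f ξ ≠ ∞)
    (hg : Measurable g) (hgin : ∫⁻ ξ, g ξ ≠ ∞) {B : ℝ≥0∞} (hB : B ≠ ∞) (hfB : ∀ ξ, f ξ ≤ B)
    (hgB : ∀ ξ, g ξ ≤ B) :
    eLpNorm (fun x => phys f x - phys g x) 3 volume ^ 3 ≤
      (∫⁻ ξ, ‖dens f ξ - dens g ξ‖ₑ) ^ 2 * (2 * B) := by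
  have h := eLpNorm_fourierInv_pow_le ((integrable_dens hf hfin).sub (integrable_dens hg hgin))
    (B := 2 * B) (ENNReal.mul_ne_top (by norm_num) hB) (enorm_dens_sub_le hfB hgB) 1
  norm_num at h
  refine le_trans ?_ h
  gcongr
  refine eLpNorm_mono fun x => ?_
  have := fourierInv_sub (integrable_dens hf hfin) (integrable_dens hg hgin) x
  have e : (dens f - dens g) = fun ξ => dens f ξ - dens g ξ := rfl
  rw [e, this]
  have e2 : phys f x - phys g x = (𝓕⁻ (dens f) x - 𝓕⁻ (dens g) x).re := by
    rw [Complex.sub_re]; rfl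
  rw [e2]
  exact Complex.abs_re_le_norm _

theorem memLp_phys {f : E3 → ℝ≥0∞} (hf : Measurable f) (hfin : ∫⁻ ξ, f ξ ≠ ∞)
    {B : ℝ≥0∞} (hB : B ≠ ∞) (hfB : ∀ ξ, f ξ ≤ B) : MemLp (phys f) 3 := by
  refine ⟨(continuous_phys hf hfin).aestronglyMeasurable, ?_⟩
  have h := eLpNorm_fourierInv_pow_le (integrable_dens hf hfin) hB
    (fun ξ => (enorm_dens_le f ξ).trans (hfB ξ)) 1
  norm_num at h
  have h2 : eLpNorm (phys f) 3 volume ≤ eLpNorm (𝓕⁻ (dens f)) 3 volume :=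
    eLpNorm_mono fun x => Complex.abs_re_le_norm _
  refine h2.trans_lt ?_
  have h3 : (∫⁻ ξ, ‖dens f ξ‖ₑ) ^ 2 * B < ∞ := by
    refine ENNReal.mul_lt_top (ENNReal.pow_lt_top ?_) hB.lt_top
    exact (lintegral_mono (enorm_dens_le f)).trans_lt hfin.lt_top
  by_contra! hcon
  rw [top_le_iff.1 hcon] at h
  simp only [ne_eq, OfNat.ofNat_ne_zero, not_false_eq_true, ENNReal.top_pow, top_le_iff] at h
  exact h3.ne h

/-- A set of full measure is dense, so for a continuous function the essential bound holds at every
point. It is used at the origin, where the function equals the mass. -/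
theorem enorm_le_eLpNorm_top {f : E3 → ℝ} (hf : Continuous f) (x : E3) :
    ‖f x‖ₑ ≤ eLpNorm f ∞ volume := by
  rw [eLpNorm_exponent_top]
  have hc : IsClosed {y | ‖f y‖ₑ ≤ eLpNormEssSup f volume} :=
    isClosed_le (by fun_prop) continuous_const
  have hd : Dense {y | ‖f y‖ₑ ≤ eLpNormEssSup f volume} :=
    Measure.dense_of_ae (ae_le_eLpNormEssSup (f := f) (μ := volume))
  have := hd.closure_eq
  rw [hc.closure_eq] at this
  have hx : x ∈ {y | ‖f y‖ₑ ≤ eLpNormEssSup f volume} := by rw [this]; trivial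
  exact hx

/-! ### Time regularity and passage to Weissler solutions. -/

theorem symb_add (s t : ℝ) (ξ : E3) : symb (s + t) ξ = symb s ξ * symb t ξ := by
  unfold symb
  rw [← ENNReal.ofReal_mul (Real.exp_pos _).le, ← Real.exp_add]
  congr 2
  ring

/-- The Duhamel contribution of the times between `s` and `t` is nonnegative and is dropped. This is
the lower half of the modulus of continuity; `fsol_le_add` is the upper half. -/
theorem symb_mul_fsol_le (hf₀ : Measurable f₀) {s t : ℝ} (h : s ≤ t) (ξ : E3) :
    symb (t - s) ξ * fsol f₀ s ξ ≤ fsol f₀ t ξ := by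
  rw [fsol_eq hf₀ s, fsol_eq hf₀ t, mul_add, ← mul_assoc, ← symb_add, sub_add_cancel]
  refine add_le_add le_rfl ?_
  rw [← lintegral_const_mul' _ _ (by unfold symb; exact ENNReal.ofReal_ne_top)]
  simp_rw [← mul_assoc, ← symb_add]
  have e : ∀ τ, t - s + (s - τ) = t - τ := fun τ => by ring
  simp_rw [e]
  exact lintegral_mono_set (Ioo_subset_Ioo_right h)

theorem fsol_le_add (hf₀ : Measurable f₀) {s t : ℝ} (h : s ≤ t) (ξ : E3) :
    fsol f₀ t ξ ≤ fsol f₀ s ξ + ∫⁻ τ in Ico s t, conv3 (fsol f₀ τ) ξ := by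
  rw [fsol_eq hf₀ s, fsol_eq hf₀ t, add_assoc]
  refine add_le_add (mul_le_mul' (symb_anti h ξ) le_rfl) ?_
  have hsub : Ioo 0 t ⊆ Ioo 0 s ∪ Ico s t := by
    intro τ hτ
    rcases lt_or_ge τ s with h | h
    · exact Or.inl ⟨hτ.1, h⟩
    · exact Or.inr ⟨h, hτ.2⟩
  refine (lintegral_mono_set hsub).trans ((lintegral_union_le _ _ _).trans ?_)
  refine add_le_add (lintegral_mono fun τ => mul_le_mul' (symb_anti (by linarith) ξ) le_rfl) ?_
  refine setLIntegral_mono' measurableSet_Ico fun τ hτ => ?_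
  exact mul_le_of_le_one_left' (symb_le_one (by linarith [hτ.2]) ξ)

/-- Admissible Fourier data: measurable, even, bounded and integrable. -/
structure IsDatum (f₀ : E3 → ℝ≥0∞) (B : ℝ) : Prop where
  measurable : Measurable f₀
  even : ∀ ξ, f₀ (-ξ) = f₀ ξ
  nonneg : 0 ≤ B
  le : ∀ ξ, f₀ ξ ≤ ENNReal.ofReal B
  finite : ∫⁻ ξ, f₀ ξ ≠ ∞

namespace IsDatum

variable {B T : ℝ} {A : ℝ≥0}

theorem exists_bound (H : IsDatum f₀ B) (hA : ∀ t ∈ Icc 0 T, mass f₀ t ≤ A) :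
    ∃ C : ℝ, 0 ≤ C ∧ ∀ t ∈ Icc 0 T, ∀ ξ, fsol f₀ t ξ ≤ ENNReal.ofReal C := by
  refine ⟨B * Real.exp ((A : ℝ) ^ 2 * T), mul_nonneg H.nonneg (Real.exp_pos _).le, fun t ht ξ => ?_⟩
  refine (fsol_le_of_mass_le H.measurable H.nonneg H.le (M := A) A.2 ?_ t ht ξ).trans ?_
  · simpa using hA
  · refine ENNReal.ofReal_le_ofReal (mul_le_mul_of_nonneg_left ?_ H.nonneg)
    have := ht.2
    gcongr

theorem mass_ne_top (hA : ∀ t ∈ Icc 0 T, mass f₀ t ≤ A) {t : ℝ} (ht : t ∈ Icc 0 T) :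
    ∫⁻ ξ, fsol f₀ t ξ ≠ ∞ :=
  ((hA t ht).trans_lt ENNReal.coe_lt_top).ne

/-- The Duhamel formula on the physical side. -/
theorem phys_fsol_eq (H : IsDatum f₀ B) (hA : ∀ t ∈ Icc 0 T, mass f₀ t ≤ A) {t : ℝ}
    (ht : t ∈ Ioc 0 T) (x : E3) :
    phys (fsol f₀ t) x = heat t (phys f₀) x +
      ∫ τ in (0 : ℝ)..t, heat (t - τ) (fun y => phys (fsol f₀ τ) y ^ 3) x := by
  have hm := measurable_fsol_apply H.measurable
  have heven := fsol_neg H.even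
  obtain ⟨G, hG⟩ : ∃ G : ℝ → E3 → ℝ≥0∞, G = fun τ ξ => symb (t - τ) ξ * conv3 (fsol f₀ τ) ξ :=
    ⟨_, rfl⟩
  have hGm : Measurable fun p : ℝ × E3 => G p.1 p.2 := by
    rw [hG]
    exact (measurable_symb.comp (by fun_prop : Measurable fun p : ℝ × E3 => (t - p.1, p.2))).mul
      (measurable_conv3_family (measurable_fsol H.measurable))
  have hfin : ∀ τ ∈ Ioo 0 t, ∫⁻ ξ, fsol f₀ τ ξ ≠ ∞ := fun τ hτ =>
    mass_ne_top hA ⟨hτ.1.le, hτ.2.le.trans ht.2⟩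
  have hGle : ∀ τ ∈ Ioo 0 t, ∫⁻ ξ, G τ ξ ≤ (A : ℝ≥0∞) ^ 3 := by
    intro τ hτ
    calc ∫⁻ ξ, G τ ξ ≤ ∫⁻ ξ, conv3 (fsol f₀ τ) ξ := by
          rw [hG]
          exact lintegral_mono fun ξ =>
            mul_le_of_le_one_left' (symb_le_one (by linarith [hτ.2]) ξ)
      _ = (mass f₀ τ) ^ 3 := lintegral_conv3 (hm τ)
      _ ≤ _ := by gcongr; exact hA τ ⟨hτ.1.le, hτ.2.le.trans ht.2⟩
  have hA3 : (A : ℝ≥0∞) ^ 3 ≠ ∞ := ENNReal.pow_ne_top ENNReal.coe_ne_top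
  have hGfin' : ∀ τ ∈ Ioo 0 t, ∫⁻ ξ, G τ ξ ≠ ∞ := fun τ hτ => ne_top_of_le_ne_top hA3 (hGle τ hτ)
  have hGfin : ∫⁻ τ in Ioo 0 t, ∫⁻ ξ, G τ ξ ≠ ∞ := by
    refine ne_top_of_le_ne_top ?_ (setLIntegral_mono' measurableSet_Ioo hGle)
    rw [setLIntegral_const]
    exact ENNReal.mul_ne_top hA3 (by simp)
  have hGs : Measurable fun p : E3 × ℝ => G p.2 p.1 := hGm.comp measurable_swap
  have h1m : Measurable fun ξ => symb t ξ * f₀ ξ := (measurable_symb_apply t).mul H.measurable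
  have h1fin : ∫⁻ ξ, symb t ξ * f₀ ξ ≠ ∞ :=
    ne_top_of_le_ne_top H.finite
      (lintegral_mono fun ξ => mul_le_of_le_one_left' (symb_le_one ht.1.le ξ))
  have h2m : Measurable fun ξ => ∫⁻ τ in Ioo 0 t, G τ ξ :=
    Measurable.lintegral_prod_right' (f := fun p : E3 × ℝ => G p.2 p.1) hGs
  have h2fin : ∫⁻ ξ, ∫⁻ τ in Ioo 0 t, G τ ξ ≠ ∞ := by
    rw [lintegral_lintegral_swap hGs.aemeasurable]
    exact hGfin
  have heq : fsol f₀ t = fun ξ => symb t ξ * f₀ ξ + ∫⁻ τ in Ioo 0 t, G τ ξ := by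
    ext ξ
    rw [hG]
    exact fsol_eq H.measurable t ξ
  rw [heq, phys_add h1m h1fin h2m h2fin, ← heat_phys H.measurable H.finite H.even ht.1,
    phys_lintegral hGm ht.1.le hGfin hGfin']
  congr 1
  rw [intervalIntegral.integral_of_le ht.1.le, intervalIntegral.integral_of_le ht.1.le,
    integral_Ioc_eq_integral_Ioo, integral_Ioc_eq_integral_Ioo]
  refine setIntegral_congr_fun measurableSet_Ioo fun τ hτ => ?_
  have h3 : (fun y => phys (fsol f₀ τ) y ^ 3) = phys (conv3 (fsol f₀ τ)) := by
    ext y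
    exact (phys_conv3 (hm τ) (hfin τ hτ) (heven τ) y).symm
  rw [hG, h3, heat_phys (measurable_conv3 (hm τ)) (lintegral_conv3_ne_top (hm τ) (hfin τ hτ))
    (conv3_neg (heven τ)) (sub_pos.2 hτ.2)]

/-- A majorant independent of `t`, integrable by `lintegral_tail_ne_top`, for dominated convergence
in the frequency variable. -/
theorem fsol_le_tail (H : IsDatum f₀ B) {t : ℝ} (ht : t ∈ Icc 0 T) (ξ : E3) :
    fsol f₀ t ξ ≤ f₀ ξ + ∫⁻ τ in Ico 0 T, conv3 (fsol f₀ τ) ξ := by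
  refine (fsol_le_add H.measurable ht.1 ξ).trans ?_
  rw [fsol_zero H.measurable]
  exact add_le_add le_rfl (lintegral_mono_set (Ico_subset_Ico_right ht.2))

theorem lintegral_tail_ne_top (H : IsDatum f₀ B) (hA : ∀ t ∈ Icc 0 T, mass f₀ t ≤ A) :
    ∫⁻ ξ, (f₀ ξ + ∫⁻ τ in Ico 0 T, conv3 (fsol f₀ τ) ξ) ≠ ∞ := by
  have hcm : Measurable fun p : E3 × ℝ => conv3 (fsol f₀ p.2) p.1 :=
    (measurable_conv3_family (measurable_fsol H.measurable)).comp measurable_swap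
  rw [lintegral_add_left H.measurable, lintegral_lintegral_swap hcm.aemeasurable]
  refine ENNReal.add_ne_top.2 ⟨H.finite, ?_⟩
  have h1 : ∫⁻ τ in Ico 0 T, ∫⁻ ξ, conv3 (fsol f₀ τ) ξ ≤ ∫⁻ τ in Ico 0 T, (A : ℝ≥0∞) ^ 3 := by
    refine setLIntegral_mono' measurableSet_Ico fun τ hτ => ?_
    rw [lintegral_conv3 (measurable_fsol_apply H.measurable τ)]
    gcongr
    exact hA τ ⟨hτ.1, hτ.2.le⟩
  refine ne_top_of_le_ne_top ?_ h1
  rw [setLIntegral_const]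
  exact ENNReal.mul_ne_top (ENNReal.pow_ne_top ENNReal.coe_ne_top) (by simp)

theorem abs_toReal_sub_le (H : IsDatum f₀ B) (hA : ∀ t ∈ Icc 0 T, mass f₀ t ≤ A) {C : ℝ}
    (hC0 : 0 ≤ C) (hC : ∀ t ∈ Icc 0 T, ∀ ξ, fsol f₀ t ξ ≤ ENNReal.ofReal C) {s t : ℝ}
    (hs : s ∈ Icc 0 T) (ht : t ∈ Icc 0 T) (hst : s ≤ t) (ξ : E3) :
    |(fsol f₀ t ξ).toReal - (fsol f₀ s ξ).toReal| ≤
      (1 - Real.exp (-(4 * Real.pi ^ 2 * (t - s)) * ‖ξ‖ ^ 2)) * C + (A : ℝ) ^ 2 * C * (t - s) := by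
  have hfin : ∀ r ∈ Icc 0 T, fsol f₀ r ξ ≠ ∞ := fun r hr =>
    ne_top_of_le_ne_top ENNReal.ofReal_ne_top (hC r hr ξ)
  have hle : ∀ r ∈ Icc 0 T, (fsol f₀ r ξ).toReal ≤ C := fun r hr =>
    ENNReal.toReal_le_of_le_ofReal hC0 (hC r hr ξ)
  have h1 : (fsol f₀ t ξ).toReal ≤ (fsol f₀ s ξ).toReal + (A : ℝ) ^ 2 * C * (t - s) := by
    have h2 : ∫⁻ τ in Ico s t, conv3 (fsol f₀ τ) ξ ≤ ENNReal.ofReal ((A : ℝ) ^ 2 * C * (t - s)) := by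
      calc ∫⁻ τ in Ico s t, conv3 (fsol f₀ τ) ξ ≤ ∫⁻ τ in Ico s t, ENNReal.ofReal ((A : ℝ) ^ 2 * C) := by
            refine setLIntegral_mono' measurableSet_Ico fun τ hτ => ?_
            have hτT : τ ∈ Icc 0 T := ⟨hs.1.trans hτ.1, hτ.2.le.trans ht.2⟩
            refine (conv3_le (measurable_fsol_apply H.measurable τ) (hC τ hτT) ξ).trans ?_
            rw [ENNReal.ofReal_mul (by positivity), ENNReal.ofReal_pow (NNReal.coe_nonneg A), ENNReal.ofReal_coe_nnreal]
            gcongr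
            exact hA τ hτT
        _ = _ := by
            rw [setLIntegral_const, Real.volume_Ico, ← ENNReal.ofReal_mul (by positivity)]
    have h3 := (fsol_le_add H.measurable hst ξ).trans (add_le_add le_rfl h2)
    have h4 := ENNReal.toReal_mono (ENNReal.add_ne_top.2 ⟨hfin s hs, ENNReal.ofReal_ne_top⟩) h3
    have hts : 0 ≤ t - s := by linarith
    rwa [ENNReal.toReal_add (hfin s hs) ENNReal.ofReal_ne_top,
      ENNReal.toReal_ofReal (by positivity)] at h4
  have h5 : Real.exp (-(4 * Real.pi ^ 2 * (t - s)) * ‖ξ‖ ^ 2) * (fsol f₀ s ξ).toReal ≤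
      (fsol f₀ t ξ).toReal := by
    have := ENNReal.toReal_mono (hfin t ht) (symb_mul_fsol_le H.measurable hst ξ)
    rwa [ENNReal.toReal_mul, symb, ENNReal.toReal_ofReal (Real.exp_pos _).le] at this
  have h6 : Real.exp (-(4 * Real.pi ^ 2 * (t - s)) * ‖ξ‖ ^ 2) ≤ 1 := by
    rw [Real.exp_le_one_iff]
    have : 0 ≤ 4 * Real.pi ^ 2 * (t - s) * ‖ξ‖ ^ 2 := by
      have : 0 ≤ t - s := by linarith
      positivity
    linarith
  have h7 := hle s hs
  have h8 : 0 ≤ (A : ℝ) ^ 2 * C * (t - s) := by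
    have : 0 ≤ t - s := by linarith
    positivity
  have h9 : 0 ≤ (1 - Real.exp (-(4 * Real.pi ^ 2 * (t - s)) * ‖ξ‖ ^ 2)) * C :=
    mul_nonneg (by linarith) hC0
  rw [abs_le]
  constructor
  · nlinarith
  · linarith

/-- Dominated convergence: the two-sided estimate `abs_toReal_sub_le` gives convergence at each
frequency, and twice the tail bound dominates. Only pointwise convergence is needed, so the growth
of the symbol's modulus in `ξ` is harmless. -/
theorem tendsto_lintegral_sub (H : IsDatum f₀ B) (hA : ∀ t ∈ Icc 0 T, mass f₀ t ≤ A) {s : ℝ}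
    (hs : s ∈ Icc 0 T) :
    Tendsto (fun t => ∫⁻ ξ, ‖dens (fsol f₀ t) ξ - dens (fsol f₀ s) ξ‖ₑ) (𝓝[Icc 0 T] s) (𝓝 0) := by
  obtain ⟨C, hC0, hC⟩ := H.exists_bound hA
  set b : E3 → ℝ≥0∞ := fun ξ => 2 * (f₀ ξ + ∫⁻ τ in Ico 0 T, conv3 (fsol f₀ τ) ξ) with hb
  have hbfin : ∫⁻ ξ, b ξ ≠ ∞ := by
    rw [hb, lintegral_const_mul' _ _ (by norm_num)]
    exact ENNReal.mul_ne_top (by norm_num) (H.lintegral_tail_ne_top hA)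
  have h := tendsto_lintegral_filter_of_dominated_convergence (μ := (volume : Measure E3))
    (l := 𝓝[Icc 0 T] s) (F := fun t ξ => ‖dens (fsol f₀ t) ξ - dens (fsol f₀ s) ξ‖ₑ)
    (f := fun _ => 0) b ?_ ?_ hbfin ?_
  · simpa using h
  · refine Eventually.of_forall fun t => ?_
    have h1 := measurable_dens (measurable_fsol_apply H.measurable t)
    have h2 := measurable_dens (measurable_fsol_apply H.measurable s)
    exact (h1.sub h2).enorm
  · filter_upwards [self_mem_nhdsWithin] with t ht
    refine ae_of_all _ fun ξ => ?_
    refine enorm_sub_le.trans ?_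
    rw [hb]
    simp only
    rw [two_mul]
    exact add_le_add ((enorm_dens_le _ ξ).trans (H.fsol_le_tail ht ξ))
      ((enorm_dens_le _ ξ).trans (H.fsol_le_tail hs ξ))
  · refine ae_of_all _ fun ξ => ?_
    have h1 : Tendsto (fun t => ‖dens (fsol f₀ t) ξ - dens (fsol f₀ s) ξ‖) (𝓝[Icc 0 T] s) (𝓝 0) := by
      set g : ℝ → ℝ := fun t => (1 - Real.exp (-(4 * Real.pi ^ 2 * |t - s|) * ‖ξ‖ ^ 2)) * C +
        (A : ℝ) ^ 2 * C * |t - s| with hg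
      have hgc : Tendsto g (𝓝[Icc 0 T] s) (𝓝 0) := by
        have : Continuous g := by rw [hg]; fun_prop
        have h0 := this.tendsto s
        have e : g s = 0 := by simp [hg]
        rw [e] at h0
        exact h0.mono_left nhdsWithin_le_nhds
      refine squeeze_zero' (Eventually.of_forall fun t => norm_nonneg _) ?_ hgc
      filter_upwards [self_mem_nhdsWithin] with t ht
      have e : ‖dens (fsol f₀ t) ξ - dens (fsol f₀ s) ξ‖ =
          |(fsol f₀ t ξ).toReal - (fsol f₀ s ξ).toReal| := by
        rw [dens, dens, ← Complex.ofReal_sub, Complex.norm_real, Real.norm_eq_abs]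
      rw [e, hg]
      simp only
      rcases le_total s t with hst | hst
      · rw [abs_of_nonneg (by linarith : 0 ≤ t - s)]
        exact H.abs_toReal_sub_le hA hC0 hC hs ht hst ξ
      · rw [abs_sub_comm, abs_sub_comm t s, abs_of_nonneg (by linarith : 0 ≤ s - t)]
        exact H.abs_toReal_sub_le hA hC0 hC ht hs hst ξ
    have h2 := (ENNReal.continuous_ofReal.tendsto 0).comp h1
    simp only [ENNReal.ofReal_zero] at h2
    refine h2.congr fun t => ?_
    simp only [Function.comp, ofReal_norm]

/-- The trajectory in `L³` generated by the minimal solution on the Fourier side. -/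
theorem exists_trajectory (H : IsDatum f₀ B) {Tmax : ℝ}
    (hlife : ∀ T < Tmax, ∃ A : ℝ≥0, ∀ t ∈ Icc 0 T, mass f₀ t ≤ A) :
    ∃ u : ℝ → Lp ℝ 3 (volume : Measure E3), ∀ t ∈ Ico 0 Tmax,
      (u t : E3 → ℝ) =ᵐ[volume] phys (fsol f₀ t) := by
  classical
  have hmem : ∀ t ∈ Ico 0 Tmax, MemLp (phys (fsol f₀ t)) 3 := by
    intro t ht
    obtain ⟨A, hA⟩ := hlife t ht.2
    obtain ⟨C, hC0, hC⟩ := H.exists_bound hA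
    have htt : t ∈ Icc 0 t := ⟨ht.1, le_rfl⟩
    exact memLp_phys (measurable_fsol_apply H.measurable t) (mass_ne_top hA htt)
      ENNReal.ofReal_ne_top (hC t htt)
  refine ⟨fun t => if h : t ∈ Ico 0 Tmax then (hmem t h).toLp _ else 0, fun t ht => ?_⟩
  simp only [ht, dif_pos]
  exact (hmem t ht).coeFn_toLp

theorem isWeisslerSolution (H : IsDatum f₀ B) (u₀ : 𝓢(E3, ℝ)) (hu₀ : ∀ x, u₀ x = phys f₀ x)
    (hT : 0 < T) (hA : ∀ t ∈ Icc 0 T, mass f₀ t ≤ A)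
    {u : ℝ → Lp ℝ 3 (volume : Measure E3)}
    (hu : ∀ t ∈ Icc 0 T, (u t : E3 → ℝ) =ᵐ[volume] phys (fsol f₀ t)) :
    IsWeisslerSolution u₀ T u := by
  have hm := measurable_fsol_apply H.measurable
  have hu₀' : (u₀ : E3 → ℝ) = phys f₀ := funext hu₀
  refine ⟨hT, ?_, ?_, ?_, ?_⟩
  · obtain ⟨C, hC0, hC⟩ := H.exists_bound hA
    intro s hs
    rw [ContinuousWithinAt, Lp.tendsto_Lp_iff_tendsto_eLpNorm']
    have h1 := ENNReal.Tendsto.pow (n := 2) (H.tendsto_lintegral_sub hA hs)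
    have h2 := ENNReal.Tendsto.mul_const (b := 2 * ENNReal.ofReal C) h1
      (Or.inr (ENNReal.mul_ne_top (by norm_num) ENNReal.ofReal_ne_top))
    simp only [ne_eq, OfNat.ofNat_ne_zero, not_false_eq_true, zero_pow, zero_mul] at h2
    have h3 : Tendsto (fun t => eLpNorm ((u t : E3 → ℝ) - (u s : E3 → ℝ)) 3 volume ^ 3)
        (𝓝[Icc 0 T] s) (𝓝 0) := by
      refine tendsto_of_tendsto_of_tendsto_of_le_of_le' tendsto_const_nhds h2
        (Eventually.of_forall fun t => zero_le) ?_
      filter_upwards [self_mem_nhdsWithin] with t ht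
      have e : ((u t : E3 → ℝ) - (u s : E3 → ℝ)) =ᵐ[volume]
          fun x => phys (fsol f₀ t) x - phys (fsol f₀ s) x := (hu t ht).sub (hu s hs)
      rw [eLpNorm_congr_ae e]
      exact eLpNorm_phys_sub_le (hm t) (mass_ne_top hA ht) (hm s) (mass_ne_top hA hs)
        ENNReal.ofReal_ne_top (hC t ht) (hC s hs)
    have h4 := h3.ennrpow_const (1 / 3 : ℝ)
    rw [ENNReal.zero_rpow_of_pos (by norm_num)] at h4
    refine h4.congr fun t => ?_
    rw [← ENNReal.rpow_natCast, ← ENNReal.rpow_mul]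
    norm_num
  · intro a ha
    refine ⟨A, fun t ht => ?_⟩
    have htT : t ∈ Icc 0 T := ⟨ha.le.trans ht.1, ht.2⟩
    rw [eLpNorm_congr_ae (hu t htT)]
    have hb : ∀ x, ‖phys (fsol f₀ t) x‖ ≤ A := by
      intro x
      refine (abs_phys_le (hm t) (mass_ne_top hA htT) x).trans ?_
      exact ENNReal.toReal_le_coe_of_le_coe (hA t htT)
    refine (eLpNorm_le_of_ae_bound (ae_of_all _ hb)).trans ?_
    simp
  · have h0 : (0 : ℝ) ∈ Icc 0 T := ⟨le_rfl, hT.le⟩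
    refine Lp.ext ((hu 0 h0).trans ?_)
    refine EventuallyEq.trans ?_ (SchwartzMap.coeFn_toLp u₀ 3 volume).symm
    rw [hu₀']
    have e : fsol f₀ 0 = f₀ := funext (fsol_zero H.measurable)
    rw [e]
  · intro t ht
    filter_upwards [hu t ⟨ht.1.le, ht.2⟩] with x hx
    rw [hx, H.phys_fsol_eq hA ht, hu₀']
    congr 1
    refine intervalIntegral.integral_congr fun τ hτ => ?_
    rw [uIcc_of_le ht.1.le] at hτ
    refine heat_congr_ae ?_ x
    filter_upwards [hu τ ⟨hτ.1, hτ.2.trans ht.2⟩] with y hy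
    rw [hy]

/-- If the minimal solution on the Fourier side has infinite mass at some time, then the
corresponding maximal Weissler solution blows up before that time. -/
theorem exists_maximal (H : IsDatum f₀ B) (u₀ : 𝓢(E3, ℝ)) (hu₀ : ∀ x, u₀ x = phys f₀ x)
    {s : ℝ} (hs : 0 ≤ s) (hinf : mass f₀ s = ∞) :
    ∃ (Tmax : ℝ) (u : ℝ → Lp ℝ 3 (volume : Measure E3)),
      IsMaximalWeisslerSolution u₀ Tmax u ∧ Tmax ≤ s ∧
      Tendsto (fun t => eLpNorm (u t : E3 → ℝ) ∞ volume) (𝓝[<] Tmax) (𝓝 ∞) := by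
  obtain ⟨Tmax, hpos, hle, hlife, hblow⟩ := exists_lifespan H.measurable H.finite hs hinf
  obtain ⟨u, hu⟩ := H.exists_trajectory hlife
  have hm := measurable_fsol_apply H.measurable
  have hsol : ∀ T, 0 < T → T < Tmax → IsWeisslerSolution u₀ T u := by
    intro T hT hTm
    obtain ⟨A, hA⟩ := hlife T hTm
    exact H.isWeisslerSolution u₀ hu₀ hT hA fun t ht => hu t ⟨ht.1, ht.2.trans_lt hTm⟩
  have hub : Tendsto (fun t => eLpNorm (u t : E3 → ℝ) ∞ volume) (𝓝[<] Tmax) (𝓝 ∞) := by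
    refine tendsto_of_tendsto_of_tendsto_of_le_of_le' hblow tendsto_const_nhds ?_
      (Eventually.of_forall fun t => le_top)
    filter_upwards [Ioo_mem_nhdsLT hpos] with t ht
    obtain ⟨A, hA⟩ := hlife t ht.2
    have hfin := mass_ne_top hA (t := t) ⟨ht.1.le, le_rfl⟩
    rw [eLpNorm_congr_ae (hu t ⟨ht.1.le, ht.2⟩)]
    refine le_trans ?_ (enorm_le_eLpNorm_top (continuous_phys (hm t) hfin) 0)
    rw [phys_zero (hm t) hfin, ← ofReal_norm, Real.norm_of_nonneg ENNReal.toReal_nonneg,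
      ENNReal.ofReal_toReal hfin]
    rfl
  have huniq : ∀ (T : ℝ) (v : ℝ → Lp ℝ 3 (volume : Measure E3)), IsWeisslerSolution u₀ T v →
      ∀ t ∈ Icc 0 T, t < Tmax → v t = u t := by
    intro T v hv t ht htm
    -- The comparison interval must have positive length even when `t = 0`, and must stay below both
    -- `T` and `Tmax`.
    set r := max t (min T (Tmax / 2)) with hr
    have hr0 : 0 < r := lt_max_of_lt_right (lt_min hv.pos (by linarith))
    have hrT : r ≤ T := max_le ht.2 (min_le_left _ _)
    have hrm : r < Tmax := max_lt htm ((min_le_right _ _).trans_lt (by linarith))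
    obtain ⟨A, hA⟩ := hlife r hrm
    have hvr : IsWeisslerSolution u₀ r v :=
      ⟨hr0, hv.continuousOn.mono (Icc_subset_Icc_right hrT), fun a ha => by
        obtain ⟨M, hM⟩ := hv.locBounded a ha
        exact ⟨M, fun t ht => hM t ⟨ht.1, ht.2.trans hrT⟩⟩, hv.initial,
        fun t ht => hv.duhamel t ⟨ht.1, ht.2.trans hrT⟩⟩
    refine (hsol r hr0 hrm).eq_of_bounded hvr (U := A) ?_ t ⟨ht.1, le_max_left _ _⟩
    intro τ hτ
    filter_upwards [hu τ ⟨hτ.1, hτ.2.trans_lt hrm⟩] with x hx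
    rw [hx]
    exact (abs_phys_le (hm τ) (mass_ne_top hA hτ) x).trans
      (ENNReal.toReal_le_coe_of_le_coe (hA τ hτ))
  refine ⟨Tmax, u, ⟨hpos, hsol, fun T v hv => ?_⟩, hle, hub⟩
  have hT : T < Tmax := by
    by_contra! hT
    -- A solution reaching `Tmax` is bounded on `[Tmax/2, T]`, yet agrees with `u` before `Tmax`,
    -- where the sup norm is unbounded.
    obtain ⟨M, hM⟩ := hv.locBounded (Tmax / 2) (by linarith)
    have h1 := (ENNReal.tendsto_nhds_top_iff_nnreal.1 hub) M
    obtain ⟨t, ht1, ht2⟩ := (h1.and (Ioo_mem_nhdsLT (show Tmax / 2 < Tmax by linarith))).exists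
    have h2 := hM t ⟨ht2.1.le, ht2.2.le.trans hT⟩
    rw [huniq T v hv t ⟨by linarith [ht2.1], ht2.2.le.trans hT⟩ ht2.2] at h2
    exact absurd ht1 (not_lt.2 h2)
  exact ⟨hT, fun t ht => huniq T v hv t ht (ht.2.trans_lt hT)⟩

end IsDatum

/-! ### Self-amplification of the low frequencies. -/

/-- A lower bound for `f ∗ f ∗ f` from lower bounds of `f` on three balls. -/
theorem le_conv3 {f : E3 → ℝ≥0∞} {m : ℝ≥0∞} {r : ℝ} {p q η : E3}
    (hp : ∀ ξ, dist ξ p < r → m ≤ f ξ) (hq : ∀ ξ, dist ξ q < r → m ≤ f ξ)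
    (hpq : ∀ ξ, dist ξ (η - p - q) < 2 * r → m ≤ f ξ) :
    m ^ 3 * volume (Metric.ball (0 : E3) r) ^ 2 ≤ conv3 f η := by
  have hvol : ∀ z : E3, volume (Metric.ball z r) = volume (Metric.ball (0 : E3) r) := fun z =>
    Measure.addHaar_ball_center volume z r
  have h1 : ∀ a ∈ Metric.ball p r, m ^ 2 * volume (Metric.ball (0 : E3) r) ≤
      ∫⁻ b, f b * f (-b + (-a + η)) := by
    intro a ha
    calc m ^ 2 * volume (Metric.ball (0 : E3) r) = ∫⁻ b in Metric.ball q r, m ^ 2 := by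
          rw [setLIntegral_const, hvol q]
      _ ≤ ∫⁻ b in Metric.ball q r, f b * f (-b + (-a + η)) := by
          refine setLIntegral_mono' measurableSet_ball fun b hb => ?_
          rw [sq]
          refine mul_le_mul' (hq b hb) (hpq _ ?_)
          have e : -b + (-a + η) - (η - p - q) = -((b - q) + (a - p)) := by abel
          rw [dist_eq_norm, e, norm_neg]
          refine (norm_add_le _ _).trans_lt ?_
          rw [Metric.mem_ball, dist_eq_norm] at ha hb
          linarith
      _ ≤ _ := setLIntegral_le_lintegral _ _
  rw [conv3_apply]
  calc m ^ 3 * volume (Metric.ball (0 : E3) r) ^ 2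
      = ∫⁻ a in Metric.ball p r, m * (m ^ 2 * volume (Metric.ball (0 : E3) r)) := by
        rw [setLIntegral_const, hvol p]; ring
    _ ≤ ∫⁻ a in Metric.ball p r, f a * ∫⁻ b, f b * f (-b + (-a + η)) :=
        setLIntegral_mono' measurableSet_ball fun a ha => mul_le_mul' (hp a ha) (h1 a ha)
    _ ≤ _ := setLIntegral_le_lintegral _ _

theorem ofReal_le_symb {t R : ℝ} {ξ : E3} (h : t * ‖ξ‖ ^ 2 ≤ R) :
    ENNReal.ofReal (Real.exp (-(4 * Real.pi ^ 2 * R))) ≤ symb t ξ := by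
  unfold symb
  refine ENNReal.ofReal_le_ofReal (Real.exp_le_exp.2 ?_)
  have : 0 ≤ 4 * Real.pi ^ 2 := by positivity
  nlinarith

/-- The volume of the ball of radius `1/10`. -/
noncomputable def ballVol : ℝ := (volume (Metric.ball (0 : E3) (1 / 10))).toReal

theorem ballVol_pos : 0 < ballVol :=
  ENNReal.toReal_pos (Metric.measure_ball_pos _ _ (by norm_num)).ne' measure_ball_lt_top.ne

theorem ofReal_ballVol : ENNReal.ofReal ballVol = volume (Metric.ball (0 : E3) (1 / 10)) :=
  ENNReal.ofReal_toReal measure_ball_lt_top.ne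

/-- A lower bound for the symbol for low frequencies and times up to one. -/
noncomputable def dampConst : ℝ := Real.exp (-(4 * Real.pi ^ 2))

theorem dampConst_pos : 0 < dampConst := Real.exp_pos _

theorem ofReal_dampConst_le_symb {t : ℝ} {ξ : E3} (ht1 : t ≤ 1) (hξ : ‖ξ‖ ≤ 1 / 2) :
    ENNReal.ofReal dampConst ≤ symb t ξ := by
  have h : t * ‖ξ‖ ^ 2 ≤ 1 := by
    have : ‖ξ‖ ^ 2 ≤ 1 := by
      have := norm_nonneg ξ
      nlinarith
    nlinarith [sq_nonneg ‖ξ‖]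
  have := ofReal_le_symb h
  rwa [mul_one] at this

/-- Growth of the low frequencies: a lower bound on a time interval is upgraded by the equation. -/
theorem ofReal_le_fsol_of_le (hf₀ : Measurable f₀) {s r t y : ℝ} (hs : 0 ≤ s) (hrt : r ≤ t)
    (ht1 : t ≤ 1) (hy : 0 ≤ y)
    (h : ∀ τ ∈ Ioo s r, ∀ ξ : E3, ‖ξ‖ ≤ 1 / 2 → ENNReal.ofReal y ≤ fsol f₀ τ ξ)
    {η : E3} (hη : ‖η‖ ≤ 1 / 2) :
    ENNReal.ofReal ((r - s) * (dampConst * (y ^ 3 * ballVol ^ 2))) ≤ fsol f₀ t η := by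
  have hd := dampConst_pos
  have hb := ballVol_pos
  rw [fsol_eq hf₀]
  refine le_trans ?_ le_add_self
  have hsub : Ioo s r ⊆ Ioo 0 t := Ioo_subset_Ioo hs hrt
  refine le_trans ?_ (lintegral_mono_set hsub)
  calc ENNReal.ofReal ((r - s) * (dampConst * (y ^ 3 * ballVol ^ 2)))
      = ∫⁻ τ in Ioo s r, ENNReal.ofReal (dampConst * (y ^ 3 * ballVol ^ 2)) := by
        rw [setLIntegral_const, Real.volume_Ioo, ← ENNReal.ofReal_mul (by positivity), mul_comm]
    _ ≤ _ := by
        refine setLIntegral_mono' measurableSet_Ioo fun τ hτ => ?_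
        rw [ENNReal.ofReal_mul hd.le, ENNReal.ofReal_mul (by positivity), ENNReal.ofReal_pow hy,
          ENNReal.ofReal_pow hb.le, ofReal_ballVol]
        refine mul_le_mul' (ofReal_dampConst_le_symb (by linarith [hτ.1]) hη) ?_
        have h3 : ‖(3 : ℝ)⁻¹ • η‖ ≤ 1 / 6 := by
          rw [norm_smul]; norm_num; linarith
        have hlow : ∀ ξ : E3, dist ξ ((3 : ℝ)⁻¹ • η) < 1 / 5 → ENNReal.ofReal y ≤ fsol f₀ τ ξ := by
          intro ξ hξ
          refine h τ hτ ξ ?_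
          rw [dist_eq_norm] at hξ
          have : ‖ξ‖ ≤ ‖ξ - (3 : ℝ)⁻¹ • η‖ + ‖(3 : ℝ)⁻¹ • η‖ := by
            simpa using norm_add_le (ξ - (3 : ℝ)⁻¹ • η) ((3 : ℝ)⁻¹ • η)
          linarith
        -- Splitting `η` into three equal parts keeps all three balls inside the low-frequency
        -- region, since `1/6 + 1/5 ≤ 1/2`.
        refine le_conv3 (p := (3 : ℝ)⁻¹ • η) (q := (3 : ℝ)⁻¹ • η)
          (fun ξ hξ => hlow ξ (by linarith)) (fun ξ hξ => hlow ξ (by linarith)) (fun ξ hξ => ?_)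
        have e : η - (3 : ℝ)⁻¹ • η - (3 : ℝ)⁻¹ • η = (3 : ℝ)⁻¹ • η := by module
        rw [e] at hξ
        exact hlow ξ (by linarith)

/-- Large low frequencies on `[t₁, 2t₁]` force an infinite mass at time `2t₁`. -/
theorem mass_eq_top_of_le (hf₀ : Measurable f₀) {t₁ Y : ℝ} (ht₁ : 0 < t₁) (ht₁' : 2 * t₁ ≤ 1) (hY : 0 < Y)
    (hYbig : 4 ≤ t₁ * (dampConst * (Y ^ 2 * ballVol ^ 2)))
    (h : ∀ t ∈ Icc t₁ (2 * t₁), ∀ ξ : E3, ‖ξ‖ ≤ 1 / 2 → ENNReal.ofReal Y ≤ fsol f₀ t ξ) :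
    mass f₀ (2 * t₁) = ∞ := by
  have hd := dampConst_pos
  have hb := ballVol_pos
  -- The bound doubles while the remaining time halves. The cubic gain brings `4^n` relative to the
  -- current bound against a time `2^(-n)`, so the constant `4` in the hypothesis suffices at every
  -- stage.
  have hstep : ∀ n : ℕ, ∀ t ∈ Icc (2 * t₁ - t₁ * (1 / 2) ^ n) (2 * t₁), ∀ ξ : E3, ‖ξ‖ ≤ 1 / 2 →
      ENNReal.ofReal (Y * 2 ^ n) ≤ fsol f₀ t ξ := by
    intro n
    induction n with
    | zero =>
      intro t ht ξ hξ
      simp only [pow_zero, mul_one] at ht ⊢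
      exact h t ⟨by linarith [ht.1], ht.2⟩ ξ hξ
    | succ n ih =>
      intro t ht ξ hξ
      have hn : (0 : ℝ) < (1 / 2) ^ n := by positivity
      have hn1 : ((1 : ℝ) / 2) ^ n ≤ 1 := pow_le_one₀ (by norm_num) (by norm_num)
      have hpow : ((1 : ℝ) / 2) ^ (n + 1) = (1 / 2) ^ n / 2 := by rw [pow_succ]; ring
      rw [hpow] at ht
      have h1 := ofReal_le_fsol_of_le hf₀ (s := 2 * t₁ - t₁ * (1 / 2) ^ n)
        (r := 2 * t₁ - t₁ * ((1 / 2) ^ n / 2)) (t := t) (y := Y * 2 ^ n)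
        (by nlinarith) ht.1 (ht.2.trans ht₁') (by positivity)
        (fun τ hτ ζ hζ => ih τ ⟨hτ.1.le, by nlinarith [hτ.2]⟩ ζ hζ) hξ
      refine le_trans (ENNReal.ofReal_le_ofReal ?_) h1
      have e2 : (2 * t₁ - t₁ * ((1 / 2) ^ n / 2) - (2 * t₁ - t₁ * (1 / 2) ^ n)) *
          (dampConst * ((Y * 2 ^ n) ^ 3 * ballVol ^ 2)) =
          (t₁ * (dampConst * (Y ^ 2 * ballVol ^ 2))) * (Y * 2 ^ n) * ((1 / 2) ^ n * 2 ^ n * 2 ^ n) / 2 := by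
        ring
      have e3 : ((1 : ℝ) / 2) ^ n * 2 ^ n = 1 := by rw [← mul_pow]; norm_num
      rw [e2, e3, one_mul, pow_succ]
      have h2n : (1 : ℝ) ≤ 2 ^ n := one_le_pow₀ (by norm_num)
      have hYn : 0 < Y * 2 ^ n := by positivity
      have h4 : 4 * (Y * 2 ^ n) ≤ t₁ * (dampConst * (Y ^ 2 * ballVol ^ 2)) * (Y * 2 ^ n) := by gcongr
      have h5 : 0 ≤ t₁ * (dampConst * (Y ^ 2 * ballVol ^ 2)) * (Y * 2 ^ n) := by positivity
      nlinarith
  have hinf : ∀ ξ ∈ Metric.closedBall (0 : E3) (1 / 2), fsol f₀ (2 * t₁) ξ = ∞ := by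
    intro ξ hξ
    have hξ' : ‖ξ‖ ≤ 1 / 2 := by simpa using hξ
    refine ENNReal.eq_top_of_forall_nnreal_le fun x => ?_
    obtain ⟨n, hn⟩ := pow_unbounded_of_one_lt ((x : ℝ) / Y) (by norm_num : (1 : ℝ) < 2)
    rw [div_lt_iff₀ hY] at hn
    have h1 := hstep n (2 * t₁) ⟨by
      have : 0 ≤ t₁ * (1 / 2) ^ n := by positivity
      linarith, le_rfl⟩ ξ hξ'
    refine le_trans ?_ h1
    rw [← ENNReal.ofReal_coe_nnreal]
    exact ENNReal.ofReal_le_ofReal (by linarith)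
  have hle : ∫⁻ ξ in Metric.closedBall (0 : E3) (1 / 2), fsol f₀ (2 * t₁) ξ ≤ mass f₀ (2 * t₁) :=
    setLIntegral_le_lintegral _ _
  rw [setLIntegral_congr_fun measurableSet_closedBall hinf, setLIntegral_const,
    ENNReal.top_mul (Metric.measure_closedBall_pos _ _ (by norm_num)).ne'] at hle
  exact top_le_iff.1 hle

/-! ### The lacunary datum and its transfer to low frequencies. -/

/-- The bump function used to build the data. -/
noncomputable def bump : ContDiffBump (0 : E3) := ⟨1, 2, by norm_num, by norm_num⟩

/-- A fixed unit vector. -/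
noncomputable def dir : E3 := EuclideanSpace.single 0 1

theorem norm_dir : ‖dir‖ = 1 := by simp [dir]

/-- Four bumps at the frequencies `±l` and `±2l`. -/
noncomputable def pat (l : ℝ) (ξ : E3) : ℝ :=
  bump (ξ - l • dir) + bump (ξ + l • dir) + (bump (ξ - (2 * l) • dir) + bump (ξ + (2 * l) • dir))

/-- The Fourier side of the initial datum: a lacunary superposition of oscillating packets. -/
noncomputable def profile (K N : ℕ) (w : ℝ) (ξ : E3) : ℝ :=
  ∑ k ∈ Finset.Ico K (K + N), w * 16 ^ k * pat (64 ^ k) ξ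

theorem pat_nonneg (l : ℝ) (ξ : E3) : 0 ≤ pat l ξ :=
  add_nonneg (add_nonneg bump.nonneg bump.nonneg) (add_nonneg bump.nonneg bump.nonneg)

theorem pat_le (l : ℝ) (ξ : E3) : pat l ξ ≤ 4 := by
  have h : ∀ z, bump z ≤ 1 := fun z => bump.le_one
  unfold pat
  linarith [h (ξ - l • dir), h (ξ + l • dir), h (ξ - (2 * l) • dir), h (ξ + (2 * l) • dir)]

theorem pat_neg (l : ℝ) (ξ : E3) : pat l (-ξ) = pat l ξ := by
  have h : ∀ z, bump (-z) = bump z := fun z => bump.neg z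
  have h1 : ∀ c : ℝ, -ξ - c • dir = -(ξ + c • dir) := fun c => by abel
  have h2 : ∀ c : ℝ, -ξ + c • dir = -(ξ - c • dir) := fun c => by abel
  unfold pat
  simp only [h1, h2, h]
  ring

theorem one_le_pat_of_dist {l c : ℝ} {ξ : E3} (hc : c = l ∨ c = -l ∨ c = 2 * l ∨ c = -(2 * l))
    (h : dist ξ (c • dir) ≤ 1) : 1 ≤ pat l ξ := by
  have hb : bump (ξ - c • dir) = 1 := by
    refine bump.one_of_mem_closedBall ?_
    rw [mem_closedBall_zero_iff, ← dist_eq_norm]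
    exact h
  have h0 : ∀ z, 0 ≤ bump z := fun z => bump.nonneg
  unfold pat
  have p1 := h0 (ξ - l • dir)
  have p2 := h0 (ξ + l • dir)
  have p3 := h0 (ξ - (2 * l) • dir)
  have p4 := h0 (ξ + (2 * l) • dir)
  rcases hc with rfl | rfl | rfl | rfl
  · linarith
  · rw [neg_smul, sub_neg_eq_add] at hb; linarith
  · linarith
  · rw [neg_smul, sub_neg_eq_add] at hb; linarith

/-- The bumps vanish beyond distance `2` from their centres, and `2 ≤ l/2`. -/
theorem norm_of_pat_ne_zero {l : ℝ} (hl : 4 ≤ l) {ξ : E3} (h : pat l ξ ≠ 0) :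
    l / 2 ≤ ‖ξ‖ ∧ ‖ξ‖ ≤ 3 * l := by
  have key : ∀ c : ℝ, (l ≤ |c| ∧ |c| ≤ 2 * l) → bump (ξ - c • dir) ≠ 0 → l / 2 ≤ ‖ξ‖ ∧ ‖ξ‖ ≤ 3 * l := by
    intro c hc hb
    have h1 : ‖ξ - c • dir‖ < 2 := by
      by_contra! hcon
      exact hb (bump.zero_of_le_dist (by rw [dist_zero_right]; exact hcon))
    have h2 : ‖c • dir‖ = |c| := by rw [norm_smul, norm_dir, mul_one, Real.norm_eq_abs]
    have h3 := norm_sub_norm_le (c • dir) ξ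
    have h4 := norm_sub_norm_le ξ (c • dir)
    rw [norm_sub_rev, h2] at h3
    rw [h2] at h4
    constructor <;> linarith [hc.1, hc.2]
  have hl0 : 0 ≤ l := by linarith
  by_contra hcon
  have z : ∀ c : ℝ, (l ≤ |c| ∧ |c| ≤ 2 * l) → bump (ξ - c • dir) = 0 := fun c hc => by
    by_contra hb
    exact hcon (key c hc hb)
  have z1 := z l (by rw [abs_of_nonneg hl0]; constructor <;> linarith)
  have z2 := z (-l) (by rw [abs_neg, abs_of_nonneg hl0]; constructor <;> linarith)
  have z3 := z (2 * l) (by rw [abs_of_nonneg (by linarith)]; constructor <;> linarith)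
  have z4 := z (-(2 * l)) (by rw [abs_neg, abs_of_nonneg (by linarith)]; constructor <;> linarith)
  rw [neg_smul, sub_neg_eq_add] at z2 z4
  exact h (by rw [pat, z1, z2, z3, z4]; norm_num)

theorem contDiff_pat (l : ℝ) : ContDiff ℝ (⊤ : ℕ∞) (pat l) := by
  have h : ∀ c : E3, ContDiff ℝ (⊤ : ℕ∞) fun ξ => bump (ξ + c) := fun c =>
    bump.contDiff.comp (contDiff_id.add contDiff_const)
  have h' : ∀ c : E3, ContDiff ℝ (⊤ : ℕ∞) fun ξ => bump (ξ - c) := fun c =>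
    bump.contDiff.comp (contDiff_id.sub contDiff_const)
  exact ((h' _).add (h _)).add ((h' _).add (h _))

theorem integrable_bump : Integrable bump := bump.integrable

theorem integrable_pat (l : ℝ) : Integrable (pat l) :=
  ((integrable_bump.comp_sub_right _).add (integrable_bump.comp_add_right _)).add
    ((integrable_bump.comp_sub_right _).add (integrable_bump.comp_add_right _))

theorem integral_pat (l : ℝ) : ∫ ξ, pat l ξ = 4 * ∫ ξ, bump ξ := by
  have h1 : ∀ c : E3, Integrable fun ξ => bump (ξ - c) := fun c => integrable_bump.comp_sub_right c
  have h2 : ∀ c : E3, Integrable fun ξ => bump (ξ + c) := fun c => integrable_bump.comp_add_right c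
  have h3 : ∀ c : ℝ, ∫ ξ, (bump (ξ - c • dir) + bump (ξ + c • dir)) = 2 * ∫ ξ, bump ξ := by
    intro c
    rw [integral_add (h1 _) (h2 _), integral_sub_right_eq_self (fun ξ => bump ξ),
      integral_add_right_eq_self (fun ξ => bump ξ)]
    ring
  have h4 : ∀ c : ℝ, Integrable fun ξ => bump (ξ - c • dir) + bump (ξ + c • dir) :=
    fun c => (h1 _).add (h2 _)
  unfold pat
  rw [integral_add (h4 l) (h4 (2 * l)), h3, h3]
  ring

section Profile

variable {K N : ℕ} {w : ℝ}

theorem profile_nonneg (hw : 0 ≤ w) (ξ : E3) : 0 ≤ profile K N w ξ :=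
  Finset.sum_nonneg fun _ _ => mul_nonneg (by positivity) (pat_nonneg _ _)

theorem profile_neg (ξ : E3) : profile K N w (-ξ) = profile K N w ξ := by
  simp only [profile, pat_neg]

theorem contDiff_profile : ContDiff ℝ (⊤ : ℕ∞) (profile K N w) := by
  unfold profile
  exact ContDiff.sum fun k _ => contDiff_const.mul (contDiff_pat _)

theorem integrable_profile : Integrable (profile K N w) := by
  unfold profile
  exact integrable_finsetSum _ fun k _ => (integrable_pat _).const_mul _

theorem four_le_pow {k : ℕ} (hk : 1 ≤ k) : (4 : ℝ) ≤ 64 ^ k := by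
  calc (4 : ℝ) ≤ 64 ^ 1 := by norm_num
    _ ≤ 64 ^ k := pow_le_pow_right₀ (by norm_num) hk

theorem hasCompactSupport_profile (hK : 1 ≤ K) : HasCompactSupport (profile K N w) := by
  refine HasCompactSupport.of_support_subset_isCompact
    (isCompact_closedBall (0 : E3) (3 * 64 ^ (K + N))) fun ξ hξ => ?_
  obtain ⟨k, hk, hne⟩ := Finset.exists_ne_zero_of_sum_ne_zero hξ
  rw [Finset.mem_Ico] at hk
  have h := norm_of_pat_ne_zero (four_le_pow (hK.trans hk.1)) (right_ne_zero_of_mul hne)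
  rw [mem_closedBall_zero_iff]
  refine h.2.trans ?_
  have : (64 : ℝ) ^ k ≤ 64 ^ (K + N) := pow_le_pow_right₀ (by norm_num) hk.2.le
  linarith

theorem exists_isDatum_profile (hK : 1 ≤ K) (hw : 0 ≤ w) :
    ∃ B, IsDatum (fun ξ => ENNReal.ofReal (profile K N w ξ)) B := by
  have hc : Continuous (profile K N w) := contDiff_profile.continuous
  obtain ⟨B, hB⟩ := (hasCompactSupport_profile (N := N) (w := w) hK).exists_bound_of_continuous hc
  refine ⟨B, hc.measurable.ennreal_ofReal, fun ξ => by rw [profile_neg],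
    (norm_nonneg _).trans (hB 0), fun ξ => ENNReal.ofReal_le_ofReal ((le_abs_self _).trans (hB ξ)), ?_⟩
  rw [← ofReal_integral_eq_lintegral_ofReal integrable_profile (ae_of_all _ (profile_nonneg hw))]
  exact ENNReal.ofReal_ne_top

theorem exists_schwartz_profile (hK : 1 ≤ K) (hw : 0 ≤ w) :
    ∃ u₀ : 𝓢(E3, ℝ), ∀ x, u₀ x = phys (fun ξ => ENNReal.ofReal (profile K N w ξ)) x := by
  have hgC : HasCompactSupport fun ξ => (profile K N w ξ : ℂ) :=
    (hasCompactSupport_profile hK).comp_left (g := fun r : ℝ => (r : ℂ)) (by simp)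
  have hgD : ContDiff ℝ (⊤ : ℕ∞) fun ξ => (profile K N w ξ : ℂ) :=
    Complex.ofRealCLM.contDiff.comp contDiff_profile
  set G : 𝓢(E3, ℂ) := hgC.toSchwartzMap hgD with hG
  have hGd : (G : E3 → ℂ) = dens (fun ξ => ENNReal.ofReal (profile K N w ξ)) := by
    ext ξ
    rw [dens, ENNReal.toReal_ofReal (profile_nonneg hw ξ)]
    rfl
  refine ⟨SchwartzMap.postcompCLM (𝕜 := ℝ) Complex.reCLM (𝓕⁻ G), fun x => ?_⟩
  rw [phys, ← hGd, ← SchwartzMap.fourierInv_coe]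
  rfl

/-- The damping factor at the time scale adapted to a packet. -/
noncomputable def packetConst : ℝ := Real.exp (-(4 * Real.pi ^ 2 * 9))

theorem packetConst_pos : 0 < packetConst := Real.exp_pos _

/-- Only the linear evolution of one packet is kept. Since `|ξ| ≤ 3·64^k` and `s·64^(2k) ≤ 1`, the
damping exponent is at most `4π²·9`, uniformly in `k`. -/
theorem ofReal_le_fsol_profile (hK : 1 ≤ K) (hw : 0 ≤ w) {k : ℕ} (hk : k ∈ Finset.Ico K (K + N))
    {s c : ℝ} (hs : 0 < s) (hs' : s * (64 ^ k) ^ 2 ≤ 1)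
    (hc : c = 64 ^ k ∨ c = -64 ^ k ∨ c = 2 * 64 ^ k ∨ c = -(2 * 64 ^ k)) {ξ : E3}
    (hξ : dist ξ (c • dir) ≤ 1) :
    ENNReal.ofReal (packetConst * (w * 16 ^ k)) ≤
      fsol (fun ξ => ENNReal.ofReal (profile K N w ξ)) s ξ := by
  have hp : 1 ≤ pat (64 ^ k) ξ := one_le_pat_of_dist hc hξ
  have h4 : (4 : ℝ) ≤ 64 ^ k := four_le_pow (hK.trans (Finset.mem_Ico.1 hk).1)
  have hn := norm_of_pat_ne_zero h4 (by linarith : pat (64 ^ k) ξ ≠ 0)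
  obtain ⟨B, H⟩ := exists_isDatum_profile (N := N) hK hw
  have h1 : w * 16 ^ k ≤ profile K N w ξ := by
    have h2 : w * 16 ^ k * pat (64 ^ k) ξ ≤ profile K N w ξ :=
      Finset.single_le_sum (f := fun k => w * 16 ^ k * pat (64 ^ k) ξ)
        (fun i _ => mul_nonneg (by positivity) (pat_nonneg _ _)) hk
    have h3 : 0 ≤ w * 16 ^ k := by positivity
    nlinarith
  rw [fsol_eq H.measurable, ENNReal.ofReal_mul packetConst_pos.le]
  refine le_trans (mul_le_mul' (ofReal_le_symb ?_) (ENNReal.ofReal_le_ofReal h1)) le_self_add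
  calc s * ‖ξ‖ ^ 2 ≤ s * (3 * 64 ^ k) ^ 2 := by gcongr; exact hn.2
    _ = 9 * (s * (64 ^ k) ^ 2) := by ring
    _ ≤ 9 := by linarith

/-- The resonance `64^k + 64^k - 2·64^k = 0`: two frequencies near `64^k` and one near `-2·64^k` add
up to a prescribed low `η`. The third ball, shifted by `η`, stays within distance `1/5 + 1/2 ≤ 1` of
its bump's centre. -/
theorem ofReal_le_conv3_profile (hK : 1 ≤ K) (hw : 0 ≤ w) {k : ℕ} (hk : k ∈ Finset.Ico K (K + N))
    {s : ℝ} (hs : 0 < s) (hs' : s * (64 ^ k) ^ 2 ≤ 1) {η : E3} (hη : ‖η‖ ≤ 1 / 2) :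
    ENNReal.ofReal ((packetConst * (w * 16 ^ k)) ^ 3 * ballVol ^ 2) ≤
      conv3 (fsol (fun ξ => ENNReal.ofReal (profile K N w ξ)) s) η := by
  have hp := packetConst_pos
  rw [ENNReal.ofReal_mul (by positivity), ENNReal.ofReal_pow (by positivity),
    ENNReal.ofReal_pow ballVol_pos.le, ofReal_ballVol]
  have hmain := fun c hc ξ hξ => ofReal_le_fsol_profile (N := N) (c := c) (ξ := ξ) hK hw hk hs hs' hc hξ
  refine le_conv3 (p := (64 ^ k : ℝ) • dir) (q := (64 ^ k : ℝ) • dir)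
    (fun ξ hξ => hmain _ (Or.inl rfl) ξ (by linarith))
    (fun ξ hξ => hmain _ (Or.inl rfl) ξ (by linarith)) (fun ξ hξ => ?_)
  refine hmain (-(2 * 64 ^ k)) (Or.inr (Or.inr (Or.inr rfl))) ξ ?_
  have e : ξ - (-(2 * 64 ^ k : ℝ)) • dir =
      (ξ - (η - (64 ^ k : ℝ) • dir - (64 ^ k : ℝ) • dir)) + η := by module
  rw [dist_eq_norm] at hξ ⊢
  rw [e]
  refine (norm_add_le _ _).trans ?_
  linarith

/-- Each packet transfers the same amount of mass to the low frequencies. -/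
theorem ofReal_le_fsol_low (hK : 1 ≤ K) (hw : 0 ≤ w) {t₁ t : ℝ} (hKt : 1 ≤ t₁ * (64 ^ K) ^ 2)
    (ht : t₁ ≤ t) (ht1 : t ≤ 1) {η : E3} (hη : ‖η‖ ≤ 1 / 2) :
    ENNReal.ofReal (N * (dampConst * (packetConst ^ 3 * w ^ 3 * ballVol ^ 2) / 2)) ≤
      fsol (fun ξ => ENNReal.ofReal (profile K N w ξ)) t η := by
  have hp := packetConst_pos
  have hd := dampConst_pos
  have hb := ballVol_pos
  obtain ⟨B, H⟩ := exists_isDatum_profile (N := N) hK hw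
  -- Time windows in which packet `k` is still active. They are disjoint because the scales shrink
  -- by `64^2`, so the contributions add, and all lie before `t₁` by the choice of `K`.
  set I : ℕ → Set ℝ := fun k => Ioo (1 / (64 ^ k) ^ 2 / 2) (1 / (64 ^ k) ^ 2) with hI
  have hI0 : ∀ k, ∀ s ∈ I k, 0 < s ∧ s * (64 ^ k) ^ 2 ≤ 1 := by
    intro k s hs
    have h64 : (0 : ℝ) < (64 ^ k) ^ 2 := by positivity
    refine ⟨lt_trans (by positivity) hs.1, ?_⟩
    have := hs.2.le
    rwa [le_div_iff₀ h64] at this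
  have hIt : ∀ k ∈ Finset.Ico K (K + N), I k ⊆ Ioo 0 t := by
    intro k hk s hs
    refine ⟨(hI0 k s hs).1, hs.2.trans_le (le_trans ?_ ht)⟩
    rw [div_le_iff₀ (by positivity)]
    refine hKt.trans ?_
    have h1 : (64 : ℝ) ^ K ≤ 64 ^ k := pow_le_pow_right₀ (by norm_num) (Finset.mem_Ico.1 hk).1
    have h2 : 0 ≤ t₁ := by
      by_contra! hneg
      have : t₁ * (64 ^ K) ^ 2 ≤ 0 := mul_nonpos_of_nonpos_of_nonneg hneg.le (by positivity)
      linarith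
    gcongr
  have hdisj : Set.PairwiseDisjoint (↑(Finset.Ico K (K + N))) I := by
    have hlt : ∀ i j : ℕ, i < j → Disjoint (I i) (I j) := by
      intro i j hij
      rw [Set.disjoint_left]
      intro s hi hj
      have h1 : 1 / (64 ^ j : ℝ) ^ 2 ≤ 1 / (64 ^ i) ^ 2 / 2 := by
        rw [div_div]
        apply one_div_le_one_div_of_le (by positivity)
        have h2 : (64 : ℝ) ^ i * 64 ≤ 64 ^ j := by
          rw [← pow_succ]; exact pow_le_pow_right₀ (by norm_num) hij
        have h3 : (0 : ℝ) < 64 ^ i := by positivity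
        nlinarith
      exact absurd (hi.1.trans (hj.2.trans_le h1)) (lt_irrefl _)
    intro i _ j _ hij
    rcases lt_or_gt_of_ne hij with h | h
    · exact hlt i j h
    · exact (hlt j i h).symm
  have hterm : ∀ k ∈ Finset.Ico K (K + N),
      ENNReal.ofReal (dampConst * (packetConst ^ 3 * w ^ 3 * ballVol ^ 2) / 2) ≤
      ∫⁻ τ in I k, symb (t - τ) η *
        conv3 (fsol (fun ξ => ENNReal.ofReal (profile K N w ξ)) τ) η := by
    intro k hk
    calc ENNReal.ofReal (dampConst * (packetConst ^ 3 * w ^ 3 * ballVol ^ 2) / 2)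
        = ∫⁻ τ in I k, ENNReal.ofReal
            (dampConst * ((packetConst * (w * 16 ^ k)) ^ 3 * ballVol ^ 2)) := by
          rw [setLIntegral_const, hI, Real.volume_Ioo, ← ENNReal.ofReal_mul (by positivity)]
          congr 1
          -- The cubed amplitude cancels the window length exactly, which makes the contribution
          -- independent of `k`.
          have e : ((16 : ℝ) ^ k) ^ 3 = (64 ^ k) ^ 2 := by
            rw [← pow_mul, ← pow_mul, mul_comm k 3, mul_comm k 2, pow_mul, pow_mul]; norm_num
          have h64 : ((64 : ℝ) ^ k) ^ 2 ≠ 0 := by positivity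
          rw [mul_pow, mul_pow, e]
          field_simp
          ring
      _ ≤ _ := by
          refine setLIntegral_mono' measurableSet_Ioo fun τ hτ => ?_
          have hτt := hIt k hk hτ
          rw [ENNReal.ofReal_mul hd.le]
          exact mul_le_mul' (ofReal_dampConst_le_symb (by linarith [hτt.1]) hη)
            (ofReal_le_conv3_profile hK hw hk (hI0 k τ hτ).1 (hI0 k τ hτ).2 hη)
  rw [fsol_eq H.measurable]
  refine le_trans ?_ le_add_self
  refine le_trans ?_ (lintegral_mono_set (iUnion₂_subset hIt))
  rw [lintegral_biUnion_finset hdisj fun k _ => measurableSet_Ioo]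
  refine le_trans (le_of_eq ?_) (Finset.sum_le_sum hterm)
  rw [Finset.sum_const, Nat.card_Ico, Nat.add_sub_cancel_left, nsmul_eq_mul,
    ENNReal.ofReal_mul (by positivity), ENNReal.ofReal_natCast]

end Profile

/-! ### Littlewood–Paley blocks and Besov norms of the datum. -/

theorem integrable_dilate (ψ : 𝓢(E3, ℂ)) (j : ℤ) : Integrable (dilate ψ j) := by
  unfold dilate
  exact ((integrable_comp_smul_iff volume (ψ : E3 → ℂ) (by positivity : (2 : ℝ) ^ j ≠ 0)).2
    ψ.integrable).const_mul _

theorem fourier_dilate (ψ : 𝓢(E3, ℂ)) (j : ℤ) (ξ : E3) :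
    𝓕 (dilate ψ j) ξ = 𝓕 (ψ : E3 → ℂ) (((2 : ℝ) ^ j)⁻¹ • ξ) := by
  have hc : (2 : ℝ) ^ j ≠ 0 := by positivity
  rw [Real.fourier_eq, Real.fourier_eq]
  obtain ⟨g, hg⟩ : ∃ g : E3 → ℂ,
      ∀ z, g z = Real.fourierChar (-inner ℝ z (((2 : ℝ) ^ j)⁻¹ • ξ)) • ψ z := ⟨_, fun _ => rfl⟩
  have h1 : ∀ y : E3, Real.fourierChar (-inner ℝ y ξ) • dilate ψ j y =
      (2 : ℂ) ^ (3 * j) * g ((2 : ℝ) ^ j • y) := by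
    intro y
    have e : inner ℝ ((2 : ℝ) ^ j • y) (((2 : ℝ) ^ j)⁻¹ • ξ) = inner ℝ y ξ := by
      rw [inner_smul_left, inner_smul_right]
      simp only [conj_trivial]
      field_simp
    simp only [hg, e, dilate, Circle.smul_def, smul_eq_mul]
    ring
  simp_rw [h1, ← hg]
  rw [integral_const_mul, Measure.integral_comp_smul]
  have h2 : (2 : ℂ) ^ (3 * j) = (((2 : ℝ) ^ j) ^ 3 : ℝ) := by
    push_cast
    rw [mul_comm, zpow_mul]
    norm_cast
  rw [h2, finrank_euclideanSpace_fin, abs_of_pos (by positivity), Complex.real_smul, ← mul_assoc,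
    ← Complex.ofReal_mul, mul_inv_cancel₀ (by positivity), Complex.ofReal_one, one_mul]

theorem IsLittlewoodPaley.annulus {ψ : 𝓢(E3, ℂ)} (hψ : IsLittlewoodPaley ψ) {j : ℤ} {ξ : E3}
    (h : 𝓕 (dilate ψ j) ξ ≠ 0) :
    3 / 5 * (2 : ℝ) ^ j ≤ 2 * Real.pi * ‖ξ‖ ∧ 2 * Real.pi * ‖ξ‖ ≤ 5 / 3 * (2 : ℝ) ^ j := by
  have hj : (0 : ℝ) < 2 ^ j := by positivity
  have h2π : 0 < 2 * Real.pi := by positivity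
  rw [fourier_dilate] at h
  have h1 : hat ψ ((2 * Real.pi) • (((2 : ℝ) ^ j)⁻¹ • ξ)) ≠ 0 := by
    rw [hat, smul_smul _ (2 * Real.pi), inv_mul_cancel₀ h2π.ne', one_smul]
    exact h
  have h2 := hψ.support _ h1
  rw [norm_smul, norm_smul, Real.norm_of_nonneg h2π.le, Real.norm_of_nonneg (by positivity)] at h2
  have e : 2 * Real.pi * (((2 : ℝ) ^ j)⁻¹ * ‖ξ‖) = 2 * Real.pi * ‖ξ‖ / 2 ^ j := by field_simp
  rw [e, le_div_iff₀ hj, div_le_iff₀ hj] at h2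
  exact h2

/-- Packet `k` lives where `2π|ξ|` is between `π·64^k` and `6π·64^k`, which forces `64^k ≤ 2^j <
64·64^k`. The ratio `64 = 2^6` is what makes the index ranges of different packets disjoint. -/
theorem block_range_of_pat_ne_zero {j : ℤ} {k : ℕ} {ξ : E3} (hk : 1 ≤ k) (hp : pat (64 ^ k) ξ ≠ 0)
    (h1 : 3 / 5 * (2 : ℝ) ^ j ≤ 2 * Real.pi * ‖ξ‖) (h2 : 2 * Real.pi * ‖ξ‖ ≤ 5 / 3 * (2 : ℝ) ^ j) :
    6 * (k : ℤ) ≤ j ∧ j < 6 * k + 6 := by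
  have hn := norm_of_pat_ne_zero (four_le_pow hk) hp
  have e : (64 : ℝ) ^ k = 2 ^ (6 * (k : ℤ)) := by
    rw [zpow_mul, zpow_natCast]; norm_num
  have hk0 : (0 : ℝ) < 64 ^ k := by positivity
  have hpi := Real.pi_gt_three
  have hpi' := Real.pi_lt_d2
  constructor
  · rw [← zpow_le_zpow_iff_right₀ (by norm_num : (1 : ℝ) < 2), ← e]
    nlinarith [hn.1]
  · rw [← zpow_lt_zpow_iff_right₀ (by norm_num : (1 : ℝ) < 2), zpow_add₀ (by norm_num), ← e]
    have h3 : 2 * Real.pi * ‖ξ‖ ≤ 2 * 3.15 * (3 * 64 ^ k) := by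
      have := norm_nonneg ξ
      gcongr
      exact hn.2
    norm_num at h3 ⊢
    nlinarith

section Blocks

variable {ψ : 𝓢(E3, ℂ)} {K N : ℕ} {w : ℝ}

/-- On the annulus of the `j`-th block only the packet number `j / 6` is visible. -/
theorem profile_le_of_annulus (hK : 1 ≤ K) (hw : 0 ≤ w) {j : ℤ} {ξ : E3}
    (h1 : 3 / 5 * (2 : ℝ) ^ j ≤ 2 * Real.pi * ‖ξ‖) (h2 : 2 * Real.pi * ‖ξ‖ ≤ 5 / 3 * (2 : ℝ) ^ j) :
    profile K N w ξ ≤ w * (2 : ℝ) ^ ((j : ℝ) * (2 / 3)) * pat (64 ^ (j / 6).toNat) ξ ∧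
      (j ∉ Finset.Ico (6 * (K : ℤ)) (6 * K + 6 * N) → profile K N w ξ = 0) := by
  have hzero : ∀ k ∈ Finset.Ico K (K + N), ¬(6 * (k : ℤ) ≤ j ∧ j < 6 * k + 6) →
      w * 16 ^ k * pat (64 ^ k) ξ = 0 := by
    intro k hk hj
    by_contra hne
    exact hj (block_range_of_pat_ne_zero (hK.trans (Finset.mem_Ico.1 hk).1)
      (right_ne_zero_of_mul hne) h1 h2)
  constructor
  · set k := (j / 6).toNat with hk
    have hpos : 0 ≤ w * (2 : ℝ) ^ ((j : ℝ) * (2 / 3)) * pat (64 ^ k) ξ :=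
      mul_nonneg (by positivity) (pat_nonneg _ _)
    have hother : ∀ i ∈ Finset.Ico K (K + N), i ≠ k → w * 16 ^ i * pat (64 ^ i) ξ = 0 := by
      intro i hi hik
      refine hzero i hi fun hj => hik ?_
      omega
    by_cases hkm : k ∈ Finset.Ico K (K + N) ∧ 0 ≤ j
    · rw [profile, Finset.sum_eq_single_of_mem k hkm.1 hother]
      refine mul_le_mul_of_nonneg_right (mul_le_mul_of_nonneg_left ?_ hw) (pat_nonneg _ _)
      have e : (16 : ℝ) ^ k = (2 : ℝ) ^ (4 * (k : ℝ)) := by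
        rw [Real.rpow_mul (by norm_num), Real.rpow_natCast]; norm_num
      rw [e]
      refine Real.rpow_le_rpow_of_exponent_le (by norm_num) ?_
      -- With `16^k = 2^(4k)`, this gives the weight `2^(2j/3)`, matching the Besov regularity
      -- `-2/3`.
      have h6 : 6 * (k : ℤ) ≤ j := by omega
      have h6' : 6 * (k : ℝ) ≤ j := by exact_mod_cast h6
      linarith
    · have hall : ∀ i ∈ Finset.Ico K (K + N), w * 16 ^ i * pat (64 ^ i) ξ = 0 := by
        intro i hi
        refine hzero i hi fun hj => hkm ?_
        have : i = k := by omega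
        exact ⟨this ▸ hi, by omega⟩
      rw [profile, Finset.sum_eq_zero hall]
      exact hpos
  · intro hj
    refine Finset.sum_eq_zero fun k hk => hzero k hk fun hkj => hj ?_
    rw [Finset.mem_Ico] at hk ⊢
    omega

theorem lpBlock_eq (hK : 1 ≤ K) (hw : 0 ≤ w) {u₀ : 𝓢(E3, ℝ)}
    (hu₀ : ∀ x, u₀ x = phys (fun ξ => ENNReal.ofReal (profile K N w ξ)) x) (j : ℤ) :
    lpBlock ψ j u₀ = 𝓕⁻ fun ξ => 𝓕 (dilate ψ j) ξ *
      dens (fun ξ => ENNReal.ofReal (profile K N w ξ)) ξ := by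
  obtain ⟨B, H⟩ := exists_isDatum_profile (N := N) hK hw
  ext x
  rw [lpBlock, ← integral_kernel_mul_fourierInv (integrable_dilate ψ j)
    (integrable_dens H.measurable H.finite)]
  refine integral_congr_ae (ae_of_all _ fun y => ?_)
  simp only [hu₀]
  rw [fourierInv_dens (f := fun ξ => ENNReal.ofReal (profile K N w ξ)) H.even]

theorem norm_block_le (hψ : IsLittlewoodPaley ψ) {C : ℝ} (hC0 : 0 ≤ C) (hC : ∀ ξ, ‖𝓕 (ψ : E3 → ℂ) ξ‖ ≤ C)
    (hK : 1 ≤ K) (hw : 0 ≤ w) (j : ℤ) (ξ : E3) :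
    ‖𝓕 (dilate ψ j) ξ * dens (fun ξ => ENNReal.ofReal (profile K N w ξ)) ξ‖ ≤
      C * w * (2 : ℝ) ^ ((j : ℝ) * (2 / 3)) * pat (64 ^ (j / 6).toNat) ξ := by
  have hpos : 0 ≤ C * w * (2 : ℝ) ^ ((j : ℝ) * (2 / 3)) * pat (64 ^ (j / 6).toNat) ξ :=
    mul_nonneg (by positivity) (pat_nonneg _ _)
  by_cases h : 𝓕 (dilate ψ j) ξ = 0
  · rw [h, zero_mul, norm_zero]
    exact hpos
  · have ha := hψ.annulus h
    rw [norm_mul, dens, ENNReal.toReal_ofReal (profile_nonneg hw ξ), Complex.norm_real,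
      Real.norm_of_nonneg (profile_nonneg hw ξ), fourier_dilate]
    calc _ ≤ C * (w * (2 : ℝ) ^ ((j : ℝ) * (2 / 3)) * pat (64 ^ (j / 6).toNat) ξ) :=
          mul_le_mul (hC _) (profile_le_of_annulus hK hw ha.1 ha.2).1 (profile_nonneg hw ξ) hC0
      _ = _ := by ring

theorem lpBlock_eq_zero (hψ : IsLittlewoodPaley ψ) (hK : 1 ≤ K) (hw : 0 ≤ w) {u₀ : 𝓢(E3, ℝ)}
    (hu₀ : ∀ x, u₀ x = phys (fun ξ => ENNReal.ofReal (profile K N w ξ)) x) {j : ℤ}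
    (hj : j ∉ Finset.Ico (6 * (K : ℤ)) (6 * K + 6 * N)) : lpBlock ψ j u₀ = 0 := by
  rw [lpBlock_eq hK hw hu₀]
  have h : (fun ξ => 𝓕 (dilate ψ j) ξ * dens (fun ξ => ENNReal.ofReal (profile K N w ξ)) ξ) =
      fun _ => 0 := by
    ext ξ
    by_cases h : 𝓕 (dilate ψ j) ξ = 0
    · rw [h, zero_mul]
    · have ha := hψ.annulus h
      simp [dens, (profile_le_of_annulus hK hw ha.1 ha.2).2 hj]
  rw [h]
  ext x
  simp [Real.fourierInv_eq]

/-- The Littlewood–Paley blocks of the datum in `L⁹` and `L^∞`. -/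
theorem exists_block_bound (hψ : IsLittlewoodPaley ψ) : ∃ C : ℝ, 0 < C ∧
    ∀ (K N : ℕ) (w : ℝ) (u₀ : 𝓢(E3, ℝ)), 1 ≤ K → 0 ≤ w →
      (∀ x, u₀ x = phys (fun ξ => ENNReal.ofReal (profile K N w ξ)) x) → ∀ j : ℤ,
      eLpNorm (lpBlock ψ j u₀) 9 volume ≤ ENNReal.ofReal (C * w * (2 : ℝ) ^ ((j : ℝ) * (2 / 3))) ∧
      eLpNorm (lpBlock ψ j u₀) ∞ volume ≤ ENNReal.ofReal (C * w * (2 : ℝ) ^ ((j : ℝ) * (2 / 3))) := by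
  set C := (∫ x, ‖ψ x‖) + 1 with hCdef
  have hC0 : 0 < C := by
    have : 0 ≤ ∫ x, ‖ψ x‖ := integral_nonneg fun x => norm_nonneg _
    positivity
  have hC : ∀ ξ, ‖𝓕 (ψ : E3 → ℂ) ξ‖ ≤ C := by
    intro ξ
    rw [Real.fourier_eq]
    refine (norm_integral_le_integral_norm _).trans ?_
    simp only [Circle.norm_smul]
    linarith
  -- The maximum with `1` lets one constant `4J` bound both the integral and the sup of a pattern.
  set J := max (∫ ξ, bump ξ) 1 with hJ
  have hJ1 : 1 ≤ J := le_max_right _ _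
  refine ⟨C * (4 * J), by positivity, fun K N w u₀ hK hw hu₀ j => ?_⟩
  obtain ⟨B, H⟩ := exists_isDatum_profile (N := N) hK hw
  set m := C * w * (2 : ℝ) ^ ((j : ℝ) * (2 / 3)) with hm
  have hm0 : 0 ≤ m := by positivity
  set F : E3 → ℂ := fun ξ => 𝓕 (dilate ψ j) ξ * dens (fun ξ => ENNReal.ofReal (profile K N w ξ)) ξ with hF
  have hFle : ∀ ξ, ‖F ξ‖ ≤ m * pat (64 ^ (j / 6).toNat) ξ := norm_block_le hψ hC0.le hC hK hw j
  have hFm : AEStronglyMeasurable F volume := by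
    refine AEStronglyMeasurable.mul ?_ (measurable_dens H.measurable).aestronglyMeasurable
    have hc : Continuous (𝓕 (dilate ψ j)) :=
      VectorFourier.fourierIntegral_continuous Real.continuous_fourierChar
        (by exact continuous_inner) (integrable_dilate ψ j)
    exact hc.aestronglyMeasurable
  have hFi : Integrable F := ((integrable_pat _).const_mul m).mono' hFm (ae_of_all _ hFle)
  have hint : ∫ ξ, ‖F ξ‖ ≤ m * (4 * J) := by
    refine (integral_mono hFi.norm ((integrable_pat _).const_mul m) hFle).trans ?_
    rw [integral_const_mul, integral_pat]
    have := le_max_left (∫ ξ, bump ξ) 1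
    gcongr
  have hlint : ∫⁻ ξ, ‖F ξ‖ₑ ≤ ENNReal.ofReal (m * (4 * J)) := by
    rw [← ofReal_integral_norm_eq_lintegral_enorm hFi]
    exact ENNReal.ofReal_le_ofReal hint
  have hsup : ∀ ξ, ‖F ξ‖ₑ ≤ ENNReal.ofReal (m * (4 * J)) := by
    intro ξ
    rw [← ofReal_norm]
    refine ENNReal.ofReal_le_ofReal ((hFle ξ).trans ?_)
    refine mul_le_mul_of_nonneg_left ((pat_le _ _).trans ?_) hm0
    linarith
  have e : C * (4 * J) * w * (2 : ℝ) ^ ((j : ℝ) * (2 / 3)) = m * (4 * J) := by rw [hm]; ring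
  rw [e, lpBlock_eq hK hw hu₀]
  constructor
  -- Here `9 = 7 + 2`: eight factors of the `L¹` norm and one of the sup norm of `F`, all with the
  -- same bound.
  · have h := eLpNorm_fourierInv_pow_le hFi ENNReal.ofReal_ne_top hsup 7
    norm_num at h
    have h2 : eLpNorm (𝓕⁻ F) 9 volume ^ 9 ≤ ENNReal.ofReal (m * (4 * J)) ^ 9 := by
      refine h.trans ?_
      rw [pow_succ _ 8]
      gcongr
    exact (ENNReal.pow_le_pow_left_iff (by norm_num)).1 h2
  · refine (eLpNorm_le_of_ae_bound (ae_of_all _ fun x => (norm_fourierInv_le F x).trans hint)).trans ?_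
    simp

/-- Besov bounds for the datum. -/
theorem exists_besov_bound (hψ : IsLittlewoodPaley ψ) : ∃ C : ℝ, 0 < C ∧
    ∀ (K N : ℕ) (w : ℝ) (u₀ : 𝓢(E3, ℝ)), 1 ≤ K → 1 ≤ N → 0 ≤ w →
      (∀ x, u₀ x = phys (fun ξ => ENNReal.ofReal (profile K N w ξ)) x) →
      (∀ (r : ℝ) (q : ℝ≥0∞), 0 < r → ENNReal.ofReal r ≤ q →
        besovNorm ψ (-2 / 3) 9 q u₀ ≤ ENNReal.ofReal ((6 * N : ℝ) ^ (1 / r) * (C * w))) ∧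
      besovNorm ψ (-1) ∞ ∞ u₀ ≤ ENNReal.ofReal (C * w) := by
  obtain ⟨C, hC0, hC⟩ := exists_block_bound hψ
  refine ⟨C, hC0, fun K N w u₀ hK hN hw hu₀ => ?_⟩
  have hN' : (1 : ℝ) ≤ N := by exact_mod_cast hN
  have hterm : ∀ j : ℤ, ENNReal.ofReal ((2 : ℝ) ^ ((j : ℝ) * (-2 / 3))) *
      eLpNorm (lpBlock ψ j u₀) 9 volume ≤ ENNReal.ofReal (C * w) := by
    intro j
    refine (mul_le_mul' le_rfl (hC K N w u₀ hK hw hu₀ j).1).trans (le_of_eq ?_)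
    rw [← ENNReal.ofReal_mul (by positivity)]
    congr 1
    rw [mul_left_comm, ← Real.rpow_add (by norm_num)]
    have : (j : ℝ) * (-2 / 3) + (j : ℝ) * (2 / 3) = 0 := by ring
    rw [this, Real.rpow_zero, mul_one]
  constructor
  · intro r q hr hrq
    have h6 : (1 : ℝ) ≤ 6 * N := by linarith
    have hCw : 0 ≤ C * w := by positivity
    unfold besovNorm
    split_ifs with hq
    · refine iSup_le fun j => (hterm j).trans (ENNReal.ofReal_le_ofReal ?_)
      have : (1 : ℝ) ≤ (6 * N : ℝ) ^ (1 / r) := Real.one_le_rpow h6 (by positivity)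
      nlinarith
    · have hrq' : r ≤ q.toReal := by
        have := ENNReal.toReal_mono hq hrq
        rwa [ENNReal.toReal_ofReal hr.le] at this
      have hq0 : 0 < q.toReal := hr.trans_le hrq'
      have hsum : ∑' j : ℤ, (ENNReal.ofReal ((2 : ℝ) ^ ((j : ℝ) * (-2 / 3))) *
          eLpNorm (lpBlock ψ j u₀) 9 volume) ^ q.toReal ≤
          ENNReal.ofReal (6 * N) * ENNReal.ofReal (C * w) ^ q.toReal := by
        -- Only `6N` blocks can be nonzero, six for each packet; this count is the only source of
        -- growth in `N`.
        rw [tsum_eq_sum (s := Finset.Ico (6 * (K : ℤ)) (6 * K + 6 * N)) (fun j hj => by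
          rw [lpBlock_eq_zero hψ hK hw hu₀ hj, eLpNorm_zero, mul_zero,
            ENNReal.zero_rpow_of_pos hq0])]
        refine (Finset.sum_le_card_nsmul _ _ (ENNReal.ofReal (C * w) ^ q.toReal) fun j _ =>
          ENNReal.rpow_le_rpow (hterm j) hq0.le).trans (le_of_eq ?_)
        rw [Int.card_Ico, nsmul_eq_mul]
        congr 1
        have : (6 * (K : ℤ) + 6 * N - 6 * K).toNat = 6 * N := by omega
        rw [this, ← ENNReal.ofReal_natCast]
        push_cast
        rfl
      refine (ENNReal.rpow_le_rpow hsum (by positivity)).trans ?_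
      rw [ENNReal.mul_rpow_of_nonneg _ _ (by positivity), ← ENNReal.rpow_mul,
        mul_one_div_cancel hq0.ne', ENNReal.rpow_one,
        ENNReal.ofReal_mul (p := (6 * N : ℝ) ^ (1 / r)) (by positivity),
        ENNReal.ofReal_rpow_of_pos (by positivity)]
      exact mul_le_mul' (ENNReal.ofReal_le_ofReal (Real.rpow_le_rpow_of_exponent_le h6
        (one_div_le_one_div_of_le hr hrq'))) le_rfl
  · unfold besovNorm
    rw [if_pos rfl]
    refine iSup_le fun j => ?_
    by_cases hj : j ∈ Finset.Ico (6 * (K : ℤ)) (6 * K + 6 * N)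
    · refine (mul_le_mul' le_rfl (hC K N w u₀ hK hw hu₀ j).2).trans ?_
      rw [← ENNReal.ofReal_mul (by positivity)]
      refine ENNReal.ofReal_le_ofReal ?_
      rw [mul_left_comm, ← Real.rpow_add (by norm_num)]
      -- The remaining weight is `2^(-j/3)`, at most one because only indices `j ≥ 0` occur.
      refine mul_le_of_le_one_right (by positivity) ?_
      refine Real.rpow_le_one_of_one_le_of_nonpos (by norm_num) ?_
      have h0 : (0 : ℤ) ≤ j := by
        have := (Finset.mem_Ico.1 hj).1
        omega
      have h0' : (0 : ℝ) ≤ j := by exact_mod_cast h0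
      linarith
    · rw [lpBlock_eq_zero hψ hK hw hu₀ hj, eLpNorm_zero, mul_zero]
      exact zero_le

end Blocks

/-! ### Choice of parameters. -/

theorem exists_blowup_of_small_data (ψ : 𝓢(E3, ℂ)) (hψ : IsLittlewoodPaley ψ)
    (δ : ℝ) (hδ : 0 < δ) (q₀ : ℝ≥0∞) (hq₀ : 3 < q₀) :
    ∃ (u₀ : 𝓢(E3, ℝ)) (Tmax : ℝ)
      (u : ℝ → Lp ℝ 3 (volume : Measure E3)),
      IsMaximalWeisslerSolution u₀ Tmax u ∧
      Tmax < δ ∧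
      Tendsto (fun t => eLpNorm (u t : E3 → ℝ) ∞ volume) (𝓝[<] Tmax) (𝓝 ∞) ∧
      (∀ q : ℝ≥0∞, q₀ ≤ q →
        besovNorm ψ (-2 / 3) 9 q u₀ ≤ ENNReal.ofReal δ) ∧
      besovNorm ψ (-1) ∞ ∞ u₀ ≤ ENNReal.ofReal δ := by
  obtain ⟨C, hC0, hC⟩ := exists_besov_bound hψ
  -- A finite exponent strictly above `3` handles all `q ≥ q₀` at once, including `q₀ = ∞`.
  obtain ⟨r, hr3, hrq⟩ : ∃ r : ℝ, 3 < r ∧ ENNReal.ofReal r ≤ q₀ := by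
    obtain ⟨r, hr1, hr2⟩ := ENNReal.lt_iff_exists_nnreal_btwn.1 hq₀
    exact ⟨r, by exact_mod_cast hr1, by rw [ENNReal.ofReal_coe_nnreal]; exact hr2.le⟩
  have hr0 : 0 < r := by linarith
  -- Above `1/r`, so that `N^(1/r - a)` tends to zero; below `1/3`, so that `N^(1 - 3a)` tends to
  -- infinity.
  obtain ⟨a, ha1, ha2⟩ : ∃ a : ℝ, 1 / r < a ∧ a < 1 / 3 :=
    exists_between (one_div_lt_one_div_of_lt (by norm_num) hr3)
  set t₁ := min δ 1 / 4 with ht₁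
  have hmin : 0 < min δ 1 := lt_min hδ one_pos
  have ht₁0 : 0 < t₁ := by positivity
  have ht₁δ : 2 * t₁ < δ := by
    have := min_le_left δ 1
    linarith
  have ht₁1 : 2 * t₁ ≤ 1 := by
    have := min_le_right δ 1
    linarith
  -- Starting at frequency `64^K` makes every packet complete its transfer by time `t₁`; this choice
  -- does not depend on `N`.
  obtain ⟨K, hK1, hKt⟩ : ∃ K : ℕ, 1 ≤ K ∧ 1 ≤ t₁ * (64 ^ K) ^ 2 := by
    obtain ⟨n, hn⟩ := pow_unbounded_of_one_lt (1 / t₁) (by norm_num : (1 : ℝ) < 64)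
    refine ⟨n + 1, by omega, ?_⟩
    rw [div_lt_iff₀ ht₁0] at hn
    have h1 : (64 : ℝ) ^ n ≤ (64 ^ (n + 1)) ^ 2 := by
      rw [← pow_mul]
      exact pow_le_pow_right₀ (by norm_num) (by omega)
    nlinarith
  set c := dampConst * (packetConst ^ 3 * ballVol ^ 2) / 2 with hc
  have hd := dampConst_pos
  have hb := ballVol_pos
  have hp := packetConst_pos
  have hc0 : 0 < c := by positivity
  have hlim1 : Tendsto (fun n : ℕ => (6 : ℝ) ^ (1 / r) * C * (n : ℝ) ^ (-(a - 1 / r))) atTop (𝓝 0) := by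
    have := ((tendsto_rpow_neg_atTop (sub_pos.2 ha1)).comp tendsto_natCast_atTop_atTop).const_mul
      ((6 : ℝ) ^ (1 / r) * C)
    simpa using this
  -- This quantity is the left side of the self-amplification threshold at low-frequency size `Y = c
  -- N^(1 - 3a)`; it must reach `4`.
  have hlim2 : Tendsto (fun n : ℕ => t₁ * (dampConst * ballVol ^ 2) * (c * (n : ℝ) ^ (1 - 3 * a)) ^ 2)
      atTop atTop := by
    have h1 := (tendsto_rpow_atTop (by linarith : 0 < 1 - 3 * a)).comp tendsto_natCast_atTop_atTop
    exact ((tendsto_pow_atTop two_ne_zero).comp (h1.const_mul_atTop hc0)).const_mul_atTop (by positivity)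
  obtain ⟨N, ⟨hN1, hN2⟩, hN3⟩ := (((hlim1.eventually_lt_const hδ).and
    (hlim2.eventually_ge_atTop 4)).and (eventually_ge_atTop 1)).exists
  have hN0 : (0 : ℝ) < N := by exact_mod_cast hN3
  set w := (N : ℝ) ^ (-a) with hw
  have hw0 : 0 ≤ w := by positivity
  obtain ⟨B, H⟩ := exists_isDatum_profile (N := N) hK1 hw0
  obtain ⟨u₀, hu₀⟩ := exists_schwartz_profile (N := N) hK1 hw0
  have hY : (N : ℝ) * (dampConst * (packetConst ^ 3 * w ^ 3 * ballVol ^ 2) / 2) =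
      c * (N : ℝ) ^ (1 - 3 * a) := by
    have e : (N : ℝ) ^ (1 - 3 * a) = N * w ^ 3 := by
      rw [hw, ← Real.rpow_natCast, ← Real.rpow_mul hN0.le, sub_eq_add_neg, Real.rpow_add hN0,
        Real.rpow_one]
      congr 2
      push_cast
      ring
    rw [e, hc]
    ring
  have hmass : mass (fun ξ => ENNReal.ofReal (profile K N w ξ)) (2 * t₁) = ∞ := by
    refine mass_eq_top_of_le H.measurable (Y := c * (N : ℝ) ^ (1 - 3 * a)) ht₁0 ht₁1 (by positivity)
      ?_ fun t ht ξ hξ => ?_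
    · refine hN2.trans (le_of_eq ?_)
      ring
    · rw [← hY]
      exact ofReal_le_fsol_low hK1 hw0 hKt ht.1 (ht.2.trans ht₁1) hξ
  obtain ⟨Tmax, u, hmax, hle, hblow⟩ := H.exists_maximal u₀ hu₀ (by positivity) hmass
  obtain ⟨hB1, hB2⟩ := hC K N w u₀ hK1 hN3 hw0 hu₀
  have hsmall : (6 * N : ℝ) ^ (1 / r) * (C * w) ≤ δ := by
    refine le_trans (le_of_eq ?_) hN1.le
    have e : (N : ℝ) ^ (-(a - 1 / r)) = (N : ℝ) ^ (1 / r) * w := by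
      rw [hw, ← Real.rpow_add hN0]
      congr 1
      ring
    rw [e, Real.mul_rpow (by norm_num) hN0.le]
    ring
  refine ⟨u₀, Tmax, u, hmax, hle.trans_lt ht₁δ, hblow, fun q hq => ?_, ?_⟩
  · exact (hB1 r q hr0 (hrq.trans hq)).trans (ENNReal.ofReal_le_ofReal hsmall)
  · refine hB2.trans (ENNReal.ofReal_le_ofReal (le_trans ?_ hsmall))
    have hN1' : (1 : ℝ) ≤ N := by exact_mod_cast hN3
    have : (1 : ℝ) ≤ (6 * N : ℝ) ^ (1 / r) := Real.one_le_rpow (by linarith) (by positivity)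
    have : 0 ≤ C * w := by positivity
    nlinarith

end CubicHeat

theorem theorem3p3 (ψ : 𝓢(CubicHeat.E3, ℂ)) (hψ : CubicHeat.IsLittlewoodPaley ψ)
    (δ : ℝ) (hδ : 0 < δ) (q₀ : ℝ≥0∞) (hq₀ : 3 < q₀) :
    ∃ (u₀ : 𝓢(CubicHeat.E3, ℝ)) (Tmax : ℝ)
      (u : ℝ → Lp ℝ 3 (volume : Measure CubicHeat.E3)),
      CubicHeat.IsMaximalWeisslerSolution u₀ Tmax u ∧
      Tmax < δ ∧
      Tendsto (fun t => eLpNorm (u t : CubicHeat.E3 → ℝ) ∞ volume) (𝓝[<] Tmax) (𝓝 ∞) ∧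
      (∀ q : ℝ≥0∞, q₀ ≤ q →
        CubicHeat.besovNorm ψ (-2 / 3) 9 q u₀ ≤ ENNReal.ofReal δ) ∧
      CubicHeat.besovNorm ψ (-1) ∞ ∞ u₀ ≤ ENNReal.ofReal δ :=
  CubicHeat.exists_blowup_of_small_data ψ hψ δ hδ q₀ hq₀
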